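/- **Graphs.** For $n\ge 0$, let $\mathcal A_n$ be the set of isomorphism classes of finite directed graphs $G$ (parallel edges allowed, no directed cycles) with $n$ numbered *external* vertices and finitely many *internal* vertices, each internal vertex $v$ carrying a weight $w(v)\in\{-1,0,1,2,\dots\}$, such that: every internal vertex has at least one incoming and at least one outgoing edge; internal vertices of weight $-1$ have degree at least three; the first external vertex has no incoming edge and the last external vertex has no outgoing edge. Isomorphisms are pairs of bijections of vertices and of edges that are compatible with heads and tails, fix the external vertices with their numbers and preserve the weights; $\operatorname{Aut}(G)$ is the group of automorphisms. The total weight is $W(G)=|E_G|+\sum_{v\ \mathrm{internal}}w(v)$, and $\mathcal A_n(k)\subset\mathcal A_n$ is the subset of total weight $k$. **Geometric data.** Let $M$ be an $m$-dimensional Kähler manifold with complex structure $J$, Kähler form $\omega_{-1}$ and metric $g(X,Y)=\omega_{-1}(X,JY)$. Let $\omega=\frac1h\omega_{-1}+\omega_0+\omega_1h+\cdots$ be a formal deformation of the Kähler form, each $\omega_k$ being a smooth, closed, complex-valued form of type $(1,1)$. Let $z^1,\dots,z^m$ be holomorphic coordinates on an open set $U\subset M$, and let $\Phi=\frac1h\Phi_{-1}+\Phi_0+\Phi_1h+\cdots$,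 $\Phi_k\in C^\infty(U)=C^\infty(U,\mathbb C)$, be a formal potential of $\omega$ on $U$, i.e. $\omega_k|_U=i\,\partial\bar\partial\Phi_k$ for all $k\ge-1$. Put $g_{p\bar q}=g(\partial/\partial z^p,\partial/\partial\bar z^q)$ and let $(g^{\bar q p})$ be the inverse matrix. The Poisson bracket is $\{f_1,f_2\}=\omega_{-1}(X_{f_1},X_{f_2})$, where $df=\omega_{-1}(X_f,\cdot)$. **Partition functions.** For $G\in\mathcal A_n$ and $f_1,\dots,f_n\in C^\infty(U)$, attach to a vertex with $p$ incoming and $q$ outgoing edges the tensor of all derivatives $\dfrac{\partial^{p+q}F}{\partial z^{i_1}\cdots\partial z^{i_p}\,\partial\bar z^{j_1}\cdots\partial\bar z^{j_q}}$, where the indices $i$ belong to the incoming and the indices $j$ to the outgoing edges, and $F=f_k$ at the $k$-th external vertex, $F=-\Phi_w$ at an internal vertex of weight $w$. Then $\Gamma_G(f_1,\dots,f_n)$ is the function on $U$ obtained by contracting these tensors along the edges: an edge with index $\bar s$ at its tail and index $r$ at its head contributes $g^{\bar s r}$, and one sums over all indices. Put $$D_k(f_1,\dots,f_n)=\sum_{G\in\mathcal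 A_n(k)}\frac1{|\operatorname{Aut}(G)|}\,\Gamma_G(f_1,\dots,f_n).$$ **Theorem.** Every $G\in\mathcal A_2$ has a finite automorphism group and $W(G)\ge0$, and each $\mathcal A_2(k)$, $k\ge 0$, is finite, so that $$f_1\star f_2=\sum_{G\in\mathcal A_2}\frac1{|\operatorname{Aut}(G)|}\Gamma_G(f_1,f_2)\,h^{W(G)}=\sum_{k\ge0}D_k(f_1,f_2)\,h^k$$ is well defined. Extended to formal functions by $\big(\sum_iF_ih^i\big)\star\big(\sum_jG_jh^j\big)=\sum_{k,i,j}D_k(F_i,G_j)\,h^{k+i+j}$, it defines a normalized formal deformation quantization with separation of variables on $U$. That is, $\star$ is a product on $C^\infty(U)[[h]]$ which is $\mathbb C[[h]]$-bilinear and associative, with $$D_0(f_1,f_2)=f_1f_2,\qquad D_1(f_1,f_2)-D_1(f_2,f_1)=-i\{f_1,f_2\}$$ for all $f_1,f_2\in C^\infty(U)$; moreover $1\star f=f\star1=f$ for all $f\in C^\infty(U)$, and $f_1\star f_2=f_1f_2$ whenever $f_1$ is holomorphic or $f_2$ is anti-holomorphic. -/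

import Mathlib

open scoped Manifold ContDiff PowerSeries

noncomputable section

set_option linter.unusedSectionVars false

namespace KahlerStar

/-! ### Weighted acyclic graphs -/

/-- A finite, acyclic, weighted directed graph with `n` numbered external vertices `Sum.inl i` and
internal vertices `Sum.inr v`. The edge `e` points from `tail e` to `head e`; parallel edges are
allowed. Weights of internal vertices lie in `{-1, 0, 1, 2, …}`. -/
structure WGraph (n : ℕ) where
  numInt : ℕ
  numEdge : ℕ
  head : Fin numEdge → Fin n ⊕ Fin numInt
  tail : Fin numEdge → Fin n ⊕ Fin numInt
  weight : Fin numInt → ℤ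
  neg_one_le_weight : ∀ v, -1 ≤ weight v
  /-- There are no directed cycles (in particular no loops). -/
  acyclic : ∀ v, ¬ Relation.TransGen (fun a b => ∃ e, tail e = a ∧ head e = b) v v
  /-- Internal vertices are neither sources nor sinks. -/
  exists_head_eq : ∀ v : Fin numInt, ∃ e, head e = Sum.inr v
  exists_tail_eq : ∀ v : Fin numInt, ∃ e, tail e = Sum.inr v
  /-- The first external vertex is a source. -/
  first_source : ∀ i : Fin n, i.val = 0 → ∀ e, head e ≠ Sum.inl i
  /-- The last external vertex is a sink. -/
  last_sink : ∀ i : Fin n, i.val + 1 = n → ∀ e, tail e ≠ Sum.inl i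
  /-- Internal vertices of weight `-1` have degree at least three. -/
  three_le_degree : ∀ v : Fin numInt, weight v = -1 →
    3 ≤ (Finset.univ.filter fun e => head e = Sum.inr v).card +
      (Finset.univ.filter fun e => tail e = Sum.inr v).card

namespace WGraph

variable {n : ℕ}

/-- The total weight: the number of edges plus the sum of the weights of the internal vertices. -/
def totalWeight (G : WGraph n) : ℤ := (G.numEdge : ℤ) + ∑ v, G.weight v

/-- An isomorphism of graphs: bijections on vertices and on edges, compatible with heads and tails,
fixing every external vertex with its number, and preserving the weights. -/
structure Iso (G H : WGraph n) where
  onInt : Fin G.numInt ≃ Fin H.numInt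
  onEdge : Fin G.numEdge ≃ Fin H.numEdge
  head_onEdge : ∀ e, H.head (onEdge e) = Sum.map id onInt (G.head e)
  tail_onEdge : ∀ e, H.tail (onEdge e) = Sum.map id onInt (G.tail e)
  weight_onInt : ∀ v, H.weight (onInt v) = G.weight v

/-- The number of automorphisms of a graph. -/
def autCard (G : WGraph n) : ℕ := Nat.card (Iso G G)

def Iso.refl (G : WGraph n) : Iso G G where
  onInt := Equiv.refl _
  onEdge := Equiv.refl _
  head_onEdge e := by simp
  tail_onEdge e := by simp
  weight_onInt v := rfl

def Iso.symm {G H : WGraph n} (φ : Iso G H) : Iso H G where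
  onInt := φ.onInt.symm
  onEdge := φ.onEdge.symm
  head_onEdge e := by
    have h := φ.head_onEdge (φ.onEdge.symm e)
    rw [Equiv.apply_symm_apply] at h
    rw [h, Sum.map_map]; simp
  tail_onEdge e := by
    have h := φ.tail_onEdge (φ.onEdge.symm e)
    rw [Equiv.apply_symm_apply] at h
    rw [h, Sum.map_map]; simp
  weight_onInt v := by
    have h := φ.weight_onInt (φ.onInt.symm v)
    rw [Equiv.apply_symm_apply] at h
    exact h.symm

def Iso.trans {G H K : WGraph n} (φ : Iso G H) (ψ : Iso H K) : Iso G K where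
  onInt := φ.onInt.trans ψ.onInt
  onEdge := φ.onEdge.trans ψ.onEdge
  head_onEdge e := by simp [ψ.head_onEdge, φ.head_onEdge, Sum.map_map]
  tail_onEdge e := by simp [ψ.tail_onEdge, φ.tail_onEdge, Sum.map_map]
  weight_onInt v := by simp [ψ.weight_onInt, φ.weight_onInt]

instance isoSetoid (n : ℕ) : Setoid (WGraph n) where
  r G H := Nonempty (Iso G H)
  iseqv :=
    { refl := fun G => ⟨Iso.refl G⟩
      symm := by
        rintro G H ⟨φ⟩
        exact ⟨φ.symm⟩
      trans := by
        rintro G H K ⟨φ⟩ ⟨ψ⟩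
        exact ⟨φ.trans ψ⟩ }

theorem totalWeight_congr {G H : WGraph n} (φ : Iso G H) : G.totalWeight = H.totalWeight := by
  have h1 : G.numEdge = H.numEdge := by simpa using Fintype.card_congr φ.onEdge
  have h2 : ∑ v, G.weight v = ∑ v, H.weight v :=
    Fintype.sum_equiv φ.onInt _ _ fun v => (φ.weight_onInt v).symm
  simp only [totalWeight, h1, h2]

end WGraph

/-- The set `𝒜ₙ` of isomorphism classes of graphs with `n` external vertices. -/
def GraphClass (n : ℕ) : Type := Quotient (WGraph.isoSetoid n)

/-- The total weight of an isomorphism class. -/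
def GraphClass.totalWeight {n : ℕ} (c : GraphClass n) : ℤ :=
  Quotient.lift (s := WGraph.isoSetoid n) WGraph.totalWeight
    (fun _ _ ⟨φ⟩ => WGraph.totalWeight_congr φ) c

/-- The set `𝒜ₙ(k)` of isomorphism classes of total weight `k`. -/
def GraphClassOfWeight (n : ℕ) (k : ℤ) : Type := {c : GraphClass n // c.totalWeight = k}

/-- A graph representing an isomorphism class. -/
def GraphClassOfWeight.rep {n : ℕ} {k : ℤ} (c : GraphClassOfWeight n k) : WGraph n :=
  Quotient.out (s := WGraph.isoSetoid n) c.1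

/-! ### Complexified calculus on coordinate space -/

/-- The coordinate space `ℂᵐ`. -/
abbrev Coord (m : ℕ) : Type := Fin m → ℂ

/-- A complexified tangent vector of `ℂᵐ`: the pair `(u, v)` stands for `u + √-1 v` with `u`, `v`
real tangent vectors. (The complex structure `J` of `ℂᵐ` is a different operation.) -/
abbrev CTangent (m : ℕ) : Type := Coord m × Coord m

variable {m : ℕ}

/-- The complex linear extension of a real linear form to complexified tangent vectors. -/
def extendOne (L : Coord m →L[ℝ] ℂ) (X : CTangent m) : ℂ := L X.1 + Complex.I * L X.2

/-- The complex bilinear extension of a real 2-form to complexified tangent vectors. -/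
def extendTwo (η : Coord m [⋀^Fin 2]→L[ℝ] ℂ) (X Y : CTangent m) : ℂ :=
  η ![X.1, Y.1] - η ![X.2, Y.2] + Complex.I * (η ![X.1, Y.2] + η ![X.2, Y.1])

/-- The complex structure `J`, extended to complexified tangent vectors. -/
def complexStructure (X : CTangent m) : CTangent m := (Complex.I • X.1, Complex.I • X.2)

/-- The vector `∂/∂zᵖ = (∂/∂xᵖ - √-1 ∂/∂yᵖ)/2`. -/
def delZ (p : Fin m) : CTangent m :=
  (Pi.single p (1 / 2 : ℂ), -Pi.single p (Complex.I / 2))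

/-- The vector `∂/∂z̄ᵖ = (∂/∂xᵖ + √-1 ∂/∂yᵖ)/2`. -/
def delZbar (p : Fin m) : CTangent m :=
  (Pi.single p (1 / 2 : ℂ), Pi.single p (Complex.I / 2))

/-- The derivative `∂F/∂zᵖ`. -/
def dz (p : Fin m) (F : Coord m → ℂ) (y : Coord m) : ℂ := extendOne (fderiv ℝ F y) (delZ p)

/-- The derivative `∂F/∂z̄ᵖ`. -/
def dzbar (p : Fin m) (F : Coord m → ℂ) (y : Coord m) : ℂ :=
  extendOne (fderiv ℝ F y) (delZbar p)

/-- The iterated derivative of `F` in the holomorphic directions listed in `a` and the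
anti-holomorphic directions listed in `b`. -/
def iterDeriv (a b : List (Fin m)) (F : Coord m → ℂ) : Coord m → ℂ :=
  a.foldr dz (b.foldr dzbar F)

/-- The matrix `g_{p q̄} = g(∂/∂zᵖ, ∂/∂z̄^q)` for `g(X, Y) = η(X, JY)`. -/
def metricMatrix (η : Coord m [⋀^Fin 2]→L[ℝ] ℂ) : Matrix (Fin m) (Fin m) ℂ :=
  Matrix.of fun p q => extendTwo η (delZ p) (complexStructure (delZbar q))

/-- The Hamiltonian vector, for the 2-form `η`, of a function with differential `L`: the unique `X`
with `η(X, ·) = L` if `η` is real and non-degenerate. -/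
def hamiltonianVector (η : Coord m [⋀^Fin 2]→L[ℝ] ℂ) (L : Coord m →L[ℝ] ℂ) : CTangent m :=
  Classical.epsilon fun X => ∀ Y, extendTwo η X Y = extendOne L Y

/-! ### Partition functions on coordinate space -/

namespace WGraph

variable {n : ℕ}

/-- The function attached to a vertex of `G` before differentiation: `f i` at the external vertex
`i`, and minus the potential `Φ_w` at an internal vertex of weight `w`.
Here `Φ k` stands for `Φ_{k-1}`. -/
def vertexFun (G : WGraph n) (Φ : ℕ → Coord m → ℂ) (f : Fin n → Coord m → ℂ) :
    Fin n ⊕ Fin G.numInt → Coord m → ℂ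
  | Sum.inl i => f i
  | Sum.inr v => fun y => -Φ (G.weight v + 1).toNat y

/-- The component of the tensor attached to the vertex `v`: `inc e` is the index of the edge `e` at
its head (holomorphic), `out e` is its index at its tail (anti-holomorphic). -/
def vertexFactor (G : WGraph n) (Φ : ℕ → Coord m → ℂ) (f : Fin n → Coord m → ℂ)
    (inc out : Fin G.numEdge → Fin m) (v : Fin n ⊕ Fin G.numInt) : Coord m → ℂ :=
  iterDeriv
    (((List.finRange G.numEdge).filter fun e => G.head e = v).map inc)
    (((List.finRange G.numEdge).filter fun e => G.tail e = v).map out)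
    (G.vertexFun Φ f v)

/-- The partition function `Γ_G(f₁, …, fₙ)`: the tensors at the vertices are contracted along the
edges of the graph with the inverse `g^{q̄ p}` of the metric `g`. -/
def partitionFunction (G : WGraph n) (g : Coord m → Matrix (Fin m) (Fin m) ℂ)
    (Φ : ℕ → Coord m → ℂ) (f : Fin n → Coord m → ℂ) (y : Coord m) : ℂ :=
  ∑ inc : Fin G.numEdge → Fin m, ∑ out : Fin G.numEdge → Fin m,
    (∏ v, G.vertexFactor Φ f inc out v y) * ∏ e, (g y)⁻¹ (out e) (inc e)

end WGraph

/-! ### Complex manifolds, charts and formal deformations of a Kähler form -/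

variable {M : Type*} [TopologicalSpace M] [ChartedSpace (Coord m) M]

/-- A complex-valued 2-form on (the real tangent bundle of) `M`. -/
abbrev TwoForm (m : ℕ) (M : Type*) [TopologicalSpace M] [ChartedSpace (Coord m) M] : Type _ :=
  ∀ x : M, TangentSpace 𝓘(ℝ, Coord m) x [⋀^Fin 2]→L[ℝ] ℂ

/-- The expression of a 2-form in a chart `z`, i.e. its pullback under `z⁻¹`. -/
def inChart (z : OpenPartialHomeomorph M (Coord m)) (η : TwoForm m M) (y : Coord m) :
    Coord m [⋀^Fin 2]→L[ℝ] ℂ :=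
  (η (z.symm y)).compContinuousLinearMap (mfderiv 𝓘(ℝ, Coord m) 𝓘(ℝ, Coord m) z.symm y)

/-- The holomorphic coordinate charts of a complex manifold. -/
def IsHolomorphicChart (z : OpenPartialHomeomorph M (Coord m)) : Prop :=
  z ∈ IsManifold.maximalAtlas 𝓘(ℂ, Coord m) ω M

/-- A smooth closed form of type `(1,1)`. -/
structure IsClosedOneOne (η : TwoForm m M) : Prop where
  smooth : ∀ z : OpenPartialHomeomorph M (Coord m), IsHolomorphicChart z →
    ContDiffOn ℝ ∞ (inChart z η) z.target
  closed : ∀ z : OpenPartialHomeomorph M (Coord m), IsHolomorphicChart z →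
    ∀ y ∈ z.target, extDeriv (inChart z η) y = 0
  type_one_one : ∀ z : OpenPartialHomeomorph M (Coord m), IsHolomorphicChart z →
    ∀ y ∈ z.target, ∀ u v : Coord m,
      inChart z η y ![Complex.I • u, Complex.I • v] = inChart z η y ![u, v]

/-- A Kähler form: a real closed form of type `(1,1)` such that `g(X, Y) = η(X, JY)` is
positive definite. -/
structure IsKahlerForm (η : TwoForm m M) : Prop extends IsClosedOneOne η where
  real : ∀ z : OpenPartialHomeomorph M (Coord m), IsHolomorphicChart z →
    ∀ y ∈ z.target, ∀ u v : Coord m, (inChart z η y ![u, v]).im = 0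
  positive : ∀ z : OpenPartialHomeomorph M (Coord m), IsHolomorphicChart z →
    ∀ y ∈ z.target, ∀ u : Coord m, u ≠ 0 → 0 < (inChart z η y ![u, Complex.I • u]).re

/-- A formal deformation `h⁻¹ ω₋₁ + ω₀ + ω₁ h + ⋯` of the Kähler form `ω₋₁`;
here `Ω k` stands for `ω_{k-1}`. -/
structure IsFormalDeformation (Ω : ℕ → TwoForm m M) : Prop where
  kahler : IsKahlerForm (Ω 0)
  closed_one_one : ∀ k, IsClosedOneOne (Ω k)

section Chart

variable (z : OpenPartialHomeomorph M (Coord m))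

/-- The expression of a function on `U = z.source` in the coordinates `z`, extended by zero. -/
def coordRep (f : z.source → ℂ) (y : Coord m) : ℂ :=
  open Classical in if h : y ∈ z.target then f ⟨z.symm y, z.map_target h⟩ else 0

variable {z} in
theorem coordRep_of_mem {y : Coord m} (f : z.source → ℂ) (h : y ∈ z.target) :
    coordRep z f y = f ⟨z.symm y, z.map_target h⟩ := dif_pos h

/-- The algebra `C^∞(U)` of smooth complex-valued functions on `U = z.source`. -/
def SmoothFn : Subalgebra ℂ (z.source → ℂ) where
  carrier := {f | ContDiffOn ℝ ∞ (coordRep z f) z.target}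
  mul_mem' {a b} ha hb :=
    (ContDiffOn.mul ha hb).congr fun y hy => by simp [coordRep_of_mem _ hy]
  add_mem' {a b} ha hb :=
    (ContDiffOn.add ha hb).congr fun y hy => by simp [coordRep_of_mem _ hy]
  algebraMap_mem' c :=
    (contDiffOn_const (c := c)).congr fun y hy => by simp [coordRep_of_mem _ hy]

variable {z}

/-- `Φ = h⁻¹ Φ₋₁ + Φ₀ + Φ₁ h + ⋯` is a formal potential of `Ω` on `U = z.source`, that is
`Ω = √-1 ∂∂̄Φ` there, where `∂∂̄Φ_k = ∑ ∂²Φ_k/∂zᵖ∂z̄^q dzᵖ ∧ dz̄^q`. -/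
def IsFormalPotential (Ω : ℕ → TwoForm m M) (Φ : ℕ → SmoothFn z) : Prop :=
  ∀ k, ∀ y ∈ z.target, ∀ u v : Coord m,
    inChart z (Ω k) y ![u, v] =
      Complex.I * ∑ p, ∑ q, dz p (dzbar q (coordRep z (Φ k))) y *
        (u p * star (v q) - v p * star (u q))

/-- The Poisson bracket `{f₁, f₂} = ω(X_{f₁}, X_{f₂})` of the symplectic form `η`, where
`df = ω(X_f, ·)`, for functions on `U = z.source`. -/
def poissonBracket (η : TwoForm m M) (f₁ f₂ : SmoothFn z) (x : z.source) : ℂ :=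
  extendTwo (inChart z η (z x))
    (hamiltonianVector (inChart z η (z x)) (fderiv ℝ (coordRep z f₁) (z x)))
    (hamiltonianVector (inChart z η (z x)) (fderiv ℝ (coordRep z f₂) (z x)))

/-- `f` is holomorphic on `U = z.source`. -/
def IsHolomorphicFn (f : SmoothFn z) : Prop :=
  DifferentiableOn ℂ (coordRep z f) z.target

/-- `f` is anti-holomorphic on `U = z.source`. -/
def IsAntiholomorphicFn (f : SmoothFn z) : Prop :=
  DifferentiableOn ℂ (fun y => star (coordRep z f y)) z.target

/-- The operator `D_k(f₁, …, fₙ) = ∑_{G ∈ 𝒜ₙ(k)} Γ_G(f₁, …, fₙ) / |Aut G|`. -/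
def graphOperator (Ω : ℕ → TwoForm m M) (Φ : ℕ → SmoothFn z) {n : ℕ} (k : ℤ)
    (f : Fin n → SmoothFn z) (x : z.source) : ℂ :=
  ∑ᶠ c : GraphClassOfWeight n k, (1 / (c.rep.autCard : ℂ)) *
    c.rep.partitionFunction (fun y => metricMatrix (inChart z (Ω 0) y))
      (fun j => coordRep z (Φ j)) (fun i => coordRep z (f i)) (z x)

/-- A formal deformation quantization of the algebra `C^∞(U)` with bracket `bracket`: an associative
and `ℂ⟦h⟧`-bilinear product `f₁ ⋆ f₂ = ∑ C_k(f₁, f₂) hᵏ` on `C^∞(U)⟦h⟧` with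
`C₀(f₁, f₂) = f₁ f₂` and `C₁(f₁, f₂) - C₁(f₂, f₁) = -√-1 {f₁, f₂}`. -/
structure IsDeformationQuantization (bracket : SmoothFn z → SmoothFn z → z.source → ℂ)
    (mul : (SmoothFn z)⟦X⟧ → (SmoothFn z)⟦X⟧ → (SmoothFn z)⟦X⟧) : Prop where
  assoc : ∀ F G H, mul (mul F G) H = mul F (mul G H)
  add_left : ∀ F G H, mul (F + G) H = mul F H + mul G H
  add_right : ∀ F G H, mul F (G + H) = mul F G + mul F H
  smul_left : ∀ (c : ℂ⟦X⟧) (F G), mul (c • F) G = c • mul F G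
  smul_right : ∀ (c : ℂ⟦X⟧) (F G), mul F (c • G) = c • mul F G
  zeroth : ∀ f₁ f₂ : SmoothFn z,
    PowerSeries.coeff 0 (mul (PowerSeries.C f₁) (PowerSeries.C f₂)) = f₁ * f₂
  first : ∀ (f₁ f₂ : SmoothFn z) (x : z.source),
    (PowerSeries.coeff 1 (mul (PowerSeries.C f₁) (PowerSeries.C f₂))).1 x -
      (PowerSeries.coeff 1 (mul (PowerSeries.C f₂) (PowerSeries.C f₁))).1 x =
      -Complex.I * bracket f₁ f₂ x

/-- The product is normalized: `1 ⋆ f = f ⋆ 1 = f`. -/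
def IsNormalized (mul : (SmoothFn z)⟦X⟧ → (SmoothFn z)⟦X⟧ → (SmoothFn z)⟦X⟧) : Prop :=
  ∀ f : SmoothFn z, mul 1 (PowerSeries.C f) = PowerSeries.C f ∧
    mul (PowerSeries.C f) 1 = PowerSeries.C f

/-- Separation of variables: `f₁ ⋆ f₂ = f₁ f₂` if `f₁` is holomorphic or `f₂` anti-holomorphic. -/
def HasSeparationOfVariables
    (mul : (SmoothFn z)⟦X⟧ → (SmoothFn z)⟦X⟧ → (SmoothFn z)⟦X⟧) : Prop :=
  ∀ f₁ f₂ : SmoothFn z, IsHolomorphicFn f₁ ∨ IsAntiholomorphicFn f₂ →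
    mul (PowerSeries.C f₁) (PowerSeries.C f₂) = PowerSeries.C (f₁ * f₂)

/-- `mul` is the product on `C^∞(U)⟦h⟧` given by `f₁ ⋆ f₂ = ∑ D_k(f₁, f₂) hᵏ`, extended to formal
functions: the coefficient of `hᴺ` in `F ⋆ G` is the sum of `D_k(F_i, G_j)` over
`k + i + j = N`. -/
def IsGraphProduct (Ω : ℕ → TwoForm m M) (Φ : ℕ → SmoothFn z)
    (mul : (SmoothFn z)⟦X⟧ → (SmoothFn z)⟦X⟧ → (SmoothFn z)⟦X⟧) : Prop :=
  ∀ (F G : (SmoothFn z)⟦X⟧) (N : ℕ) (x : z.source), (PowerSeries.coeff N (mul F G)).1 x =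
    ∑ a ∈ Finset.HasAntidiagonal.antidiagonal N, ∑ b ∈ Finset.HasAntidiagonal.antidiagonal a.2,
      graphOperator Ω Φ a.1 ![PowerSeries.coeff b.1 F, PowerSeries.coeff b.2 G] x

end Chart

end KahlerStar

end

/-! Write `pot = h Φ = Φ₋₁ + Φ₀ h + ⋯` and `R_l u = (∂̄_l pot) u + h ∂̄_l u`. Following Karabegov,
associativity is reduced to one statement: every left multiplication `L_f = f ⋆ ·` commutes with
every `R_l` (`star_rightMul`). Given this, `L_f L_g - L_{f⋆g}` commutes with all `R_l`, kills `1` by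
normalization, and at each order in `h` and each point depends only on a finite jet in the
holomorphic directions, because the last external vertex is a sink. If such an operator is divisible
by `h^r`, its coefficient at order `r` commutes with multiplication by `w_l = ∂̄_l Φ₋₁`. Since the
Hessian of `Φ₋₁` is invertible, suitable combinations of the `w_l - w_l(x)` are coordinates for
holomorphic jets at `x`. A jet functional which vanishes on `1` and on multiples of these
coordinates is zero, so the operator is divisible by `h^(r+1)`, and hence vanishes
(`eq_zero_of_commute`, `eq_zero_of_jet`).

The commutation is a cancellation between graphs. In `f ⋆ (∂̄_l pot · u)` the Leibniz rule at the
last vertex moves a set of its incoming edges to a new vertex carrying `∂̄_l pot`: the empty set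
gives `∂̄_l pot · (f ⋆ u)`, the other sets give graphs with a marked sink (`graphSum_mul`). In `h
∂̄_l (f ⋆ u)` the derivative falls on `f`, on `u`, on an internal vertex, or on the inverse metric
of an edge. A derivative at an internal vertex is recorded as a mark, an extra outgoing half-edge.
Vertices of weight `-1` need degree three, so the leading potential is missing exactly at bivalent
vertices, and two corrections arise. A marked sink with one incoming edge and the leading potential
is contracted by `g ∂∂̄Φ₋₁ = 1`, which moves `∂̄_l` to its neighbour (`leafSum_option`). An unmarked
bivalent vertex with the leading potential is the derivative of `g` on the edge through it
(`bivalentSum_option`). Then all terms cancel.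

Graphs are labelled and weighted by `1/(a! b!)` for `a` internal vertices and `b` edges;
orbit-stabilizer turns this into `1/|Aut G|`. All weights are treated at once by attaching the whole
series `pot` to a vertex, so that the order in `h` is `b - a` plus the sum of the shifted weights `w
+ 1`. Counting half-edges, and using that each bivalent vertex carries a factor `h`, bounds the
number of edges by three times the order plus two (`card_bivalent`). This gives finiteness and
nonnegativity, and makes truncations by the number of edges converge `h`-adically. -/

noncomputable section

set_option linter.unusedSectionVars false

namespace KahlerStar

open Finset

/-! ### Potential algebras and contractions along graphs. -/

/-- A commutative algebra with commuting derivations `∂_p = d (inl p)`, `∂̄_q = d (inr q)`, a potential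
`pot` with leading part `lead`, and the inverse `g q p` of the matrix `∂_p ∂̄_q lead`. -/
structure PotentialAlgebra (𝕜 R ι : Type*) [CommRing 𝕜] [CommRing R] [Algebra 𝕜 R] [Fintype ι]
    [DecidableEq ι] where
  d : ι ⊕ ι → Derivation 𝕜 R R
  comm : ∀ i j x, d i (d j x) = d j (d i x)
  pot : R
  lead : R
  g : ι → ι → R
  g_contract : ∀ q l, ∑ p, g q p * d (Sum.inl p) (d (Sum.inr l) lead) = if q = l then 1 else 0
  -- The derivative of an inverse matrix. Anti-holomorphic directions suffice, since only `∂̄_l` is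
  -- ever applied to a whole contraction.
  d_g : ∀ l q p, d (Sum.inr l) (g q p) =
    -∑ r, ∑ s, g q r * d (Sum.inl r) (d (Sum.inr s) (d (Sum.inr l) lead)) * g s p

namespace PotentialAlgebra

variable {𝕜 R ι : Type*} [CommRing 𝕜] [CommRing R] [Algebra 𝕜 R] [Fintype ι] [DecidableEq ι]
variable (D : PotentialAlgebra 𝕜 R ι)

instance leftCommutative_comp : LeftCommutative
    (fun (i : ι ⊕ ι) (a : R →ₗ[𝕜] R) => (D.d i).toLinearMap ∘ₗ a) where
  left_comm i j a := by
    ext x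
    exact D.comm i j _

/-- The iterated derivative along a multiset of directions. -/
def iter (s : Multiset (ι ⊕ ι)) : R →ₗ[𝕜] R :=
  s.foldr (fun i a => (D.d i).toLinearMap ∘ₗ a) LinearMap.id

@[simp] theorem iter_zero (x : R) : D.iter 0 x = x := rfl

theorem iter_cons (i : ι ⊕ ι) (s : Multiset (ι ⊕ ι)) (x : R) :
    D.iter (i ::ₘ s) x = D.d i (D.iter s x) := by
  simp [iter]

@[simp] theorem iter_singleton (i : ι ⊕ ι) (x : R) : D.iter {i} x = D.d i x := by
  rw [← Multiset.cons_zero, iter_cons, iter_zero]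

theorem iter_add (s t : Multiset (ι ⊕ ι)) (x : R) :
    D.iter (s + t) x = D.iter s (D.iter t x) := by
  induction s using Multiset.induction_on with
  | empty => simp
  | cons i s ih => rw [Multiset.cons_add, iter_cons, ih, iter_cons]

theorem d_iter (i : ι ⊕ ι) (s : Multiset (ι ⊕ ι)) (x : R) :
    D.d i (D.iter s x) = D.iter s (D.d i x) := by
  rw [← iter_singleton, ← iter_add, add_comm, iter_add, iter_singleton]

/-- The Leibniz rule for iterated derivatives. -/
theorem iter_sum_mul {E : Type*} [DecidableEq E] (F : Finset E) (c : E → Multiset (ι ⊕ ι))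
    (hc : ∀ e, ∃ i, c e = {i}) (x y : R) :
    D.iter (∑ e ∈ F, c e) (x * y) =
      ∑ S ∈ F.powerset, D.iter (∑ e ∈ S, c e) x * D.iter (∑ e ∈ F \ S, c e) y := by
  induction F using Finset.induction_on with
  | empty => simp
  | insert a F ha ih =>
    obtain ⟨i, hi⟩ := hc a
    rw [sum_insert ha, iter_add, ih, sum_powerset_insert ha, map_sum, hi, ← sum_add_distrib]
    refine sum_congr rfl fun S hS => ?_
    have haS : a ∉ S := fun h => ha (mem_powerset.1 hS h)
    have h1 : insert a F \ S = insert a (F \ S) := insert_sdiff_of_notMem _ haS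
    have h2 : insert a F \ insert a S = F \ S := by
      rw [insert_sdiff_insert, sdiff_insert_of_notMem ha]
    rw [h1, h2, sum_insert haS, sum_insert (by simp [ha]), iter_add, iter_add, hi, iter_singleton,
      iter_singleton, iter_singleton, Derivation.leibniz]
    simp only [smul_eq_mul]
    ring

section Gam

variable {X E : Type*} [Fintype X] [DecidableEq X] [Fintype E] [DecidableEq E]

/-- The directions at the vertex `x`: the edge `e` has index `(k e).1` at its tail and `(k e).2` at its
head. -/
def lab (t h : E → X) (k : E → ι × ι) (x : X) : Multiset (ι ⊕ ι) :=
  ∑ e, ((if t e = x then {Sum.inr (k e).1} else 0) + (if h e = x then {Sum.inl (k e).2} else 0))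

/-- The product of the tensor components at the vertices. -/
def vprod (φ : X → R) (t h : E → X) (k : E → ι × ι) : R := ∏ x, D.iter (lab t h k x) (φ x)

/-- The contraction of the tensors attached to the vertices along the edges. -/
def Gam (φ : X → R) (t h : E → X) : R :=
  ∑ k : E → ι × ι, D.vprod φ t h k * ∏ e, D.g (k e).1 (k e).2

theorem vprod_update (φ : X → R) (t h : E → X) (k : E → ι × ι) (x : X) (a : R) :
    D.vprod (Function.update φ x a) t h k =
      D.iter (lab t h k x) a * ∏ y ∈ univ.erase x, D.iter (lab t h k y) (φ y) := by
  rw [vprod, ← mul_prod_erase _ _ (mem_univ x), Function.update_self]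
  congr 1
  refine prod_congr rfl fun y hy => ?_
  rw [Function.update_of_ne (ne_of_mem_erase hy)]

theorem Gam_update_add (φ : X → R) (t h : E → X) (x : X) (a b : R) :
    D.Gam (Function.update φ x (a + b)) t h =
      D.Gam (Function.update φ x a) t h + D.Gam (Function.update φ x b) t h := by
  simp only [Gam, vprod_update, map_add, add_mul, sum_add_distrib]

theorem Gam_update_smul (φ : X → R) (t h : E → X) (x : X) (c : 𝕜) (a : R) :
    D.Gam (Function.update φ x (c • a)) t h = c • D.Gam (Function.update φ x a) t h := by
  simp only [Gam, vprod_update, map_smul, smul_mul_assoc, smul_sum]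

/-- The contraction in which the derivative falls on the factor of the edge `e`. -/
def edgeDer (φ : X → R) (t h : E → X) (l : ι) (e : E) : R :=
  ∑ k : E → ι × ι, D.vprod φ t h k *
    ((∏ e' ∈ univ.erase e, D.g (k e').1 (k e').2) * D.d (Sum.inr l) (D.g (k e).1 (k e).2))

theorem d_prod (i : ι ⊕ ι) {Y : Type*} [DecidableEq Y] (s : Finset Y) (F : Y → R) :
    D.d i (∏ y ∈ s, F y) = ∑ y ∈ s, (∏ z ∈ s.erase y, F z) * D.d i (F y) := by
  induction s using Finset.induction_on with
  | empty => simp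
  | insert a s ha ih =>
    rw [prod_insert ha, Derivation.leibniz, ih, sum_insert ha, erase_insert ha, smul_eq_mul,
      smul_eq_mul, mul_sum, add_comm]
    congr 1
    refine sum_congr rfl fun y hy => ?_
    have hay : a ≠ y := fun h => ha (h.symm ▸ hy)
    rw [erase_insert_of_ne hay, prod_insert (fun h => ha (mem_of_mem_erase h)),
      mul_assoc]

/-- Leibniz rule: the derivative falls either on a vertex tensor, where it commutes past the other
derivatives onto the attached function, or on the inverse metric of one edge. -/
theorem d_Gam (φ : X → R) (t h : E → X) (l : ι) :
    D.d (Sum.inr l) (D.Gam φ t h) =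
      ∑ x, D.Gam (Function.update φ x (D.d (Sum.inr l) (φ x))) t h +
        ∑ e, D.edgeDer φ t h l e := by
  have h1 : ∑ x, D.Gam (Function.update φ x (D.d (Sum.inr l) (φ x))) t h =
      ∑ k : E → ι × ι, D.d (Sum.inr l) (D.vprod φ t h k) * ∏ e, D.g (k e).1 (k e).2 := by
    simp only [Gam]
    rw [sum_comm]
    refine sum_congr rfl fun k _ => ?_
    rw [← sum_mul]
    congr 1
    rw [vprod, d_prod]
    refine sum_congr rfl fun x _ => ?_
    rw [vprod_update, d_iter, mul_comm]
  have h2 : ∑ e, D.edgeDer φ t h l e = ∑ k : E → ι × ι, D.vprod φ t h k *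
      D.d (Sum.inr l) (∏ e, D.g (k e).1 (k e).2) := by
    simp only [edgeDer]
    rw [sum_comm]
    refine sum_congr rfl fun k _ => ?_
    rw [d_prod, mul_sum]
  rw [h1, h2, Gam, map_sum, ← sum_add_distrib]
  refine sum_congr rfl fun k _ => ?_
  rw [Derivation.leibniz, smul_eq_mul, smul_eq_mul]
  ring

/-- Serves twice: it makes partition functions invariant under isomorphism, and it lets a
distinguished vertex or edge be moved to a standard position. -/
theorem Gam_reindex {X' E' : Type*} [Fintype X'] [DecidableEq X'] [Fintype E'] [DecidableEq E']
    (σ : X ≃ X') (τ : E ≃ E') (φ : X → R) (φ' : X' → R) (t h : E → X) (t' h' : E' → X')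
    (hφ : ∀ x, φ' (σ x) = φ x) (ht : ∀ e, t' (τ e) = σ (t e)) (hh : ∀ e, h' (τ e) = σ (h e)) :
    D.Gam φ t h = D.Gam φ' t' h' := by
  refine Fintype.sum_equiv (τ.arrowCongr (Equiv.refl _)) _ _ fun k => ?_
  congr 1
  · refine Fintype.prod_equiv σ _ _ fun x => ?_
    rw [hφ]
    congr 1
    congr 1
    refine Fintype.sum_equiv τ _ _ fun e => ?_
    simp [ht, hh]
  · refine Fintype.prod_equiv τ _ _ fun e => ?_
    simp

end Gam

/-! ### Contractions under adding one vertex. -/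

section AddVertex

variable {Y V E : Type*} [Fintype Y] [DecidableEq Y] [Fintype V] [DecidableEq V] [Fintype E]
  [DecidableEq E]

/-- The inclusion of the vertices into those with one more internal vertex. -/
def emb : Y ⊕ V → Y ⊕ Option V := Sum.map id some

omit [Fintype Y] [DecidableEq Y] [Fintype V] [DecidableEq V] in
theorem emb_inj {x y : Y ⊕ V} : (emb x : Y ⊕ Option V) = emb y ↔ x = y :=
  (Sum.map_injective.2 ⟨Function.injective_id, Option.some_injective V⟩).eq_iff

theorem prod_addVertex {T : Type*} [CommMonoid T] (F : Y ⊕ Option V → T) :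
    ∏ x, F x = F (Sum.inr none) * ∏ x : Y ⊕ V, F (emb x) := by
  rw [Fintype.prod_sum_type, Fintype.prod_sum_type, Fintype.prod_option]
  simp only [emb, Sum.map_inl, Sum.map_inr, id]
  rw [mul_left_comm]

/-- Attach the function `P` to the new vertex. -/
def extFun (φ : Y ⊕ V → R) (P : R) : Y ⊕ Option V → R :=
  Sum.elim (φ ∘ Sum.inl) fun o => o.elim P (φ ∘ Sum.inr)

@[simp] theorem extFun_emb (φ : Y ⊕ V → R) (P : R) (x : Y ⊕ V) : extFun φ P (emb x) = φ x := by
  cases x <;> rfl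

@[simp] theorem extFun_none (φ : Y ⊕ V → R) (P : R) : extFun φ P (Sum.inr none) = P := rfl

@[simp] theorem emb_ne_none (x : Y ⊕ V) : (emb x : Y ⊕ Option V) ≠ Sum.inr none := by
  cases x <;> simp [emb]

@[simp] theorem none_ne_emb (x : Y ⊕ V) : (Sum.inr none : Y ⊕ Option V) ≠ emb x :=
  (emb_ne_none x).symm

theorem vprod_extFun (φ : Y ⊕ V → R) (P : R) (t h : E → Y ⊕ Option V) (k : E → ι × ι) :
    D.vprod (extFun φ P) t h k = D.iter (lab t h k (Sum.inr none)) P *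
      ∏ x, D.iter (lab t h k (emb x)) (φ x) := by
  rw [vprod, prod_addVertex]
  simp

/-- An isolated vertex contributes a factor. -/
theorem Gam_isolated (φ : Y ⊕ V → R) (P : R) (t h : E → Y ⊕ V) :
    D.Gam (extFun φ P) (fun e => emb (t e)) (fun e => emb (h e)) = P * D.Gam φ t h := by
  rw [Gam, Gam, mul_sum]
  refine sum_congr rfl fun k _ => ?_
  rw [vprod_extFun, ← mul_assoc]
  congr 2
  · simp [lab]
  · simp [lab, emb_inj, vprod]

/-- The product rule at a sink: every incoming edge acts on one of the two factors, and one of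
the factors is moved to a new vertex. -/
theorem Gam_mul_sink (φ : Y ⊕ V → R) (y : Y ⊕ V) (P Q : R) (t h : E → Y ⊕ V)
    (ht : ∀ e, t e ≠ y) :
    D.Gam (Function.update φ y (P * Q)) t h =
      ∑ S ∈ (univ.filter fun e => h e = y).powerset,
        D.Gam (extFun (Function.update φ y Q) P) (fun e => emb (t e))
          (fun e => if e ∈ S then Sum.inr none else emb (h e)) := by
  simp only [Gam]
  rw [sum_comm]
  refine sum_congr rfl fun k _ => ?_
  rw [← sum_mul]
  congr 1
  have h0 : lab t h k y =
      ∑ e ∈ univ.filter (fun e => h e = y), {(Sum.inl (k e).2 : ι ⊕ ι)} := by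
    rw [lab, sum_filter]
    refine sum_congr rfl fun e _ => ?_
    simp [ht e]
  -- The directions at `y` are indexed by edges, so the Leibniz rule runs over subsets of edges
  -- without multiplicities; `S` is the set of edges acting on `P`.
  rw [vprod_update, h0, iter_sum_mul _ _ _ fun e => ⟨_, rfl⟩, sum_mul]
  refine sum_congr rfl fun S hS => ?_
  have hS' : ∀ e ∈ S, h e = y := fun e he => by simpa using mem_powerset.1 hS he
  rw [vprod_extFun, ← mul_prod_erase _ _ (mem_univ y), Function.update_self, mul_assoc]
  have hsum : ∀ (T : Finset E) (c : E → Multiset (ι ⊕ ι)),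
      ∑ e ∈ T, c e = ∑ e, if e ∈ T then c e else 0 := fun T c => by
    rw [sum_ite_mem, univ_inter]
  congr 1
  · congr 2
    rw [lab, hsum S]
    refine sum_congr rfl fun e _ => ?_
    by_cases heS : e ∈ S <;> simp [heS]
  congr 1
  · congr 2
    rw [lab, hsum (_ \ S)]
    refine sum_congr rfl fun e _ => ?_
    by_cases heS : e ∈ S
    · simp [heS, emb_inj, ht e]
    · simp [heS, emb_inj, ht e]
  · refine prod_congr rfl fun x hx => ?_
    rw [Function.update_of_ne (ne_of_mem_erase hx)]
    congr 2
    rw [lab, lab]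
    refine sum_congr rfl fun e _ => ?_
    by_cases heS : e ∈ S
    · have : y ≠ x := (ne_of_mem_erase hx).symm
      simp [heS, emb_inj, hS' e heS, this]
    · simp [heS, emb_inj]

theorem sum_piOption {α M : Type*} [Fintype α] [AddCommMonoid M] (F : (Option E → α) → M) :
    ∑ k, F k = ∑ a, ∑ k : E → α, F (fun o => o.elim a k) := by
  rw [← Fintype.sum_prod_type']
  refine Fintype.sum_equiv (Equiv.piOptionEquivProd (β := fun _ => α)) _ _ fun k => ?_
  congr 1
  funext o
  cases o <;> rfl

/-- Contraction of a vertex with a single incoming edge. -/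
theorem Gam_contract (φ : Y ⊕ V → R) (y : Y ⊕ V) (l : ι) (t h : E → Y ⊕ V) :
    D.Gam (extFun φ (D.d (Sum.inr l) D.lead)) (fun o : Option E => o.elim (emb y) fun e => emb (t e))
        (fun o : Option E => o.elim (Sum.inr none) fun e => emb (h e)) =
      D.Gam (Function.update φ y (D.d (Sum.inr l) (φ y))) t h := by
  rw [Gam, sum_piOption, sum_comm, Gam]
  refine sum_congr rfl fun k _ => ?_
  simp only [vprod_extFun, Fintype.prod_option, Option.elim_none, Option.elim_some]
  have h1 : ∀ a : ι × ι, lab (fun o : Option E => o.elim (emb y) fun e => emb (t e))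
      (fun o : Option E => o.elim (Sum.inr none) fun e => emb (h e))
      (fun o => o.elim a k) (Sum.inr none : Y ⊕ Option V) = {Sum.inl a.2} := by
    intro a
    simp [lab]
  have h2 : ∀ (a : ι × ι) (x : Y ⊕ V), lab (fun o : Option E => o.elim (emb y) fun e => emb (t e))
      (fun o : Option E => o.elim (Sum.inr none) fun e => emb (h e))
      (fun o => o.elim a k) (emb x : Y ⊕ Option V) =
        (if y = x then {Sum.inr a.1} else 0) + lab t h k x := by
    intro a x
    simp [lab, emb_inj]
  have h3 : ∀ a : ι × ι, ∏ x, D.iter ((if y = x then {Sum.inr a.1} else 0) + lab t h k x) (φ x) =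
      D.vprod (Function.update φ y (D.d (Sum.inr a.1) (φ y))) t h k := by
    intro a
    rw [vprod_update, ← mul_prod_erase _ _ (mem_univ y), if_pos rfl, iter_add, iter_singleton, d_iter]
    congr 1
    refine prod_congr rfl fun x hx => ?_
    rw [if_neg (ne_of_mem_erase hx).symm, zero_add]
  have h4 : ∀ a : ι × ι, D.iter {Sum.inl a.2} (D.d (Sum.inr l) D.lead) *
        D.vprod (Function.update φ y (D.d (Sum.inr a.1) (φ y))) t h k *
          (D.g a.1 a.2 * ∏ e, D.g (k e).1 (k e).2) =
      (D.g a.1 a.2 * D.d (Sum.inl a.2) (D.d (Sum.inr l) D.lead)) *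
        (D.vprod (Function.update φ y (D.d (Sum.inr a.1) (φ y))) t h k *
          ∏ e, D.g (k e).1 (k e).2) := by
    intro a
    rw [iter_singleton]
    ring
  simp only [h1, h2, h3]
  rw [sum_congr rfl fun a _ => h4 a, Fintype.sum_prod_type]
  -- Summing over the head index of the new edge pairs `g` with the Hessian of `lead`. The resulting
  -- Kronecker delta erases the vertex and its edge and leaves `∂̄_l` at the tail `y`.
  simp only [← sum_mul, D.g_contract]
  simp

/-- The derivative of the factor of an edge inserts a vertex into that edge. -/
theorem Gam_insert (φ : Y ⊕ V → R) (l : ι) (t h : E → Y ⊕ V) (e₀ : E) :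
    D.Gam (extFun φ (-D.d (Sum.inr l) D.lead))
        (fun o : Option E => o.elim (Sum.inr none) fun e => emb (t e))
        (fun o : Option E => o.elim (emb (h e₀)) fun e => if e = e₀ then Sum.inr none else emb (h e)) =
      D.edgeDer φ t h l e₀ := by
  -- After the insertion `e₀` ends at the new vertex and `none` continues to the old head.
  -- Exchanging the two head indices makes `k e₀` the outer pair of indices, as before the
  -- insertion, and the other pair the indices at the new vertex.
  have hinv : Function.Involutive (fun ak : (ι × ι) × (E → ι × ι) =>
      ((ak.1.1, (ak.2 e₀).2), Function.update ak.2 e₀ ((ak.2 e₀).1, ak.1.2))) := by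
    rintro ⟨⟨s, p⟩, k⟩
    simp
  rw [Gam, sum_piOption, ← Fintype.sum_prod_type', ← Equiv.sum_comp hinv.toPerm, edgeDer,
    Fintype.sum_prod_type_right]
  refine sum_congr rfl fun k _ => ?_
  simp only [vprod_extFun, Fintype.prod_option, Option.elim_none, Option.elim_some, Function.Involutive.coe_toPerm]
  have h1 : ∀ a : ι × ι, lab (fun o : Option E => o.elim (Sum.inr none) fun e => emb (t e))
      (fun o : Option E => o.elim (emb (h e₀)) fun e => if e = e₀ then Sum.inr none else emb (h e))
      (fun o => o.elim (a.1, (k e₀).2) (Function.update k e₀ ((k e₀).1, a.2)))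
      (Sum.inr none : Y ⊕ Option V) = {Sum.inr a.1} + {Sum.inl a.2} := by
    intro a
    simp only [lab, Fintype.sum_option, Option.elim]
    congr 1
    · simp
    · rw [sum_eq_single e₀]
      · simp
      · intro e _ he
        simp [he]
      · simp
  have h2 : ∀ (a : ι × ι) (x : Y ⊕ V),
      lab (fun o : Option E => o.elim (Sum.inr none) fun e => emb (t e))
      (fun o : Option E => o.elim (emb (h e₀)) fun e => if e = e₀ then Sum.inr none else emb (h e))
      (fun o => o.elim (a.1, (k e₀).2) (Function.update k e₀ ((k e₀).1, a.2)))
      (emb x : Y ⊕ Option V) = lab t h k x := by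
    intro a x
    simp only [lab, Fintype.sum_option, Option.elim, none_ne_emb, if_false, zero_add]
    rw [← add_sum_erase _ _ (mem_univ e₀), ← add_sum_erase univ _ (mem_univ e₀), ← add_assoc]
    congr 1
    · simp [emb_inj, add_comm]
    · refine sum_congr rfl fun e he => ?_
      have := ne_of_mem_erase he
      simp [this, emb_inj]
  have h5 : ∀ a : ι × ι, ∏ e, D.g (Function.update k e₀ ((k e₀).1, a.2) e).1
      (Function.update k e₀ ((k e₀).1, a.2) e).2 =
      D.g (k e₀).1 a.2 * ∏ e ∈ univ.erase e₀, D.g (k e).1 (k e).2 := by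
    intro a
    rw [← mul_prod_erase _ _ (mem_univ e₀), Function.update_self]
    congr 1
    refine prod_congr rfl fun e he => ?_
    rw [Function.update_of_ne (ne_of_mem_erase he)]
  simp only [h1, h2, h5]
  rw [D.d_g, Fintype.sum_prod_type_right]
  simp only [mul_neg, mul_sum, vprod, map_neg, neg_mul, sum_neg_distrib, iter_add, iter_singleton]
  congr 1
  refine sum_congr rfl fun r _ => sum_congr rfl fun s _ => ?_
  rw [D.comm (Sum.inr s)]
  ring

end AddVertex

end PotentialAlgebra
end KahlerStar
end

/-! ### Labelled graphs with a mark, and the derivative of the graph sum. -/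

noncomputable section

set_option linter.unusedSectionVars false

namespace KahlerStar

open Finset

/-- Pairs of tail and head functions of graphs with two external vertices, internal vertices `V` and
edges `E`. -/
abbrev EndPair (V E : Type*) : Type _ := (E → Fin 2 ⊕ V) × (E → Fin 2 ⊕ V)

section Degree

variable {X E : Type*} [DecidableEq X] [Fintype E]

/-- The number of edges which `h` sends to `x`. -/
def deg (h : E → X) (x : X) : ℕ := ∑ e, if h e = x then 1 else 0

theorem deg_eq_zero {h : E → X} {x : X} : deg h x = 0 ↔ ∀ e, h e ≠ x := by
  simp [deg]

theorem one_le_deg {h : E → X} {x : X} : 1 ≤ deg h x ↔ ∃ e, h e = x := by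
  rw [Nat.one_le_iff_ne_zero, Ne, deg_eq_zero]
  push Not
  rfl

theorem deg_eq_card (h : E → X) (x : X) : deg h x = (univ.filter fun e => h e = x).card := by
  rw [deg, card_filter]

theorem deg_option (h : Option E → X) (x : X) :
    deg h x = (if h none = x then 1 else 0) + deg (fun e => h (some e)) x := by
  rw [deg, Fintype.sum_option, deg]

theorem deg_congr {X' : Type*} [DecidableEq X'] {h : E → X} {h' : E → X'} {x : X} {x' : X'}
    (H : ∀ e, h e = x ↔ h' e = x') : deg h x = deg h' x' := by
  simp only [deg, H]

theorem deg_equiv {X' E' : Type*} [DecidableEq X'] [Fintype E'] (τ : E ≃ E') {h : E → X} {h' : E' → X'}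
    {x : X} {x' : X'} (H : ∀ e, h' (τ e) = x' ↔ h e = x) : deg h' x' = deg h x := by
  rw [deg, deg, ← τ.sum_comp]
  simp only [H]

theorem sum_ite_deg_eq_one {R : Type*} [AddCommMonoid R] {h : E → X} {x : X} (hx : deg h x = 1) (a : R) :
    ∑ e, (if h e = x then a else 0) = a := by
  rw [deg_eq_card] at hx
  rw [← sum_filter, sum_const, hx, one_smul]

end Degree

variable {V E : Type*} [Fintype V] [DecidableEq V] [Fintype E] [DecidableEq E]

/-- The indicator of the marked vertex `y` on the internal vertices. -/
def markAt (y : Fin 2 ⊕ V) (v : V) : ℕ := if y = Sum.inr v then 1 else 0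

@[simp] theorem markAt_inl (i : Fin 2) : markAt (Sum.inl i : Fin 2 ⊕ V) = 0 := by
  funext v
  simp [markAt]

/-- The graphs of the class `𝒜₂`, apart from the condition on the weights, where the internal vertex `v` has
`μ v` additional outgoing half-edges. -/
structure Admissible (μ : V → ℕ) (G : EndPair V E) : Prop where
  acyc : ∃ r : Fin 2 ⊕ V → ℕ, ∀ e, r (G.1 e) < r (G.2 e)
  src : ∀ e, G.2 e ≠ Sum.inl 0
  snk : ∀ e, G.1 e ≠ Sum.inl 1
  in_pos : ∀ v : V, 1 ≤ deg G.2 (Sum.inr v)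
  out_pos : ∀ v : V, 1 ≤ deg G.1 (Sum.inr v) + μ v

/-- Renaming of the internal vertices and of the edges. -/
def EndPair.map {V' E' : Type*} (σ : V ≃ V') (τ : E ≃ E') : EndPair V E ≃ EndPair V' E' :=
  (τ.arrowCongr ((Equiv.refl _).sumCongr σ)).prodCongr (τ.arrowCongr ((Equiv.refl _).sumCongr σ))

section Map

variable {V' E' : Type*} [Fintype V'] [DecidableEq V'] [Fintype E'] [DecidableEq E']
  (σ : V ≃ V') (τ : E ≃ E') (G : EndPair V E)

theorem map_fst (e : E) : (G.map σ τ).1 (τ e) = Sum.map id σ (G.1 e) := by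
  simp [EndPair.map]

theorem map_snd (e : E) : (G.map σ τ).2 (τ e) = Sum.map id σ (G.2 e) := by
  simp [EndPair.map]

theorem sumMap_inj {x y : Fin 2 ⊕ V} : Sum.map id σ x = Sum.map id σ y ↔ x = y :=
  (Sum.map_injective.2 ⟨Function.injective_id, σ.injective⟩).eq_iff

theorem deg_map_fst (x : Fin 2 ⊕ V) : deg (G.map σ τ).1 (Sum.map id σ x) = deg G.1 x :=
  deg_equiv τ fun e => by rw [map_fst, sumMap_inj]

theorem deg_map_snd (x : Fin 2 ⊕ V) : deg (G.map σ τ).2 (Sum.map id σ x) = deg G.2 x :=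
  deg_equiv τ fun e => by rw [map_snd, sumMap_inj]

theorem deg_map_fst_inr (v : V) : deg (G.map σ τ).1 (Sum.inr (σ v)) = deg G.1 (Sum.inr v) :=
  deg_map_fst σ τ G (Sum.inr v)

theorem deg_map_snd_inr (v : V) : deg (G.map σ τ).2 (Sum.inr (σ v)) = deg G.2 (Sum.inr v) :=
  deg_map_snd σ τ G (Sum.inr v)

theorem admissible_map_iff {μ : V → ℕ} {μ' : V' → ℕ} (hμ : ∀ v, μ' (σ v) = μ v) :
    Admissible μ' (G.map σ τ) ↔ Admissible μ G := by
  have hl : ∀ (i : Fin 2), (Sum.inl i : Fin 2 ⊕ V') = Sum.map id σ (Sum.inl i) := fun i => rfl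
  constructor
  · rintro ⟨⟨r, hr⟩, h1, h2, h3, h4⟩
    refine ⟨⟨fun x => r (Sum.map id σ x), fun e => ?_⟩, fun e => ?_, fun e => ?_, fun v => ?_, fun v => ?_⟩
    · simpa [map_fst, map_snd] using hr (τ e)
    · have := h1 (τ e)
      rwa [map_snd, hl, Ne, sumMap_inj] at this
    · have := h2 (τ e)
      rwa [map_fst, hl, Ne, sumMap_inj] at this
    · rw [← deg_map_snd_inr σ τ]
      exact h3 _
    · rw [← deg_map_fst_inr σ τ, ← hμ]
      exact h4 _
  · rintro ⟨⟨r, hr⟩, h1, h2, h3, h4⟩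
    refine ⟨⟨fun x => r (Sum.map id σ.symm x), fun e => ?_⟩, fun e => ?_, fun e => ?_, fun v => ?_, fun v => ?_⟩
    · obtain ⟨e, rfl⟩ := τ.surjective e
      simpa [map_fst, map_snd, Sum.map_map] using hr e
    · obtain ⟨e, rfl⟩ := τ.surjective e
      rw [map_snd, hl, Ne, sumMap_inj]
      exact h1 e
    · obtain ⟨e, rfl⟩ := τ.surjective e
      rw [map_fst, hl, Ne, sumMap_inj]
      exact h2 e
    · obtain ⟨v, rfl⟩ := σ.surjective v
      rw [deg_map_snd_inr]
      exact h3 v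
    · obtain ⟨v, rfl⟩ := σ.surjective v
      rw [deg_map_fst_inr, hμ]
      exact h4 v

end Map

namespace PotentialAlgebra

open Classical in
/-- A mark at a vertex with outgoing edges does not affect admissibility. -/
theorem admissible_markAt_iff {x : V} {G : EndPair V E} :
    Admissible (markAt (Sum.inr x)) G ∧ 1 ≤ deg G.1 (Sum.inr x) ↔ Admissible 0 G := by
  constructor
  · rintro ⟨h, hx⟩
    refine ⟨h.acyc, h.src, h.snk, h.in_pos, fun v => ?_⟩
    by_cases hv : x = v
    · subst hv; simpa using hx
    · simpa [markAt, hv] using h.out_pos v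
  · rintro h
    refine ⟨⟨h.acyc, h.src, h.snk, h.in_pos, fun v => ?_⟩, by simpa using h.out_pos x⟩
    have := h.out_pos v
    simp only [Pi.zero_apply, add_zero] at this
    omega

variable {𝕜 R ι : Type*} [CommRing 𝕜] [CommRing R] [Algebra 𝕜 R] [Fintype ι] [DecidableEq ι]
variable (D : PotentialAlgebra 𝕜 R ι)

/-- The potential attached to a vertex of degree `n`. Its leading part is allowed in degree at least
three only. -/
def potOfDeg (n : ℕ) : R := if 3 ≤ n then D.pot else D.pot - D.lead

/-- The functions attached to the vertices of a graph. -/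
def vtx (f u : R) (μ : V → ℕ) (G : EndPair V E) : Fin 2 ⊕ V → R :=
  Sum.elim ![f, u] fun v => -D.potOfDeg (deg G.2 (Sum.inr v) + deg G.1 (Sum.inr v) + μ v)

/-- The contraction for a graph where the function at the vertex `x` is replaced by `a`. -/
def gamAt (f u : R) (μ : V → ℕ) (G : EndPair V E) (x : Fin 2 ⊕ V) (a : R) : R :=
  D.Gam (Function.update (D.vtx f u μ G) x a) G.1 G.2

/-- The contraction for a graph with a mark at `y`, which acts by `∂̄_l`. -/
def markedGam (l : ι) (f u : R) (y : Fin 2 ⊕ V) (G : EndPair V E) : R :=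
  D.gamAt f u (markAt y) G y (D.d (Sum.inr l) (D.vtx f u (markAt y) G y))

open Classical in
/-- The sum of the contractions over all admissible labelled graphs. -/
def graphSum (V E : Type*) [Fintype V] [DecidableEq V] [Fintype E] [DecidableEq E] (f u : R) : R :=
  ∑ G : EndPair V E with Admissible 0 G, D.Gam (D.vtx f u 0 G) G.1 G.2

open Classical in
/-- The sum over all graphs with a mark at `y`. -/
def markedSum (E : Type*) [Fintype E] [DecidableEq E] (l : ι) (f u : R) (y : Fin 2 ⊕ V) : R :=
  ∑ G : EndPair V E with Admissible (markAt y) G, D.markedGam l f u y G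

open Classical in
/-- The sum over all graphs with a mark at `x`, where `x` has no outgoing edges. -/
def sinkSum (E : Type*) [Fintype E] [DecidableEq E] (l : ι) (f u : R) (x : V) : R :=
  ∑ G : EndPair V E with Admissible (markAt (Sum.inr x)) G ∧ deg G.1 (Sum.inr x) = 0,
    D.markedGam l f u (Sum.inr x) G

open Classical in
/-- The sum over all graphs where the marked vertex `x` has the edge `e` as its only edge, with the leading
potential at `x`. -/
def leafSum (l : ι) (f u : R) (x : V) (e : E) : R :=
  ∑ G : EndPair V E with (Admissible (markAt (Sum.inr x)) G ∧ deg G.1 (Sum.inr x) = 0) ∧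
      deg G.2 (Sum.inr x) = 1 ∧ G.2 e = Sum.inr x,
    D.gamAt f u (markAt (Sum.inr x)) G (Sum.inr x) (D.d (Sum.inr l) D.lead)

open Classical in
/-- The sum over all graphs where the vertex `x` has degree two and `e` as its outgoing edge, with the leading
potential at `x`. -/
def bivalentSum (l : ι) (f u : R) (x : V) (e : E) : R :=
  ∑ G : EndPair V E with Admissible 0 G ∧ (deg G.2 (Sum.inr x) = 1 ∧ deg G.1 (Sum.inr x) = 1) ∧
      G.1 e = Sum.inr x,
    D.gamAt f u 0 G (Sum.inr x) (-D.d (Sum.inr l) D.lead)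

section Map

variable {V' E' : Type*} [Fintype V'] [DecidableEq V'] [Fintype E'] [DecidableEq E']
  (σ : V ≃ V') (τ : E ≃ E')

theorem vtx_map (f u : R) {μ : V → ℕ} {μ' : V' → ℕ} (hμ : ∀ v, μ' (σ v) = μ v) (G : EndPair V E)
    (x : Fin 2 ⊕ V) : D.vtx f u μ' (G.map σ τ) (Sum.map id σ x) = D.vtx f u μ G x := by
  cases x with
  | inl i => rfl
  | inr v =>
    simp only [vtx, Sum.map_inr, Sum.elim_inr]
    rw [deg_map_fst_inr, deg_map_snd_inr, hμ]

theorem gamAt_map (f u : R) {μ : V → ℕ} {μ' : V' → ℕ} (hμ : ∀ v, μ' (σ v) = μ v) (G : EndPair V E)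
    (x : V) (a : R) :
    D.gamAt f u μ' (G.map σ τ) (Sum.inr (σ x)) a = D.gamAt f u μ G (Sum.inr x) a := by
  refine (D.Gam_reindex ((Equiv.refl _).sumCongr σ) τ _ _ _ _ _ _ (fun y => ?_) (fun e => ?_)
    (fun e => ?_)).symm
  · have hx : (Sum.inr (σ x) : Fin 2 ⊕ V') = Sum.map id σ (Sum.inr x) := rfl
    have hy : ((Equiv.refl (Fin 2)).sumCongr σ) y = Sum.map id σ y := rfl
    rw [hy]
    by_cases hyx : y = Sum.inr x
    · subst hyx
      rw [Function.update_self, hx, Function.update_self]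
    · rw [Function.update_of_ne hyx, hx, Function.update_of_ne (by rwa [Ne, sumMap_inj]), vtx_map _ _ _ _ _ hμ]
  · exact map_fst σ τ G e
  · exact map_snd σ τ G e

theorem markAt_map (x v : V) : markAt (Sum.inr (σ x)) (σ v) = markAt (Sum.inr x) v := by
  simp [markAt]

theorem snd_map_eq_iff (G : EndPair V E) (x : V) (e : E) :
    (G.map σ τ).2 (τ e) = Sum.inr (σ x) ↔ G.2 e = Sum.inr x := by
  rw [map_snd, show (Sum.inr (σ x) : Fin 2 ⊕ V') = Sum.map id σ (Sum.inr x) from rfl, sumMap_inj]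

theorem fst_map_eq_iff (G : EndPair V E) (x : V) (e : E) :
    (G.map σ τ).1 (τ e) = Sum.inr (σ x) ↔ G.1 e = Sum.inr x := by
  rw [map_fst, show (Sum.inr (σ x) : Fin 2 ⊕ V') = Sum.map id σ (Sum.inr x) from rfl, sumMap_inj]

theorem sinkSum_map (τ : E ≃ E') (l : ι) (f u : R) (x : V) :
    D.sinkSum E' l f u (σ x) = D.sinkSum E l f u x := by
  classical
  refine (sum_equiv (EndPair.map σ τ) (fun G => ?_) fun G _ => ?_).symm
  · simp only [mem_filter, mem_univ, true_and]
    rw [admissible_map_iff σ τ G (markAt_map σ x), deg_map_fst_inr]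
  · rw [markedGam, markedGam, gamAt_map _ _ _ _ _ (markAt_map σ x)]
    congr 2
    exact (D.vtx_map σ τ f u (markAt_map σ x) G (Sum.inr x)).symm

theorem leafSum_map (l : ι) (f u : R) (x : V) (e : E) :
    D.leafSum l f u (σ x) (τ e) = D.leafSum l f u x e := by
  classical
  refine (sum_equiv (EndPair.map σ τ) (fun G => ?_) fun G _ => ?_).symm
  · simp only [mem_filter, mem_univ, true_and]
    rw [admissible_map_iff σ τ G (markAt_map σ x), deg_map_fst_inr, deg_map_snd_inr, snd_map_eq_iff]
  · rw [gamAt_map _ _ _ _ _ (markAt_map σ x)]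

theorem bivalentSum_map (l : ι) (f u : R) (x : V) (e : E) :
    D.bivalentSum l f u (σ x) (τ e) = D.bivalentSum l f u x e := by
  classical
  refine (sum_equiv (EndPair.map σ τ) (fun G => ?_) fun G _ => ?_).symm
  · simp only [mem_filter, mem_univ, true_and]
    rw [admissible_map_iff σ τ G (μ := 0) (μ' := 0) (fun _ => rfl), deg_map_fst_inr, deg_map_snd_inr, fst_map_eq_iff]
  · rw [gamAt_map _ _ _ _ _ (μ := 0) (μ' := 0) (fun _ => rfl)]

end Map

/-! ### Differentiation of the graph sum -/

theorem gamAt_add (f u : R) (μ : V → ℕ) (G : EndPair V E) (x : Fin 2 ⊕ V) (a b : R) :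
    D.gamAt f u μ G x (a + b) = D.gamAt f u μ G x a + D.gamAt f u μ G x b :=
  D.Gam_update_add _ _ _ _ _ _

theorem gamAt_neg (f u : R) (μ : V → ℕ) (G : EndPair V E) (x : Fin 2 ⊕ V) (a : R) :
    D.gamAt f u μ G x (-a) = -D.gamAt f u μ G x a := by
  have := D.Gam_update_smul (D.vtx f u μ G) G.1 G.2 x (-1 : 𝕜) a
  simpa [gamAt] using this

/-- The mark at `x` only changes the degree of `x`, and the function at `x` is overwritten by `a`
anyway. -/
theorem gamAt_markAt (f u : R) (G : EndPair V E) (x : V) (a : R) :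
    D.gamAt f u (markAt (Sum.inr x)) G (Sum.inr x) a = D.gamAt f u 0 G (Sum.inr x) a := by
  rw [gamAt, gamAt]
  congr 1
  funext y
  by_cases hy : y = Sum.inr x
  · subst hy; simp
  · rw [Function.update_of_ne hy, Function.update_of_ne hy]
    cases y with
    | inl i => rfl
    | inr v =>
      have : ¬ x = v := fun h => hy (h ▸ rfl)
      simp [vtx, markAt, this]

theorem gamAt_inl_zero (f u a : R) (μ : V → ℕ) (G : EndPair V E) :
    D.gamAt f u μ G (Sum.inl 0) a = D.Gam (D.vtx a u μ G) G.1 G.2 := by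
  rw [gamAt]
  congr 1
  funext y
  rcases y with i | v
  · fin_cases i <;> simp [vtx]
  · simp [vtx]

theorem gamAt_inl_one (f u a : R) (μ : V → ℕ) (G : EndPair V E) :
    D.gamAt f u μ G (Sum.inl 1) a = D.Gam (D.vtx f a μ G) G.1 G.2 := by
  rw [gamAt]
  congr 1
  funext y
  rcases y with i | v
  · fin_cases i <;> simp [vtx]
  · simp [vtx]

theorem markedSum_inl_zero (l : ι) (f u : R) :
    D.markedSum E l f u (Sum.inl 0 : Fin 2 ⊕ V) = D.graphSum V E (D.d (Sum.inr l) f) u := by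
  classical
  rw [markedSum, graphSum, markAt_inl]
  refine sum_congr rfl fun G _ => ?_
  rw [markedGam, gamAt_inl_zero, markAt_inl]
  rfl

/-- The mark raises the degree of `x` by one. This affects `potOfDeg` only in degree two, where `pot
- lead` becomes `pot`; hence the correction at bivalent vertices. -/
theorem markedGam_eq (l : ι) (f u : R) (x : V) {G : EndPair V E} (hG : Admissible 0 G) :
    D.markedGam l f u (Sum.inr x) G =
      D.gamAt f u 0 G (Sum.inr x) (D.d (Sum.inr l) (D.vtx f u 0 G (Sum.inr x))) +
      if deg G.2 (Sum.inr x) = 1 ∧ deg G.1 (Sum.inr x) = 1 then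
        D.gamAt f u 0 G (Sum.inr x) (-D.d (Sum.inr l) D.lead) else 0 := by
  have h1 := hG.in_pos x
  have h2 := hG.out_pos x
  simp only [Pi.zero_apply, add_zero] at h2
  have h3 : markAt (Sum.inr x) x = 1 := by simp [markAt]
  rw [markedGam, gamAt_markAt]
  split_ifs with h
  · rw [← gamAt_add]
    congr 1
    simp [vtx, h.1, h.2, h3, potOfDeg]
    ring
  · rw [add_zero]
    congr 1
    have h4 : 3 ≤ deg G.2 (Sum.inr x) + deg G.1 (Sum.inr x) := by omega
    simp [vtx, potOfDeg, h4, le_add_right h4]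

open Classical in
/-- The sum over all insertions of a vertex into an edge. -/
def insertSum (V E : Type*) [Fintype V] [DecidableEq V] [Fintype E] [DecidableEq E] (l : ι) (f u : R) : R :=
  ∑ G : EndPair V E with Admissible 0 G, ∑ e, D.edgeDer (D.vtx f u 0 G) G.1 G.2 l e

open Classical in
-- Marked graphs are split according to whether `x` has an outgoing edge besides the mark. If it
-- has, the graph is admissible without the mark as well, and `markedGam_eq` compares the two
-- contributions.
theorem markedSum_eq (l : ι) (f u : R) (x : V) :
    D.markedSum E l f u (Sum.inr x) = D.sinkSum E l f u x +
      (∑ G : EndPair V E with Admissible 0 G,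
        D.gamAt f u 0 G (Sum.inr x) (D.d (Sum.inr l) (D.vtx f u 0 G (Sum.inr x))) +
      ∑ e : E, D.bivalentSum l f u x e) := by
  classical
  have h0 : (univ.filter fun G : EndPair V E => Admissible (markAt (Sum.inr x)) G) =
      (univ.filter fun G : EndPair V E =>
        Admissible (markAt (Sum.inr x)) G ∧ deg G.1 (Sum.inr x) = 0) ∪
      (univ.filter fun G : EndPair V E => Admissible 0 G) := by
    ext G
    simp only [mem_union, mem_filter, mem_univ, true_and, ← admissible_markAt_iff (x := x)]
    have : deg G.1 (Sum.inr x) = 0 ∨ 1 ≤ deg G.1 (Sum.inr x) := by omega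
    tauto
  have hb : ∑ e : E, D.bivalentSum l f u x e =
      ∑ G : EndPair V E with Admissible 0 G,
        if deg G.2 (Sum.inr x) = 1 ∧ deg G.1 (Sum.inr x) = 1 then
          D.gamAt f u 0 G (Sum.inr x) (-D.d (Sum.inr l) D.lead) else 0 := by
    simp only [bivalentSum, sum_filter]
    rw [sum_comm]
    refine sum_congr rfl fun G _ => ?_
    by_cases hG : Admissible 0 G
    · by_cases h : deg G.2 (Sum.inr x) = 1 ∧ deg G.1 (Sum.inr x) = 1
      · simp only [hG, h, and_self, true_and, if_true]
        -- A bivalent `x` has exactly one outgoing edge, so summing over `e` counts each graph once.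
        exact sum_ite_deg_eq_one h.2 _
      · simp only [hG, h, false_and, and_false, if_false, if_true, sum_const_zero]
    · simp only [hG, false_and, if_false, sum_const_zero]
  rw [markedSum, h0, sum_union, hb, ← sum_add_distrib]
  · congr 1
    refine sum_congr (by congr) fun G hG => ?_
    exact D.markedGam_eq l f u x (mem_filter.1 hG).2
  · rw [disjoint_filter]
    intro G _ h1 h2
    have := h2.out_pos x
    simp only [Pi.zero_apply, add_zero] at this
    omega

/-- The derivatives at internal vertices are rewritten through marked graphs, since marked sums and
sinks are what the product rule at the last vertex produces. -/
theorem d_graphSum (l : ι) (f u : R) :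
    D.d (Sum.inr l) (D.graphSum V E f u) =
      D.graphSum V E (D.d (Sum.inr l) f) u + D.graphSum V E f (D.d (Sum.inr l) u) +
      (∑ x : V, (D.markedSum E l f u (Sum.inr x) - D.sinkSum E l f u x -
        ∑ e : E, D.bivalentSum l f u x e)) + D.insertSum V E l f u := by
  classical
  have h1 : ∀ x : V, D.markedSum E l f u (Sum.inr x) - D.sinkSum E l f u x -
      ∑ e : E, D.bivalentSum l f u x e = ∑ G : EndPair V E with Admissible 0 G,
        D.gamAt f u 0 G (Sum.inr x) (D.d (Sum.inr l) (D.vtx f u 0 G (Sum.inr x))) := by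
    intro x
    rw [markedSum_eq]
    ring
  simp only [h1]
  rw [sum_comm]
  simp only [graphSum, insertSum, map_sum]
  rw [← sum_add_distrib, ← sum_add_distrib, ← sum_add_distrib]
  refine sum_congr rfl fun G _ => ?_
  rw [d_Gam]
  congr 1
  rw [Fintype.sum_sum_type, Fin.sum_univ_two]
  congr 1
  congr 1
  · exact D.gamAt_inl_zero f u _ 0 G
  · exact D.gamAt_inl_one f u _ 0 G

end PotentialAlgebra
end KahlerStar
end

/-! ### Three bijections between graphs: redirecting edges, attaching a leaf, subdividing an edge.
-/

noncomputable section

set_option linter.unusedSectionVars false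

namespace KahlerStar

open Finset

namespace PotentialAlgebra

variable {V E : Type*} [Fintype V] [DecidableEq V] [Fintype E] [DecidableEq E]
variable {𝕜 R ι : Type*} [CommRing 𝕜] [CommRing R] [Algebra 𝕜 R] [Fintype ι] [DecidableEq ι]
variable (D : PotentialAlgebra 𝕜 R ι)

/-- Merge the new vertex with the last external vertex. -/
def collapse : Fin 2 ⊕ Option V → Fin 2 ⊕ V :=
  Sum.elim Sum.inl fun o => o.elim (Sum.inl 1) Sum.inr

@[simp] theorem collapse_emb (x : Fin 2 ⊕ V) : collapse (emb x : Fin 2 ⊕ Option V) = x := by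
  cases x <;> rfl

@[simp] theorem collapse_none : collapse (Sum.inr none : Fin 2 ⊕ Option V) = Sum.inl 1 := rfl

theorem emb_collapse {x : Fin 2 ⊕ Option V} (hx : x ≠ Sum.inr none) : emb (collapse x) = x := by
  rcases x with i | _ | v
  · rfl
  · exact absurd rfl hx
  · rfl

theorem emb_inr (v : V) : (emb (Sum.inr v) : Fin 2 ⊕ Option V) = Sum.inr (some v) := rfl

theorem emb_inl (i : Fin 2) : (emb (Sum.inl i) : Fin 2 ⊕ Option V) = Sum.inl i := rfl

theorem emb_eq_inl {x : Fin 2 ⊕ V} {i : Fin 2} :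
    (emb x : Fin 2 ⊕ Option V) = Sum.inl i ↔ x = Sum.inl i := by
  rw [← emb_inl, emb_inj]

@[simp] theorem markAt_none_some (v : V) : markAt (Sum.inr none : Fin 2 ⊕ Option V) (some v) = 0 := by
  simp [markAt]

@[simp] theorem markAt_none_none : markAt (Sum.inr none : Fin 2 ⊕ Option V) none = 1 := by
  simp [markAt]

/-- A function on the vertices which agrees with `r` on the old ones. -/
def extRank (r : Fin 2 ⊕ V → ℕ) (n : ℕ) : Fin 2 ⊕ Option V → ℕ :=
  Sum.elim (r ∘ Sum.inl) fun o => o.elim n (r ∘ Sum.inr)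

@[simp] theorem extRank_emb (r : Fin 2 ⊕ V → ℕ) (n : ℕ) (x : Fin 2 ⊕ V) : extRank r n (emb x) = r x := by
  cases x <;> rfl

@[simp] theorem extRank_none (r : Fin 2 ⊕ V → ℕ) (n : ℕ) : extRank r n (Sum.inr none) = n := rfl

/-- The potential at a vertex depends only on its degree with the mark included. A surgery
preserving these numbers at the old vertices therefore only adds the function `P` at the new one. -/
theorem update_vtx_none (f u P : R) {μ : V → ℕ} {μ' : Option V → ℕ} {G : EndPair V E} {E' : Type*}
    [Fintype E'] {G' : EndPair (Option V) E'}
    (H : ∀ v, deg G'.2 (Sum.inr (some v)) + deg G'.1 (Sum.inr (some v)) + μ' (some v) =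
      deg G.2 (Sum.inr v) + deg G.1 (Sum.inr v) + μ v) :
    Function.update (D.vtx f u μ' G') (Sum.inr none) P = extFun (D.vtx f u μ G) P := by
  funext y
  by_cases hy : y = Sum.inr none
  · subst hy; simp
  · rw [Function.update_of_ne hy, ← emb_collapse hy, extFun_emb]
    generalize collapse y = x
    rcases x with i | v
    · rfl
    · simp only [vtx, emb_inr, Sum.elim_inr, H]

/-! ### The product rule at the last external vertex -/

/-- Redirect the edges in `S` to a new vertex. -/
def redirect (G : EndPair V E) (S : Finset E) : EndPair (Option V) E :=
  (fun e => emb (G.1 e), fun e => if e ∈ S then Sum.inr none else emb (G.2 e))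

theorem redirect_fst (G : EndPair V E) (S : Finset E) (v : V) :
    deg (redirect G S).1 (Sum.inr (some v)) = deg G.1 (Sum.inr v) :=
  deg_congr fun e => by simp [redirect, ← emb_inr, emb_inj]

theorem redirect_snd {G : EndPair V E} {S : Finset E} (hS : ∀ e ∈ S, G.2 e = Sum.inl 1) (v : V) :
    deg (redirect G S).2 (Sum.inr (some v)) = deg G.2 (Sum.inr v) :=
  deg_congr fun e => by
    by_cases he : e ∈ S
    · simp [redirect, he, hS e he]
    · simp [redirect, ← emb_inr, emb_inj, he]

/-- The new vertex needs an incoming edge, which is why `S` is nonempty; the outgoing edge it lacks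
is replaced by the mark. -/
theorem redirect_admissible {G : EndPair V E} {S : Finset E} (hS : ∀ e ∈ S, G.2 e = Sum.inl 1) :
    (Admissible (markAt (Sum.inr none)) (redirect G S) ∧ deg (redirect G S).1 (Sum.inr none) = 0) ↔
      Admissible 0 G ∧ S.Nonempty := by
  constructor
  · rintro ⟨⟨⟨r, hr⟩, h1, h2, h3, h4⟩, -⟩
    -- The edges in `S` return to the last external vertex, about whose rank nothing is known
    -- relative to their tails. As it is a sink, it can be lifted above all ranks.
    refine ⟨⟨⟨fun x => if x = Sum.inl 1 then 1 + ∑ y, r y else r (emb x), fun e => ?_⟩,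
      fun e => ?_, fun e => ?_, fun v => ?_, fun v => ?_⟩, ?_⟩
    · have ht : G.1 e ≠ Sum.inl 1 := fun h => h2 e (by simp [redirect, h, emb_inl])
      simp only [if_neg ht]
      split_ifs with h
      · have := single_le_sum (f := r) (fun i _ => Nat.zero_le _) (mem_univ (emb (G.1 e)))
        omega
      · have he : e ∉ S := fun he => h (hS e he)
        simpa [redirect, he] using hr e
    · intro h
      have he : e ∉ S := fun he => by rw [hS e he] at h; simp at h
      exact h1 e (by simp [redirect, he, h, emb_inl])
    · exact fun h => h2 e (by simp [redirect, h, emb_inl])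
    · rw [← redirect_snd hS]; exact h3 _
    · rw [← redirect_fst G S]; simpa using h4 (some v)
    · obtain ⟨e, he⟩ := one_le_deg.1 (h3 none)
      refine ⟨e, ?_⟩
      by_contra hc
      simp [redirect, hc] at he
  · rintro ⟨⟨⟨r, hr⟩, h1, h2, h3, h4⟩, ⟨e₀, he₀⟩⟩
    refine ⟨⟨⟨extRank r (r (Sum.inl 1)), fun e => ?_⟩, fun e => ?_, fun e => ?_, fun v => ?_,
      fun v => ?_⟩, ?_⟩
    · by_cases he : e ∈ S
      · simpa [redirect, he, hS e he] using hr e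
      · simpa [redirect, he] using hr e
    · by_cases he : e ∈ S
      · simp [redirect, he]
      · simpa [redirect, he, emb_eq_inl] using h1 e
    · simpa [redirect, emb_eq_inl] using h2 e
    · cases v with
      | none => exact one_le_deg.2 ⟨e₀, by simp [redirect, he₀]⟩
      | some v => rw [redirect_snd hS]; exact h3 v
    · cases v with
      | none => simp
      | some v => rw [redirect_fst]; simpa using h4 v
    · rw [deg_eq_zero]
      intro e
      simp [redirect]

open Classical in
-- The product rule at the last external vertex. For `S = ∅` the factor `P` is isolated and comes
-- out; the pairs `(G, S)` with `S` nonempty correspond to graphs with a marked sink, the inverse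
-- map merging that sink with the last external vertex.
theorem graphSum_mul (f u P : R) :
    D.graphSum V E f (P * u) = P * D.graphSum V E f u +
      ∑ G : EndPair (Option V) E with
          Admissible (markAt (Sum.inr none)) G ∧ deg G.1 (Sum.inr none) = 0,
        D.gamAt f u (markAt (Sum.inr none)) G (Sum.inr none) P := by
  have key : ∀ (G : EndPair V E) (S : Finset E), (∀ e ∈ S, G.2 e = Sum.inl 1) →
      D.gamAt f u (markAt (Sum.inr none)) (redirect G S) (Sum.inr none) P =
        D.Gam (extFun (D.vtx f u 0 G) P) (fun e => emb (G.1 e))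
          (fun e => if e ∈ S then Sum.inr none else emb (G.2 e)) := by
    intro G S hS
    rw [gamAt, D.update_vtx_none (μ := 0) f u P (G := G)]
    · rfl
    · intro v
      rw [redirect_fst, redirect_snd hS]
      simp
  have hterm : ∀ G : EndPair V E, Admissible 0 G →
      D.Gam (D.vtx f (P * u) 0 G) G.1 G.2 = P * D.Gam (D.vtx f u 0 G) G.1 G.2 +
        ∑ S ∈ (univ.filter fun e => G.2 e = Sum.inl 1).powerset.erase ∅,
          D.gamAt f u (markAt (Sum.inr none)) (redirect G S) (Sum.inr none) P := by
    intro G hG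
    rw [← D.gamAt_inl_one f u (P * u), gamAt, Gam_mul_sink _ _ _ _ _ _ _ hG.snk,
      ← add_sum_erase _ _ (empty_mem_powerset _)]
    have hu : Function.update (D.vtx f u 0 G) (Sum.inl 1) u = D.vtx f u 0 G := by
      conv_rhs => rw [← Function.update_eq_self (Sum.inl 1) (D.vtx f u 0 G)]
      rfl
    rw [hu]
    congr 1
    · simp only [notMem_empty, if_false]
      exact D.Gam_isolated _ _ _ _
    · refine sum_congr rfl fun S hS => ?_
      rw [key G S fun e he => by
        simpa using mem_powerset.1 (mem_of_mem_erase hS) he]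
  rw [graphSum, graphSum, sum_congr rfl fun G hG => hterm G (mem_filter.1 hG).2, sum_add_distrib, mul_sum]
  congr 1
  rw [sum_sigma']
  have hmem : ∀ (G : EndPair V E) (S : Finset E),
      (⟨G, S⟩ : Σ _ : EndPair V E, Finset E) ∈ (univ.filter fun G : EndPair V E => Admissible 0 G).sigma
        (fun G => (univ.filter fun e => G.2 e = Sum.inl 1).powerset.erase ∅) ↔
      (Admissible 0 G ∧ S.Nonempty) ∧ ∀ e ∈ S, G.2 e = Sum.inl 1 := by
    intro G S
    simp only [mem_sigma, mem_filter, mem_univ, true_and, mem_erase, mem_powerset, subset_iff,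
      nonempty_iff_ne_empty]
    tauto
  refine sum_bij' (fun p _ => redirect p.1 p.2)
    (fun G' _ => ⟨(fun e => collapse (G'.1 e), fun e => collapse (G'.2 e)),
      univ.filter fun e => G'.2 e = Sum.inr none⟩) ?_ ?_ ?_ ?_ ?_
  · rintro ⟨G, S⟩ h
    obtain ⟨h, hS⟩ := (hmem G S).1 h
    simpa using (redirect_admissible hS).2 h
  · intro G' hG'
    simp only [mem_filter, mem_univ, true_and] at hG'
    have hS : ∀ e ∈ univ.filter (fun e => G'.2 e = Sum.inr none), collapse (G'.2 e) = Sum.inl 1 := by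
      intro e he
      rw [(mem_filter.1 he).2, collapse_none]
    have hr : redirect (fun e => collapse (G'.1 e), fun e => collapse (G'.2 e))
        (univ.filter fun e => G'.2 e = Sum.inr none) = G' := by
      ext e
      · simp [redirect, emb_collapse (deg_eq_zero.1 hG'.2 e)]
      · by_cases he : G'.2 e = Sum.inr none
        · simp [redirect, he]
        · simp [redirect, he, emb_collapse he]
    rw [hmem]
    refine ⟨(redirect_admissible hS).1 ?_, hS⟩
    rwa [hr]
  · rintro ⟨G, S⟩ h
    obtain ⟨h, hS⟩ := (hmem G S).1 h
    have h1 : (fun e => collapse ((redirect G S).1 e)) = G.1 := by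
      funext e
      simp [redirect]
    have h2 : (fun e => collapse ((redirect G S).2 e)) = G.2 := by
      funext e
      by_cases he : e ∈ S
      · simp [redirect, he, hS e he]
      · simp [redirect, he]
    have h3 : (univ.filter fun e => (redirect G S).2 e = Sum.inr none) = S := by
      ext e
      by_cases he : e ∈ S <;> simp [redirect, he]
    simp only [h1, h2, h3]
  · intro G' hG'
    simp only [mem_filter, mem_univ, true_and] at hG'
    ext e
    · simp [redirect, emb_collapse (deg_eq_zero.1 hG'.2 e)]
    · by_cases he : G'.2 e = Sum.inr none
      · simp [redirect, he]
      · simp [redirect, he, emb_collapse he]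
  · intro p _
    rfl

/-- The new sink carries `+∂̄_l pot`, whereas internal vertices carry minus the potential; hence the
sign of `sinkSum`. A sink with one incoming edge has degree two with its mark, so `sinkSum` omits
`lead` there, and `leafSum` restores it. -/
theorem graphSum_d_pot_mul (l : ι) (f u : R) :
    D.graphSum V E f (D.d (Sum.inr l) D.pot * u) = D.d (Sum.inr l) D.pot * D.graphSum V E f u -
      D.sinkSum E l f u (none : Option V) + ∑ e : E, D.leafSum l f u (none : Option V) e := by
  classical
  rw [graphSum_mul, sub_add, sub_eq_add_neg]
  congr 1
  have hl : ∑ e : E, D.leafSum l f u (none : Option V) e = ∑ G : EndPair (Option V) E with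
      Admissible (markAt (Sum.inr none)) G ∧ deg G.1 (Sum.inr none) = 0,
      if deg G.2 (Sum.inr none) = 1 then D.gamAt f u (markAt (Sum.inr none)) G (Sum.inr none)
        (D.d (Sum.inr l) D.lead) else 0 := by
    simp only [leafSum, sum_filter]
    rw [sum_comm]
    refine sum_congr rfl fun G _ => ?_
    by_cases hG : Admissible (markAt (Sum.inr none)) G ∧ deg G.1 (Sum.inr none) = 0
    · by_cases h : deg G.2 (Sum.inr none) = 1
      · simp only [hG, h, and_self, true_and, if_true]
        exact sum_ite_deg_eq_one h _
      · simp only [hG, h, false_and, and_false, if_false, and_self, if_true, sum_const_zero]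
    · simp only [hG, false_and, if_false, sum_const_zero]
  rw [hl, sinkSum, neg_sub, ← sum_sub_distrib]
  refine sum_congr (by congr) fun G hG => ?_
  obtain ⟨hG, h0⟩ := (mem_filter.1 hG).2
  have h1 := hG.in_pos none
  rw [markedGam, sub_eq_add_neg, ← gamAt_neg]
  split_ifs with h
  · rw [← gamAt_add]
    congr 1
    simp [vtx, h, h0, potOfDeg]
  · rw [zero_add]
    congr 1
    have h4 : 2 ≤ deg G.2 (Sum.inr none) := by omega
    simp [vtx, potOfDeg, h0, h4]

/-! ### Contraction of a leaf -/

/-- Attach a new vertex to the vertex `y` by a new edge. -/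
def attach (y : Fin 2 ⊕ V) (G : EndPair V E) : EndPair (Option V) (Option E) :=
  (fun o => o.elim (emb y) fun e => emb (G.1 e), fun o => o.elim (Sum.inr none) fun e => emb (G.2 e))

theorem attach_fst (y : Fin 2 ⊕ V) (G : EndPair V E) (v : V) :
    deg (attach y G).1 (Sum.inr (some v)) = deg G.1 (Sum.inr v) + markAt y v := by
  rw [deg_option, add_comm, ← emb_inr]
  simp only [attach, Option.elim_none, Option.elim_some, emb_inj, markAt]
  congr 1
  exact deg_congr fun e => by rw [emb_inj]

theorem attach_snd (y : Fin 2 ⊕ V) (G : EndPair V E) (v : V) :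
    deg (attach y G).2 (Sum.inr (some v)) = deg G.2 (Sum.inr v) := by
  rw [deg_option, ← emb_inr]
  simp only [attach, Option.elim_none, Option.elim_some, none_ne_emb, if_false, zero_add]
  exact deg_congr fun e => by rw [emb_inj]

/-- The mark at `y` becomes the new outgoing edge of `y`, and the new leaf bears a mark in place of
an outgoing edge. The last external vertex is excluded because it must remain a sink. -/
theorem attach_admissible (y : Fin 2 ⊕ V) (G : EndPair V E) :
    ((Admissible (markAt (Sum.inr none)) (attach y G) ∧ deg (attach y G).1 (Sum.inr none) = 0) ∧
      deg (attach y G).2 (Sum.inr none) = 1 ∧ (attach y G).2 none = Sum.inr none) ↔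
      y ≠ Sum.inl 1 ∧ Admissible (markAt y) G := by
  constructor
  · rintro ⟨⟨⟨⟨r, hr⟩, h1, h2, h3, h4⟩, -⟩, -⟩
    refine ⟨fun h => h2 none ?_, ⟨fun x => r (emb x), fun e => hr (some e)⟩, fun e h => ?_,
      fun e h => ?_, fun v => ?_, fun v => ?_⟩
    · simp [attach, h, emb_inl]
    · exact h1 (some e) (by simp [attach, h, emb_inl])
    · exact h2 (some e) (by simp [attach, h, emb_inl])
    · rw [← attach_snd y]; exact h3 _
    · have := h4 (some v)
      rwa [attach_fst, markAt_none_some, add_zero] at this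
  · rintro ⟨hy, ⟨⟨r, hr⟩, h1, h2, h3, h4⟩⟩
    have hd : deg (attach y G).2 (Sum.inr none) = 1 := by
      rw [deg_option]
      simp [attach, deg]
    refine ⟨⟨⟨⟨extRank r (r y + 1), fun e => ?_⟩, fun e => ?_, fun e => ?_, fun v => ?_,
      fun v => ?_⟩, ?_⟩, hd, rfl⟩
    · cases e with
      | none => simp [attach]
      | some e => simpa [attach] using hr e
    · cases e with
      | none => simp [attach]
      | some e => simpa [attach, emb_eq_inl] using h1 e
    · cases e with
      | none => simpa [attach, emb_eq_inl] using hy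
      | some e => simpa [attach, emb_eq_inl] using h2 e
    · cases v with
      | none => exact hd.ge
      | some v => rw [attach_snd]; exact h3 v
    · cases v with
      | none => simp
      | some v => rw [attach_fst]; simpa using h4 v
    · rw [deg_eq_zero]
      rintro (_ | e) <;> simp [attach]

/-- Contracting the leaf with `g` moves `∂̄_l` to its neighbour `y`. The first external vertex as
`y` yields the derivative of `f`, an internal `y` yields a marked graph. -/
theorem leafSum_option (l : ι) (f u : R) :
    D.leafSum l f u (none : Option V) (none : Option E) =
      D.graphSum V E (D.d (Sum.inr l) f) u + ∑ x : V, D.markedSum E l f u (Sum.inr x) := by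
  classical
  have h0 : D.graphSum V E (D.d (Sum.inr l) f) u + ∑ x : V, D.markedSum E l f u (Sum.inr x) =
      ∑ y ∈ univ.filter (fun y : Fin 2 ⊕ V => y ≠ Sum.inl 1), D.markedSum E l f u y := by
    rw [sum_filter, Fintype.sum_sum_type, Fin.sum_univ_two, ← markedSum_inl_zero]
    simp
  rw [h0]
  simp only [markedSum]
  rw [sum_sigma', leafSum]
  symm
  refine sum_bij' (fun p _ => attach p.1 p.2)
    (fun G' _ => ⟨collapse (G'.1 none),
      (fun e => collapse (G'.1 (some e)), fun e => collapse (G'.2 (some e)))⟩) ?_ ?_ ?_ ?_ ?_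
  · rintro ⟨y, G⟩ h
    simp only [mem_sigma, mem_filter, mem_univ, true_and] at h ⊢
    exact (attach_admissible y G).2 h
  all_goals
    have hatt : ∀ G' : EndPair (Option V) (Option E),
        deg G'.1 (Sum.inr none) = 0 → deg G'.2 (Sum.inr none) = 1 → G'.2 none = Sum.inr none →
        attach (collapse (G'.1 none))
          (fun e => collapse (G'.1 (some e)), fun e => collapse (G'.2 (some e))) = G' := by
      intro G' h1 h2 h3
      rw [deg_option, if_pos h3] at h2
      have h2' : deg (fun e => G'.2 (some e)) (Sum.inr none) = 0 := by omega
      ext o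
      · cases o <;> simp [attach, emb_collapse (deg_eq_zero.1 h1 _)]
      · cases o with
        | none => simp [attach, h3]
        | some e => simp [attach, emb_collapse (deg_eq_zero.1 h2' e)]
  · intro G' hG'
    simp only [mem_sigma, mem_filter, mem_univ, true_and] at hG' ⊢
    rw [← attach_admissible, hatt G' hG'.1.2 hG'.2.1 hG'.2.2]
    exact hG'
  · rintro ⟨y, G⟩ h
    simp [attach]
  · intro G' hG'
    simp only [mem_filter, mem_univ, true_and] at hG'
    exact hatt G' hG'.1.2 hG'.2.1 hG'.2.2
  · rintro ⟨y, G⟩ h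
    rw [markedGam, gamAt, gamAt, D.update_vtx_none (μ := markAt y) (G := G) f u]
    · exact (D.Gam_contract _ _ _ _ _).symm
    · intro v
      rw [attach_fst, attach_snd, markAt_none_some]
      ring

/-! ### Insertion of a vertex into an edge -/

/-- Insert a new vertex into the edge `e₀`. -/
def insertVertex (G : EndPair V E) (e₀ : E) : EndPair (Option V) (Option E) :=
  (fun o => o.elim (Sum.inr none) fun e => emb (G.1 e),
    fun o => o.elim (emb (G.2 e₀)) fun e => if e = e₀ then Sum.inr none else emb (G.2 e))

theorem insertVertex_fst (G : EndPair V E) (e₀ : E) (v : V) :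
    deg (insertVertex G e₀).1 (Sum.inr (some v)) = deg G.1 (Sum.inr v) := by
  rw [deg_option, ← emb_inr]
  simp only [insertVertex, Option.elim_none, Option.elim_some, none_ne_emb, if_false, zero_add]
  exact deg_congr fun e => by rw [emb_inj]

theorem insertVertex_snd (G : EndPair V E) (e₀ : E) (v : V) :
    deg (insertVertex G e₀).2 (Sum.inr (some v)) = deg G.2 (Sum.inr v) := by
  rw [deg_option, ← emb_inr, deg, deg, ← add_sum_erase _ _ (mem_univ e₀),
    ← add_sum_erase univ _ (mem_univ e₀)]
  simp only [insertVertex, Option.elim_none, Option.elim_some, none_ne_emb, if_false, zero_add, if_true,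
    emb_inj]
  congr 1
  refine sum_congr rfl fun e he => ?_
  simp only [if_neg (ne_of_mem_erase he), emb_inj]

theorem insertVertex_fst_none (G : EndPair V E) (e₀ : E) :
    deg (insertVertex G e₀).1 (Sum.inr none) = 1 := by
  rw [deg_option]
  simp [insertVertex, deg]

theorem insertVertex_snd_none (G : EndPair V E) (e₀ : E) :
    deg (insertVertex G e₀).2 (Sum.inr none) = 1 := by
  rw [deg_option, deg, sum_eq_single e₀]
  · simp [insertVertex]
  · intro e _ he
    simp [insertVertex, he]
  · simp

theorem insertVertex_admissible (G : EndPair V E) (e₀ : E) :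
    Admissible 0 (insertVertex G e₀) ↔ Admissible 0 G := by
  constructor
  · rintro ⟨⟨r, hr⟩, h1, h2, h3, h4⟩
    refine ⟨⟨fun x => r (emb x), fun e => ?_⟩, fun e h => ?_, fun e h => ?_, fun v => ?_, fun v => ?_⟩
    · by_cases he : e = e₀
      · subst he
        have ha := hr none
        have hb := hr (some e)
        simp only [insertVertex, Option.elim_none, Option.elim_some, if_true] at ha hb
        exact ha.trans' hb
      · simpa [insertVertex, he] using hr (some e)
    · by_cases he : e = e₀
      · subst he
        exact h1 none (by simp [insertVertex, h, emb_inl])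
      · exact h1 (some e) (by simp [insertVertex, h, emb_inl, he])
    · exact h2 (some e) (by simp [insertVertex, h, emb_inl])
    · rw [← insertVertex_snd G e₀]; exact h3 _
    · rw [← insertVertex_fst G e₀]; exact h4 (some v)
  · rintro ⟨⟨r, hr⟩, h1, h2, h3, h4⟩
    -- Doubling the ranks leaves an odd value free between the two ends of `e₀`.
    refine ⟨⟨extRank (fun x => 2 * r x) (2 * r (G.1 e₀) + 1), fun e => ?_⟩, fun e => ?_, fun e => ?_,
      fun v => ?_, fun v => ?_⟩
    · cases e with
      | none =>
        have := hr e₀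
        simp only [insertVertex, Option.elim_none, extRank_none, extRank_emb]
        omega
      | some e =>
        by_cases he : e = e₀
        · subst he; simp [insertVertex]
        · simpa [insertVertex, he] using hr e
    · cases e with
      | none => simpa [insertVertex, emb_eq_inl] using h1 e₀
      | some e =>
        by_cases he : e = e₀
        · simp [insertVertex, he]
        · simpa [insertVertex, emb_eq_inl, he] using h1 e
    · cases e with
      | none => simp [insertVertex]
      | some e => simpa [insertVertex, emb_eq_inl] using h2 e
    · cases v with
      | none => exact (insertVertex_snd_none G e₀).ge
      | some v => rw [insertVertex_snd]; exact h3 v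
    · cases v with
      | none => rw [insertVertex_fst_none]; simp
      | some v => rw [insertVertex_fst]; exact h4 v

/-- A bivalent vertex with outgoing edge `none` determines its unique incoming edge `e₀`, so
subdividing edges is a bijection onto such graphs. By `Gam_insert` the vertex with the leading
potential is the derivative of `g` on `e₀`. -/
theorem bivalentSum_option (l : ι) (f u : R) :
    D.bivalentSum l f u (none : Option V) (none : Option E) = D.insertSum V E l f u := by
  classical
  rw [insertSum, bivalentSum, sum_sigma']
  symm
  refine sum_bij (fun p _ => insertVertex p.1 p.2) ?_ ?_ ?_ ?_
  · rintro ⟨G, e₀⟩ h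
    simp only [mem_sigma, mem_filter, mem_univ, true_and, and_true] at h ⊢
    exact ⟨(insertVertex_admissible G e₀).2 h,
      ⟨insertVertex_snd_none G e₀, insertVertex_fst_none G e₀⟩, rfl⟩
  · rintro ⟨G, e₀⟩ - ⟨G', e₁⟩ - h
    have h1 : ∀ o, (insertVertex G e₀).1 o = (insertVertex G' e₁).1 o := fun o => by
      simp only at h; rw [h]
    have h2 : ∀ o, (insertVertex G e₀).2 o = (insertVertex G' e₁).2 o := fun o => by
      simp only at h; rw [h]
    have he : e₀ = e₁ := by
      by_contra hc
      have := h2 (some e₀)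
      simp [insertVertex, hc] at this
    subst he
    have hG : G = G' := by
      ext e
      · simpa [insertVertex, emb_inj] using h1 (some e)
      · by_cases he : e = e₀
        · subst he
          simpa [insertVertex, emb_inj] using h2 none
        · simpa [insertVertex, emb_inj, he] using h2 (some e)
    rw [hG]
  · intro G' hG'
    simp only [mem_filter, mem_univ, true_and] at hG'
    obtain ⟨hG, ⟨hin, hout⟩, hn⟩ := hG'
    obtain ⟨r, hr⟩ := hG.acyc
    have hn2 : G'.2 none ≠ Sum.inr none := by
      intro h
      have := hr none
      rw [h, hn] at this
      omega
    rw [deg_option, if_pos hn] at hout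
    have hout' : deg (fun e => G'.1 (some e)) (Sum.inr none) = 0 := by omega
    rw [deg_option, if_neg hn2, zero_add, deg_eq_card, card_eq_one] at hin
    obtain ⟨e₀, he₀⟩ := hin
    have hiff : ∀ e, G'.2 (some e) = Sum.inr none ↔ e = e₀ := fun e => by
      simpa using Finset.ext_iff.1 he₀ e
    have hGeq : insertVertex (fun e => collapse (G'.1 (some e)),
        fun e => if e = e₀ then collapse (G'.2 none) else collapse (G'.2 (some e))) e₀ = G' := by
      ext o
      · cases o with
        | none => simp [insertVertex, hn]
        | some e => simp [insertVertex, emb_collapse (deg_eq_zero.1 hout' e)]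
      · cases o with
        | none => simp [insertVertex, emb_collapse hn2]
        | some e =>
          by_cases he : e = e₀
          · simp [insertVertex, he, (hiff e₀).2 rfl]
          · simp [insertVertex, he, emb_collapse (mt (hiff e).1 he)]
    refine ⟨⟨(fun e => collapse (G'.1 (some e)),
        fun e => if e = e₀ then collapse (G'.2 none) else collapse (G'.2 (some e))), e₀⟩, ?_, hGeq⟩
    simp only [mem_sigma, mem_filter, mem_univ, true_and, and_true]
    rw [← insertVertex_admissible _ e₀, hGeq]
    exact hG
  · rintro ⟨G, e₀⟩ h
    rw [gamAt, D.update_vtx_none (μ := 0) (G := G) f u]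
    · exact (D.Gam_insert _ _ _ _ _).symm
    · intro v
      rw [insertVertex_fst, insertVertex_snd]
      rfl

end PotentialAlgebra
end KahlerStar
end

/-! ### Orders in the formal parameter, truncated products and their defect. -/

noncomputable section

set_option linter.unusedSectionVars false

namespace KahlerStar

open Finset

section Count

variable {V E : Type*} [Fintype V] [DecidableEq V] [Fintype E] [DecidableEq E]

theorem sum_deg_le (h : E → Fin 2 ⊕ V) : ∑ v : V, deg h (Sum.inr v) ≤ Fintype.card E := by
  simp only [deg]
  rw [sum_comm, Fintype.card_eq_sum_ones]
  refine sum_le_sum fun e _ => ?_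
  rcases hx : h e with i | w
  · simp
  · simp

/-- Every internal vertex receives an edge of its own. Thus the exponent `b - a` in `coef` is a
genuine difference on all graphs that occur. -/
theorem Admissible.card_le {μ : V → ℕ} {G : EndPair V E} (hG : Admissible μ G) :
    Fintype.card V ≤ Fintype.card E := by
  refine le_trans ?_ (sum_deg_le G.2)
  rw [Fintype.card_eq_sum_ones]
  exact sum_le_sum fun v _ => hG.in_pos v

/-- The bivalent vertices other than `y`. -/
def bivalent (μ : V → ℕ) (G : EndPair V E) (y : Fin 2 ⊕ V) : Finset V :=
  univ.filter fun v => Sum.inr v ≠ y ∧ deg G.2 (Sum.inr v) + deg G.1 (Sum.inr v) + μ v < 3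

/-- Count half-edges: every internal vertex has degree at least two with the mark, and at least
three unless it is bivalent. There are at most `2|E|` half-edges at internal vertices; the summand
`2` pays for the mark and for the vertex `y`. -/
theorem Admissible.card_bivalent {μ : V → ℕ} {G : EndPair V E} (hG : Admissible μ G)
    (y : Fin 2 ⊕ V) (hμ : ∑ v, μ v ≤ 1) :
    3 * Fintype.card V ≤ 2 * Fintype.card E + (bivalent μ G y).card + 2 := by
  have h1 : ∀ v, 3 ≤ (deg G.2 (Sum.inr v) + deg G.1 (Sum.inr v) + μ v) +
      ((if Sum.inr v ≠ y ∧ deg G.2 (Sum.inr v) + deg G.1 (Sum.inr v) + μ v < 3 then 1 else 0) +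
        if Sum.inr v = y then 1 else 0) := by
    intro v
    have ha := hG.in_pos v
    have hb := hG.out_pos v
    by_cases h : (Sum.inr v : Fin 2 ⊕ V) = y
    · simp only [h, ne_eq, not_true, false_and, if_false, if_true]
      subst h
      omega
    · by_cases h' : deg G.2 (Sum.inr v) + deg G.1 (Sum.inr v) + μ v < 3
      · simp only [h, h', ne_eq, not_false_eq_true, and_self, if_true, if_false]
        omega
      · simp only [h, h', and_false, if_false]
        omega
  have h2 := sum_le_sum fun v (_ : v ∈ univ) => h1 v
  have h3 : ∑ v : V, (if Sum.inr v = y then 1 else 0) ≤ 1 := by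
    rcases y with i | w <;> simp
  simp only [sum_add_distrib, sum_const, card_univ, smul_eq_mul] at h2
  rw [bivalent, card_filter]
  have h4 := sum_deg_le G.1
  have h5 := sum_deg_le G.2
  omega

theorem sum_markAt_le (y : Fin 2 ⊕ V) : ∑ v, markAt y v ≤ 1 := by
  rcases y with i | w <;> simp [markAt]

end Count

namespace PotentialAlgebra

variable {V E : Type*} [Fintype V] [DecidableEq V] [Fintype E] [DecidableEq E]
variable {R ι : Type*} [CommRing R] [Algebra ℂ⟦X⟧ R] [Fintype ι] [DecidableEq ι]
variable (D : PotentialAlgebra ℂ⟦X⟧ R ι)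

/-- The formal parameter in `R`. -/
def hbar (R : Type*) [CommRing R] [Algebra ℂ⟦X⟧ R] : R := algebraMap ℂ⟦X⟧ R PowerSeries.X

/-- The coefficient of the graphs with `a` internal vertices and `b` edges. -/
def coef (a b : ℕ) : ℂ⟦X⟧ :=
  PowerSeries.C ((a.factorial * b.factorial : ℂ)⁻¹) * PowerSeries.X ^ (b - a)

/-- This and the next two recursions accompany the removal of a vertex, of an edge, or of both. The
integer counts the choices of the removed object, and `X` accounts for the change of `b - a`. -/
theorem coef_succ_left {a b : ℕ} (h : a + 1 ≤ b) :
    coef a b = PowerSeries.X * coef (a + 1) b * ((a + 1 : ℕ) : ℂ⟦X⟧) := by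
  have h1 : b - a = (b - (a + 1)) + 1 := by omega
  have h2 : ((a.factorial * b.factorial : ℂ)⁻¹) =
      (((a + 1).factorial * b.factorial : ℂ)⁻¹) * ((a + 1 : ℕ) : ℂ) := by
    rw [Nat.factorial_succ]
    have : (a.factorial : ℂ) ≠ 0 := by exact_mod_cast a.factorial_ne_zero
    have : (b.factorial : ℂ) ≠ 0 := by exact_mod_cast b.factorial_ne_zero
    have : ((a + 1 : ℕ) : ℂ) ≠ 0 := by exact_mod_cast a.succ_ne_zero
    push_cast at *
    field_simp
  rw [coef, coef, h1, h2, map_mul, map_natCast]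
  ring

theorem coef_succ_right {a b : ℕ} (h : a ≤ b) :
    coef a (b + 1) * ((b + 1 : ℕ) : ℂ⟦X⟧) = PowerSeries.X * coef a b := by
  have h1 : b + 1 - a = (b - a) + 1 := by omega
  have h2 : ((a.factorial * b.factorial : ℂ)⁻¹) =
      ((a.factorial * (b + 1).factorial : ℂ)⁻¹) * ((b + 1 : ℕ) : ℂ) := by
    rw [Nat.factorial_succ]
    have : (a.factorial : ℂ) ≠ 0 := by exact_mod_cast a.factorial_ne_zero
    have : (b.factorial : ℂ) ≠ 0 := by exact_mod_cast b.factorial_ne_zero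
    have : ((b + 1 : ℕ) : ℂ) ≠ 0 := by exact_mod_cast b.succ_ne_zero
    push_cast at *
    field_simp
  rw [coef, coef, h1, h2, map_mul, map_natCast]
  ring

theorem coef_succ_succ (a b : ℕ) :
    coef (a + 1) (b + 1) * (((a + 1) * (b + 1) : ℕ) : ℂ⟦X⟧) = coef a b := by
  have h2 : ((a.factorial * b.factorial : ℂ)⁻¹) =
      (((a + 1).factorial * (b + 1).factorial : ℂ)⁻¹) * (((a + 1) * (b + 1) : ℕ) : ℂ) := by
    rw [Nat.factorial_succ, Nat.factorial_succ]
    have : (a.factorial : ℂ) ≠ 0 := by exact_mod_cast a.factorial_ne_zero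
    have : (b.factorial : ℂ) ≠ 0 := by exact_mod_cast b.factorial_ne_zero
    have : ((b + 1 : ℕ) : ℂ) ≠ 0 := by exact_mod_cast b.succ_ne_zero
    have : ((a + 1 : ℕ) : ℂ) ≠ 0 := by exact_mod_cast a.succ_ne_zero
    push_cast at *
    field_simp
  rw [coef, coef, h2, map_mul, map_natCast, Nat.add_sub_add_right]
  ring

/-! ### Divisibility by powers of the formal parameter -/

theorem hbar_dvd_iter {x : R} (hx : hbar R ∣ x) (s : Multiset (ι ⊕ ι)) : hbar R ∣ D.iter s x := by
  obtain ⟨y, rfl⟩ := hx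
  refine ⟨D.iter s y, ?_⟩
  rw [hbar, ← Algebra.smul_def, map_smul, Algebra.smul_def]

theorem hbar_pow_dvd_Gam {Y : Type*} [Fintype Y] [DecidableEq Y] (φ : Y → R) (t h : E → Y)
    (T : Finset Y) (hT : ∀ y ∈ T, hbar R ∣ φ y) : hbar R ^ T.card ∣ D.Gam φ t h := by
  refine dvd_sum fun k _ => Dvd.dvd.mul_right ?_ _
  have h1 : hbar R ^ T.card = ∏ y, if y ∈ T then hbar R else 1 := by
    rw [prod_ite_mem, univ_inter, prod_const]
  rw [h1, vprod]
  refine prod_dvd_prod_of_dvd _ _ fun y _ => ?_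
  split_ifs with hy
  · exact D.hbar_dvd_iter (hT y hy) _
  · exact one_dvd _

/-- The coefficient gives `b - a` powers of `hbar`, and each of the `c` bivalent vertices other than
`y` gives one more, as it carries `-(pot - lead)`. From `3a ≤ 2b + c + 2` follows `3(b - a + c) ≥ b
- 2 ≥ 3w`. -/
theorem hbar_pow_dvd_gamAt (hpot : hbar R ∣ D.pot - D.lead) (f u a : R) {μ : V → ℕ}
    {G : EndPair V E} (hG : Admissible μ G) (y : Fin 2 ⊕ V) (hμ : ∑ v, μ v ≤ 1) {w : ℕ}
    (hw : 3 * w + 2 ≤ Fintype.card E) :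
    hbar R ^ w ∣ coef (Fintype.card V) (Fintype.card E) • D.gamAt f u μ G y a := by
  have h1 : hbar R ^ ((bivalent μ G y).map ⟨Sum.inr, Sum.inr_injective⟩ : Finset (Fin 2 ⊕ V)).card ∣
      D.gamAt f u μ G y a := by
    refine D.hbar_pow_dvd_Gam _ _ _ _ fun x hx => ?_
    obtain ⟨v, hv, rfl⟩ := mem_map.1 hx
    simp only [bivalent, mem_filter, mem_univ, true_and] at hv
    rw [Function.Embedding.coeFn_mk, Function.update_of_ne hv.1]
    simp only [vtx, Sum.elim_inr, potOfDeg, if_neg (not_le.2 hv.2)]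
    rwa [dvd_neg]
  rw [card_map] at h1
  have h2 := hG.card_bivalent y hμ
  have h3 := hG.card_le
  rw [coef, mul_smul, Algebra.smul_def, Algebra.smul_def, map_pow]
  refine Dvd.dvd.mul_left ?_ _
  refine (pow_dvd_pow _ ?_).trans (pow_add (hbar R) _ _ ▸ mul_dvd_mul_left _ h1)
  omega

theorem hbar_pow_dvd_graphSum (hpot : hbar R ∣ D.pot - D.lead) (f u : R) {a b w : ℕ}
    (hw : 3 * w + 2 ≤ b) : hbar R ^ w ∣ coef a b • D.graphSum (Fin a) (Fin b) f u := by
  classical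
  rw [graphSum, smul_sum]
  refine dvd_sum fun G hG => ?_
  have := D.hbar_pow_dvd_gamAt hpot f u u (mem_filter.1 hG).2 (Sum.inl 1) (by simp) (w := w)
    (by simpa using hw)
  rw [gamAt_inl_one] at this
  simpa using this

theorem hbar_pow_dvd_markedSum (hpot : hbar R ∣ D.pot - D.lead) (l : ι) (f u : R) {a b w : ℕ}
    (y : Fin 2 ⊕ Fin a) (hw : 3 * w + 2 ≤ b) :
    hbar R ^ w ∣ coef a b • D.markedSum (Fin b) l f u y := by
  classical
  rw [markedSum, smul_sum]
  refine dvd_sum fun G hG => ?_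
  simpa [markedGam] using D.hbar_pow_dvd_gamAt hpot f u
    (D.d (Sum.inr l) (D.vtx f u (markAt y) G y)) (mem_filter.1 hG).2 y
    (sum_markAt_le y) (w := w) (by simpa using hw)

theorem hbar_pow_dvd_bivalentSum (hpot : hbar R ∣ D.pot - D.lead) (l : ι) (f u : R) {a b w : ℕ}
    (x : Fin a) (e : Fin b) (hw : 3 * w + 2 ≤ b) :
    hbar R ^ w ∣ coef a b • D.bivalentSum l f u x e := by
  classical
  rw [bivalentSum, smul_sum]
  refine dvd_sum fun G hG => ?_
  simpa using D.hbar_pow_dvd_gamAt hpot f u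
    (-D.d (Sum.inr l) D.lead) (mem_filter.1 hG).2.1 (Sum.inr x) (by simp) (w := w) (by simpa using hw)

/-! ### Vanishing -/

theorem graphSum_eq_zero (f u : R) {a b : ℕ} (h : b < a) : D.graphSum (Fin a) (Fin b) f u = 0 := by
  classical
  refine sum_eq_zero fun G hG => ?_
  have := (mem_filter.1 hG).2.card_le
  simp at this
  omega

theorem markedSum_eq_zero (l : ι) (f u : R) {a b : ℕ} (h : b < a) (y : Fin 2 ⊕ Fin a) :
    D.markedSum (Fin b) l f u y = 0 := by
  classical
  refine sum_eq_zero fun G hG => ?_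
  have := (mem_filter.1 hG).2.card_le
  simp at this
  omega

theorem sinkSum_eq_zero (l : ι) (f u : R) {b : ℕ} (h : b < Fintype.card V) (x : V) :
    D.sinkSum (Fin b) l f u x = 0 := by
  classical
  refine sum_eq_zero fun G hG => ?_
  have := (mem_filter.1 hG).2.1.card_le
  simp at this
  omega

theorem bivalentSum_eq_zero (l : ι) (f u : R) {a b : ℕ} (h : b < a) (x : Fin a) (e : Fin b) :
    D.bivalentSum l f u x e = 0 := by
  classical
  refine sum_eq_zero fun G hG => ?_
  have := (mem_filter.1 hG).2.1.card_le
  simp at this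
  omega

/-! ### Distinguished vertices and edges -/

/-- By symmetry under relabelling all choices of the distinguished vertex contribute equally;
`finSuccEquiv' x` sends `x` to `none`. The next two lemmas do the same for edges and for pairs. -/
theorem sum_sinkSum_succ (l : ι) (f u : R) (a b : ℕ) :
    ∑ x : Fin (a + 1), D.sinkSum (Fin b) l f u x =
      (a + 1) • D.sinkSum (Fin b) l f u (none : Option (Fin a)) := by
  rw [sum_congr rfl fun x _ => (D.sinkSum_map (finSuccEquiv' x) (Equiv.refl (Fin b)) l f u x).symm]
  simp

theorem sum_leafSum_succ (l : ι) (f u : R) (b : ℕ) :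
    ∑ e : Fin (b + 1), D.leafSum l f u (none : Option V) e =
      (b + 1) • D.leafSum l f u (none : Option V) (none : Option (Fin b)) := by
  rw [sum_congr rfl fun e _ =>
    (D.leafSum_map (Equiv.refl (Option V)) (finSuccEquiv' e) l f u none e).symm]
  simp

theorem sum_bivalentSum_succ (l : ι) (f u : R) (a b : ℕ) :
    ∑ x : Fin (a + 1), ∑ e : Fin (b + 1), D.bivalentSum l f u x e =
      ((a + 1) * (b + 1)) • D.bivalentSum l f u (none : Option (Fin a)) (none : Option (Fin b)) := by
  rw [sum_congr rfl fun x _ => sum_congr rfl fun e _ =>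
    (D.bivalentSum_map (finSuccEquiv' x) (finSuccEquiv' e) l f u x e).symm]
  simp [mul_assoc]

/-! ### The truncated product -/

/-- The sum over all graphs with less than `N` internal vertices and less than `N` edges. -/
def starN (N : ℕ) (f u : R) : R :=
  ∑ a ∈ range N, ∑ b ∈ range N, coef a b • D.graphSum (Fin a) (Fin b) f u

/-- Shifting both indices adds a row and a column at the far boundary. The column `a = N` vanishes
below `b = N`, so only the row `b = N` survives. -/
theorem sum_range_sum_succ (F : ℕ → ℕ → R) (N : ℕ) (h1 : ∀ b, F 0 b = 0) (h2 : ∀ a, F a 0 = 0)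
    (h3 : ∀ b < N, F N b = 0) :
    ∑ a ∈ range N, ∑ b ∈ range N, F (a + 1) (b + 1) =
      ∑ a ∈ range N, ∑ b ∈ range N, F a b + ∑ a ∈ range (N + 1), F a N := by
  have h4 : ∀ a, ∑ b ∈ range N, F a (b + 1) = ∑ b ∈ range N, F a b + F a N := fun a => by
    rw [← sum_range_succ, sum_range_succ', h2, add_zero]
  have h5 : ∑ a ∈ range N, ∑ b ∈ range N, F (a + 1) (b + 1) =
      ∑ a ∈ range (N + 1), ∑ b ∈ range N, F a (b + 1) := by
    rw [sum_range_succ']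
    simp [h1]
  rw [h5, sum_congr rfl fun a _ => h4 a, sum_add_distrib, sum_range_succ]
  rw [sum_eq_zero fun b hb => h3 b (mem_range.1 hb), add_zero]

/-- The defect of the commutation of the truncated left multiplication with
the right multiplication by `∂̄_l pot`. -/
theorem starN_defect (l : ι) (f u : R) (n : ℕ) :
    D.starN (n + 1) f (D.d (Sum.inr l) D.pot * u) +
        hbar R * D.starN (n + 1) f (D.d (Sum.inr l) u) -
      (D.d (Sum.inr l) D.pot * D.starN (n + 1) f u +
        hbar R * D.d (Sum.inr l) (D.starN (n + 1) f u)) =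
      -hbar R * (∑ a ∈ range (n + 1), coef a n • (D.graphSum (Fin a) (Fin n) (D.d (Sum.inr l) f) u +
          ∑ x : Fin a, D.markedSum (Fin n) l f u (Sum.inr x)) +
        ∑ a ∈ range (n + 2), coef a (n + 1) •
          ∑ x : Fin a, ∑ e : Fin (n + 1), D.bivalentSum l f u x e) := by
  set δ := D.d (Sum.inr l)
  have hsm : ∀ (c : ℂ⟦X⟧) (x : R), (PowerSeries.X * c) • x = hbar R * c • x := by
    intro c x
    rw [mul_smul, Algebra.smul_def, hbar]
  -- sinks
  have hK : ∑ a ∈ range (n + 1), ∑ b ∈ range (n + 1),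
      coef a b • D.sinkSum (Fin b) l f u (none : Option (Fin a)) =
      hbar R * ∑ a ∈ range (n + 1), ∑ b ∈ range (n + 1),
        coef a b • ∑ x : Fin a, D.sinkSum (Fin b) l f u x := by
    rw [sum_comm, sum_comm (f := fun a b => coef a b • ∑ x : Fin a, D.sinkSum (Fin b) l f u x), mul_sum]
    refine sum_congr rfl fun b hb => ?_
    have h1 : ∀ a, coef a b • D.sinkSum (Fin b) l f u (none : Option (Fin a)) =
        hbar R * coef (a + 1) b • ∑ x : Fin (a + 1), D.sinkSum (Fin b) l f u x := by
      intro a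
      by_cases hab : a + 1 ≤ b
      · rw [sum_sinkSum_succ, ← Nat.cast_smul_eq_nsmul ℂ⟦X⟧ (a + 1), smul_smul, ← hsm, ← mul_assoc,
          ← coef_succ_left hab]
      · rw [D.sinkSum_eq_zero l f u (by simpa using hab), sum_eq_zero fun x _ =>
          D.sinkSum_eq_zero l f u (by simpa using hab) x]
        simp
    rw [sum_congr rfl fun a _ => h1 a, ← mul_sum]
    congr 1
    have h2 := sum_range_succ' (fun a => coef a b • ∑ x : Fin a, D.sinkSum (Fin b) l f u x) (n + 1)
    rw [sum_range_succ] at h2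
    rw [sum_eq_zero (s := (univ : Finset (Fin (n + 1)))) fun x _ =>
      D.sinkSum_eq_zero l f u (by simpa using hb) x] at h2
    simpa using h2.symm
  -- leaves
  have hL : ∀ a, ∑ b ∈ range (n + 1), coef a b • ∑ e : Fin b,
      D.leafSum l f u (none : Option (Fin a)) e =
      hbar R * ∑ b ∈ range n, coef a b • (D.graphSum (Fin a) (Fin b) (δ f) u +
        ∑ x : Fin a, D.markedSum (Fin b) l f u (Sum.inr x)) := by
    intro a
    rw [sum_range_succ']
    simp only [univ_eq_empty, sum_empty, smul_zero, add_zero]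
    rw [mul_sum]
    refine sum_congr rfl fun b _ => ?_
    rw [sum_leafSum_succ, leafSum_option, ← Nat.cast_smul_eq_nsmul ℂ⟦X⟧ (b + 1), smul_smul]
    by_cases hab : a ≤ b
    · rw [coef_succ_right hab, hsm]
    · rw [D.graphSum_eq_zero _ _ (not_le.1 hab), sum_eq_zero fun x _ =>
        D.markedSum_eq_zero l f u (not_le.1 hab) _]
      simp
  -- bivalent vertices
  have hB := sum_range_sum_succ (fun a b => coef a b • ∑ x : Fin a, ∑ e : Fin b,
    D.bivalentSum l f u x e) (n + 1) (by simp) (by simp) (by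
      intro b hb
      rw [sum_eq_zero, smul_zero]
      intro x _
      exact sum_eq_zero fun e _ => D.bivalentSum_eq_zero l f u hb x e)
  have hI : ∑ a ∈ range (n + 1), ∑ b ∈ range (n + 1), coef a b • D.insertSum (Fin a) (Fin b) l f u =
      ∑ a ∈ range (n + 1), ∑ b ∈ range (n + 1),
        coef (a + 1) (b + 1) • ∑ x : Fin (a + 1), ∑ e : Fin (b + 1), D.bivalentSum l f u x e := by
    refine sum_congr rfl fun a _ => sum_congr rfl fun b _ => ?_
    rw [sum_bivalentSum_succ, bivalentSum_option, ← Nat.cast_smul_eq_nsmul ℂ⟦X⟧ ((a + 1) * (b + 1)),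
      smul_smul, coef_succ_succ]
  have h1 : D.starN (n + 1) f (δ D.pot * u) = δ D.pot * D.starN (n + 1) f u -
      ∑ a ∈ range (n + 1), ∑ b ∈ range (n + 1),
        coef a b • D.sinkSum (Fin b) l f u (none : Option (Fin a)) +
      ∑ a ∈ range (n + 1), ∑ b ∈ range (n + 1), coef a b • ∑ e : Fin b,
        D.leafSum l f u (none : Option (Fin a)) e := by
    simp only [starN, δ, graphSum_d_pot_mul, smul_add, smul_sub, sum_add_distrib, sum_sub_distrib,
      mul_sum, mul_smul_comm]
  have h2 : δ (D.starN (n + 1) f u) = D.starN (n + 1) (δ f) u + D.starN (n + 1) f (δ u) +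
      (∑ a ∈ range (n + 1), ∑ b ∈ range (n + 1),
        coef a b • ∑ x : Fin a, D.markedSum (Fin b) l f u (Sum.inr x) -
      ∑ a ∈ range (n + 1), ∑ b ∈ range (n + 1),
        coef a b • ∑ x : Fin a, D.sinkSum (Fin b) l f u x -
      ∑ a ∈ range (n + 1), ∑ b ∈ range (n + 1),
        coef a b • ∑ x : Fin a, ∑ e : Fin b, D.bivalentSum l f u x e) +
      ∑ a ∈ range (n + 1), ∑ b ∈ range (n + 1), coef a b • D.insertSum (Fin a) (Fin b) l f u := by
    simp only [starN, δ, map_sum, Derivation.map_smul, d_graphSum, smul_add, smul_sub, sum_add_distrib,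
      sum_sub_distrib]
  have h3 : D.starN (n + 1) (δ f) u = ∑ a ∈ range (n + 1), ∑ b ∈ range n,
      coef a b • D.graphSum (Fin a) (Fin b) (δ f) u +
      ∑ a ∈ range (n + 1), coef a n • D.graphSum (Fin a) (Fin n) (δ f) u := by
    simp only [starN, sum_range_succ _ n, sum_add_distrib]
    abel
  have h4 : ∑ a ∈ range (n + 1), ∑ b ∈ range (n + 1),
        coef a b • ∑ x : Fin a, D.markedSum (Fin b) l f u (Sum.inr x) =
      ∑ a ∈ range (n + 1), ∑ b ∈ range n,
        coef a b • ∑ x : Fin a, D.markedSum (Fin b) l f u (Sum.inr x) +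
      ∑ a ∈ range (n + 1), coef a n • ∑ x : Fin a, D.markedSum (Fin n) l f u (Sum.inr x) := by
    simp only [sum_range_succ _ n, sum_add_distrib]
    abel
  -- Inside the summation square sinks cancel against sinks, leaves against marked graphs and
  -- derivatives of `f`, and bivalent vertices against subdivided edges. What remains has `n` edges,
  -- or `n + 1` in the bivalent case.
  rw [h1, h2, h3, h4, hK, sum_congr rfl fun a _ => hL a, hI, hB]
  simp only [smul_add, sum_add_distrib, mul_add, ← mul_sum, mul_sub, neg_mul]
  ring

/-- The boundary graphs have at least `n` edges, hence order at least `k`; the prefactor `hbar`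
gives one more power. -/
theorem hbar_pow_dvd_starN_defect (hpot : hbar R ∣ D.pot - D.lead) (l : ι) (f u : R) {n k : ℕ}
    (hn : 3 * k + 2 ≤ n) :
    hbar R ^ (k + 1) ∣ D.starN (n + 1) f (D.d (Sum.inr l) D.pot * u) +
        hbar R * D.starN (n + 1) f (D.d (Sum.inr l) u) -
      (D.d (Sum.inr l) D.pot * D.starN (n + 1) f u +
        hbar R * D.d (Sum.inr l) (D.starN (n + 1) f u)) := by
  rw [starN_defect, pow_succ', neg_mul, ← mul_neg]
  refine mul_dvd_mul_left _ ((dvd_neg).2 (dvd_add (dvd_sum fun a _ => ?_) (dvd_sum fun a _ => ?_)))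
  · rw [smul_add, smul_sum]
    exact dvd_add (D.hbar_pow_dvd_graphSum hpot _ _ hn)
      (dvd_sum fun x _ => D.hbar_pow_dvd_markedSum hpot l f u _ hn)
  · rw [smul_sum]
    refine dvd_sum fun x _ => ?_
    rw [smul_sum]
    exact dvd_sum fun e _ => D.hbar_pow_dvd_bivalentSum hpot l f u x e (by omega)

/-- Graphs with many edges have high order, so the truncations stabilise `hbar`-adically. -/
theorem hbar_pow_dvd_starN_sub (hpot : hbar R ∣ D.pot - D.lead) (f u : R) {n N k : ℕ}
    (hn : 3 * k + 2 ≤ n) (hN : n ≤ N) :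
    hbar R ^ k ∣ D.starN N f u - D.starN n f u := by
  induction N, hN using Nat.le_induction with
  | base => simp
  | succ N hN ih =>
    have h1 : D.starN (N + 1) f u = D.starN N f u +
        ∑ a ∈ range (N + 1), coef a N • D.graphSum (Fin a) (Fin N) f u := by
      rw [starN, starN, sum_congr rfl fun a _ => sum_range_succ _ _, sum_add_distrib]
      congr 1
      rw [sum_range_succ]
      rw [sum_eq_zero (s := range N) (f := fun b => coef N b • D.graphSum (Fin N) (Fin b) f u),
        add_zero]
      intro b hb
      rw [D.graphSum_eq_zero f u (mem_range.1 hb), smul_zero]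
    rw [h1, add_sub_right_comm]
    exact dvd_add ih (dvd_sum fun a _ => D.hbar_pow_dvd_graphSum hpot f u (by omega))

end PotentialAlgebra
end KahlerStar
end

/-! ### Jets, the formal product, and associativity. -/

noncomputable section

set_option linter.unusedSectionVars false

namespace KahlerStar

open Finset

/-! ### Functions vanishing to a given order in the holomorphic directions -/

section Jet

variable {A ι : Type*} [CommRing A] [Algebra ℂ A]
variable (d : ι → Derivation ℂ A A) (ev : A →ₐ[ℂ] ℂ)

/-- Vanishing of all derivatives of order less than `s` at the point `ev`. -/
def VanishesTo : ℕ → A → Prop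
  | 0, _ => True
  | s + 1, u => ev u = 0 ∧ ∀ p, VanishesTo s (d p u)

variable {d ev}

theorem VanishesTo.of_succ {s : ℕ} {u : A} (h : VanishesTo d ev (s + 1) u) : VanishesTo d ev s u := by
  induction s generalizing u with
  | zero => trivial
  | succ s ih => exact ⟨h.1, fun p => ih (h.2 p)⟩

theorem VanishesTo.mono {s t : ℕ} (hst : s ≤ t) {u : A} (h : VanishesTo d ev t u) :
    VanishesTo d ev s u := by
  induction t, hst using Nat.le_induction with
  | base => exact h
  | succ t _ ih => exact ih h.of_succ

theorem VanishesTo.add {s : ℕ} {u v : A} (hu : VanishesTo d ev s u) (hv : VanishesTo d ev s v) :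
    VanishesTo d ev s (u + v) := by
  induction s generalizing u v with
  | zero => trivial
  | succ s ih =>
    refine ⟨by rw [map_add, hu.1, hv.1, add_zero], fun p => ?_⟩
    rw [map_add]
    exact ih (hu.2 p) (hv.2 p)

theorem vanishesTo_zero (s : ℕ) : VanishesTo d ev s 0 := by
  induction s with
  | zero => trivial
  | succ s ih => exact ⟨map_zero _, fun p => by rwa [map_zero]⟩

theorem VanishesTo.mul_left {s : ℕ} (a : A) {u : A} (hu : VanishesTo d ev s u) :
    VanishesTo d ev s (a * u) := by
  induction s generalizing u a with
  | zero => trivial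
  | succ s ih =>
    refine ⟨by rw [map_mul, hu.1, mul_zero], fun p => ?_⟩
    rw [Derivation.leibniz, smul_eq_mul, smul_eq_mul, mul_comm u]
    exact (ih a (hu.2 p)).add (ih _ hu.of_succ)

theorem VanishesTo.mul_of_ev {s : ℕ} {a u : A} (ha : ev a = 0) (hu : VanishesTo d ev s u) :
    VanishesTo d ev (s + 1) (a * u) := by
  induction s generalizing u with
  | zero => exact ⟨by rw [map_mul, ha, zero_mul], fun p => trivial⟩
  | succ s ih =>
    refine ⟨by rw [map_mul, ha, zero_mul], fun p => ?_⟩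
    rw [Derivation.leibniz, smul_eq_mul, smul_eq_mul, mul_comm u]
    exact (ih (hu.2 p)).add (hu.mul_left _)

variable (d ev) in
/-- The ideal of the functions vanishing to order `s`. -/
def jetIdeal (s : ℕ) : Ideal A where
  carrier := {u | VanishesTo d ev s u}
  add_mem' hu hv := hu.add hv
  zero_mem' := vanishesTo_zero s
  smul_mem' a _ hu := hu.mul_left a

/-- Euler's identity: to leading order `u` is homogeneous of degree `t` in the coordinates `w`.
Applying `d q` reduces to order `t - 1`; the error `(δ - d q (w p)) * d p u` gains an order because
its first factor vanishes at the point. This takes the place of a Taylor expansion. -/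
theorem euler_mem_jetIdeal [Fintype ι] [DecidableEq ι] (hd : ∀ p q u, d p (d q u) = d q (d p u))
    {w : ι → A} (hw : ∀ p, ev (w p) = 0) (hdw : ∀ p q, ev (d q (w p)) = if p = q then 1 else 0) {t : ℕ}
    {u : A} (hu : u ∈ jetIdeal d ev t) :
    (t : A) * u - ∑ p, w p * d p u ∈ jetIdeal d ev (t + 1) := by
  induction t generalizing u with
  | zero =>
    refine ⟨?_, fun p => trivial⟩
    simp [hw]
  | succ t ih =>
    refine ⟨?_, fun q => ?_⟩
    · simp [hw, hu.1]
    · have h1 : d q (((t + 1 : ℕ) : A) * u - ∑ p, w p * d p u) =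
          ((t : A) * d q u - ∑ p, w p * d p (d q u)) +
            ∑ p, ((if p = q then 1 else 0) - d q (w p)) * d p u := by
        simp only [map_sub, map_sum, Derivation.leibniz, smul_eq_mul, sub_mul, sum_sub_distrib,
          sum_add_distrib, ite_mul, one_mul, zero_mul, sum_ite_eq', mem_univ, if_true, hd q,
          Derivation.map_natCast, mul_zero, add_zero]
        simp only [mul_comm (d _ u)]
        push_cast
        ring
      rw [h1]
      refine (jetIdeal d ev (t + 1)).add_mem (ih (hu.2 q)) ((jetIdeal d ev (t + 1)).sum_mem fun p _ => ?_)
      refine VanishesTo.mul_of_ev ?_ (hu.2 p)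
      rw [map_sub, hdw]
      split_ifs <;> simp

/-- A functional which depends on a jet only and vanishes on `1` and on all multiples of local coordinates
is zero. -/
theorem eq_zero_of_jet [Fintype ι] [DecidableEq ι] (hd : ∀ p q u, d p (d q u) = d q (d p u))
    {w : ι → A} (hw : ∀ p, ev (w p) = 0) (hdw : ∀ p q, ev (d q (w p)) = if p = q then 1 else 0)
    (T : A →ₗ[ℂ] ℂ) (hT1 : T 1 = 0) (hTw : ∀ p v, T (w p * v) = 0) (s : ℕ)
    (hTs : ∀ u ∈ jetIdeal d ev s, T u = 0) (u : A) : T u = 0 := by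
  -- Descending induction on the order `t`: on the `t`-th ideal, Euler's identity gives `t * T u =
  -- T` of an element of the next ideal. Division by `t` requires `1 ≤ t`; order zero is settled by
  -- splitting off the constant `ev u`, where `T 1 = 0` enters.
  have key : ∀ j t : ℕ, 1 ≤ t → s ≤ t + j → ∀ u ∈ jetIdeal d ev t, T u = 0 := by
    intro j
    induction j with
    | zero =>
      intro t _ hst u hu
      exact hTs u (VanishesTo.mono hst hu)
    | succ j ih =>
      intro t ht hst u hu
      have h1 := ih (t + 1) (by omega) (by omega) _ (euler_mem_jetIdeal hd hw hdw hu)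
      rw [map_sub, map_sum, sum_eq_zero fun p _ => hTw p _, sub_zero, ← nsmul_eq_mul, map_nsmul,
        nsmul_eq_mul, mul_eq_zero] at h1
      rcases h1 with h1 | h1
      · exact absurd h1 (by exact_mod_cast (by omega : t ≠ 0))
      · exact h1
  have h1 : u - algebraMap ℂ A (ev u) ∈ jetIdeal d ev 1 := by
    refine ⟨?_, fun p => trivial⟩
    simp
  have h2 := key s 1 le_rfl (by omega) _ h1
  rw [map_sub, Algebra.algebraMap_eq_smul_one, map_smul, hT1, smul_zero, sub_zero] at h2
  exact h2

end Jet

/-! ### Formal power series -/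

section Formal

variable {A ι : Type*} [CommRing A] [Algebra ℂ A]

theorem coeff_smul_series (c : ℂ⟦X⟧) (F : A⟦X⟧) (n : ℕ) : PowerSeries.coeff n (c • F) =
    ∑ p ∈ antidiagonal n, PowerSeries.coeff p.1 c • PowerSeries.coeff p.2 F := by
  rw [Algebra.smul_def, PowerSeries.coeff_mul]
  refine sum_congr rfl fun p _ => ?_
  rw [PowerSeries.algebraMap_apply'', PowerSeries.coeff_map, ← Algebra.smul_def]

theorem hbar_series : PotentialAlgebra.hbar A⟦X⟧ = PowerSeries.X := by
  rw [PotentialAlgebra.hbar, PowerSeries.algebraMap_apply'', PowerSeries.map_X]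

/-- The coefficientwise extension of a derivation to formal power series. -/
def seriesDerivation (d : Derivation ℂ A A) : Derivation ℂ⟦X⟧ A⟦X⟧ A⟦X⟧ :=
  Derivation.mk'
    { toFun := fun F => PowerSeries.mk fun n => d (PowerSeries.coeff n F)
      map_add' := fun F G => by
        ext n
        simp
      map_smul' := fun c F => by
        ext n
        simp [coeff_smul_series] }
    fun F G => by
      ext n
      simp only [LinearMap.coe_mk, AddHom.coe_mk, PowerSeries.coeff_mk, PowerSeries.coeff_mul, map_sum,
        Derivation.leibniz, smul_eq_mul, map_add, sum_add_distrib]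
      congr 1
      rw [← Nat.sum_antidiagonal_swap]
      simp

@[simp] theorem coeff_seriesDerivation (d : Derivation ℂ A A) (F : A⟦X⟧) (n : ℕ) :
    PowerSeries.coeff n (seriesDerivation d F) = d (PowerSeries.coeff n F) := by
  simp [seriesDerivation]

theorem seriesDerivation_C (d : Derivation ℂ A A) (f : A) :
    seriesDerivation d (PowerSeries.C f) = PowerSeries.C (d f) := by
  ext n
  rw [coeff_seriesDerivation, PowerSeries.coeff_C, PowerSeries.coeff_C]
  split_ifs <;> simp

theorem eq_of_X_pow_dvd {x y : A⟦X⟧} (h : ∀ k, PowerSeries.X ^ (k + 1) ∣ x - y) : x = y := by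
  ext k
  have := PowerSeries.X_pow_dvd_iff.1 (h k) k (Nat.lt_succ_self k)
  rwa [map_sub, sub_eq_zero] at this

/-- Formal power series whose coefficients up to order `r` vanish to order `s`. -/
def seriesJetIdeal (d : ι → Derivation ℂ A A) (ev : A →ₐ[ℂ] ℂ) (r s : ℕ) : Ideal A⟦X⟧ where
  carrier := {F | ∀ i ≤ r, PowerSeries.coeff i F ∈ jetIdeal d ev s}
  add_mem' hF hG i hi := by
    rw [map_add]
    exact add_mem (hF i hi) (hG i hi)
  zero_mem' i _ := by simp
  smul_mem' a F hF i hi := by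
    rw [smul_eq_mul, PowerSeries.coeff_mul]
    refine sum_mem fun p hp => Ideal.mul_mem_left _ _ (hF p.2 ?_)
    have := mem_antidiagonal.1 hp
    omega

end Formal

namespace PotentialAlgebra

variable {A ι : Type*} [CommRing A] [Algebra ℂ A] [Fintype ι] [DecidableEq ι]

theorem contract_g {𝕜 R : Type*} [CommRing 𝕜] [CommRing R] [Algebra 𝕜 R] (D : PotentialAlgebra 𝕜 R ι)
    (q p : ι) : ∑ l, D.d (Sum.inl q) (D.d (Sum.inr l) D.lead) * D.g l p = if q = p then 1 else 0 := by
  have h1 : (Matrix.of D.g) *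
      (Matrix.of fun p l => D.d (Sum.inl p) (D.d (Sum.inr l) D.lead)) = 1 := by
    ext q l
    rw [Matrix.mul_apply, Matrix.one_apply]
    exact D.g_contract q l
  have h1' := mul_eq_one_comm.1 h1
  have h2 := congrFun (congrFun h1' q) p
  rwa [Matrix.mul_apply, Matrix.one_apply] at h2

/-- The extension of the calculus on `A` to formal power series, with the formal potential `∑ Φ_k X^k`. -/
def formal (D : PotentialAlgebra ℂ A ι) (Φ : ℕ → A) : PotentialAlgebra ℂ⟦X⟧ A⟦X⟧ ι where
  d i := seriesDerivation (D.d i)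
  comm i j F := by
    ext n
    simp [D.comm i j]
  pot := PowerSeries.mk Φ
  lead := PowerSeries.C D.lead
  g q p := PowerSeries.C (D.g q p)
  g_contract q l := by
    simp only [seriesDerivation_C, ← map_mul, ← map_sum, D.g_contract]
    split_ifs <;> simp
  d_g l q p := by
    simp only [seriesDerivation_C, ← map_mul, ← map_sum, ← map_neg, D.d_g]

variable (D : PotentialAlgebra ℂ A ι) (Φ : ℕ → A)

theorem formal_d (i : ι ⊕ ι) : (D.formal Φ).d i = seriesDerivation (D.d i) := rfl

theorem X_dvd_formal (h0 : Φ 0 = D.lead) : hbar A⟦X⟧ ∣ (D.formal Φ).pot - (D.formal Φ).lead := by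
  rw [hbar_series, PowerSeries.X_dvd_iff]
  simp [formal, h0]

/-- The formal product given by the sum over all graphs. -/
def star (f u : A⟦X⟧) : A⟦X⟧ :=
  -- Graphs omitted by the cut-off have at least `3k + 6 ≥ 3(k + 1) + 2` edges, hence order greater
  -- than `k`. The cut-off is not sharp.
  PowerSeries.mk fun k => PowerSeries.coeff k ((D.formal Φ).starN (3 * k + 6) f u)

theorem X_pow_dvd_star_sub (h0 : Φ 0 = D.lead) (f u : A⟦X⟧) {k N : ℕ} (hN : 3 * k + 6 ≤ N) :
    PowerSeries.X ^ (k + 1) ∣ D.star Φ f u - (D.formal Φ).starN N f u := by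
  rw [PowerSeries.X_pow_dvd_iff]
  intro m hm
  have h := (D.formal Φ).hbar_pow_dvd_starN_sub (D.X_dvd_formal Φ h0) f u (n := 3 * m + 6) (N := N)
    (k := m + 1) (by omega) (by omega)
  rw [hbar_series, PowerSeries.X_pow_dvd_iff] at h
  have := h m (by omega)
  rw [map_sub] at this ⊢
  rw [star, PowerSeries.coeff_mk, sub_eq_zero, eq_comm, ← sub_eq_zero, this]

theorem X_pow_dvd_seriesDerivation (d : Derivation ℂ A A) {F : A⟦X⟧} {k : ℕ}
    (h : PowerSeries.X ^ k ∣ F) : PowerSeries.X ^ k ∣ seriesDerivation d F := by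
  rw [PowerSeries.X_pow_dvd_iff] at h ⊢
  intro m hm
  rw [coeff_seriesDerivation, h m hm, map_zero]

section Linear

variable {R : Type*} [CommRing R] [Algebra ℂ⟦X⟧ R] (B : PotentialAlgebra ℂ⟦X⟧ R ι)

theorem starN_add_right (N : ℕ) (f u v : R) : B.starN N f (u + v) = B.starN N f u + B.starN N f v := by
  have h : ∀ (a b : ℕ) (G : EndPair (Fin a) (Fin b)), B.Gam (B.vtx f (u + v) 0 G) G.1 G.2 =
      B.Gam (B.vtx f u 0 G) G.1 G.2 + B.Gam (B.vtx f v 0 G) G.1 G.2 := fun a b G => by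
    rw [← B.gamAt_inl_one f f u, ← B.gamAt_inl_one f f v, ← gamAt_add, gamAt_inl_one]
  simp only [starN, graphSum, h, sum_add_distrib, smul_add]

theorem starN_add_left (N : ℕ) (f g u : R) : B.starN N (f + g) u = B.starN N f u + B.starN N g u := by
  have h : ∀ (a b : ℕ) (G : EndPair (Fin a) (Fin b)), B.Gam (B.vtx (f + g) u 0 G) G.1 G.2 =
      B.Gam (B.vtx f u 0 G) G.1 G.2 + B.Gam (B.vtx g u 0 G) G.1 G.2 := fun a b G => by
    rw [← B.gamAt_inl_zero f u f, ← B.gamAt_inl_zero f u g, ← gamAt_add, gamAt_inl_zero]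
  simp only [starN, graphSum, h, sum_add_distrib, smul_add]

theorem starN_smul_right (N : ℕ) (c : ℂ⟦X⟧) (f u : R) : B.starN N f (c • u) = c • B.starN N f u := by
  have h : ∀ (a b : ℕ) (G : EndPair (Fin a) (Fin b)), B.Gam (B.vtx f (c • u) 0 G) G.1 G.2 =
      c • B.Gam (B.vtx f u 0 G) G.1 G.2 := fun a b G => by
    rw [← B.gamAt_inl_one f f u, gamAt, ← Gam_update_smul]
    exact (B.gamAt_inl_one f f _ 0 G).symm
  simp only [starN, graphSum, h, smul_sum, smul_comm c]

theorem starN_smul_left (N : ℕ) (c : ℂ⟦X⟧) (f u : R) : B.starN N (c • f) u = c • B.starN N f u := by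
  have h : ∀ (a b : ℕ) (G : EndPair (Fin a) (Fin b)), B.Gam (B.vtx (c • f) u 0 G) G.1 G.2 =
      c • B.Gam (B.vtx f u 0 G) G.1 G.2 := fun a b G => by
    rw [← B.gamAt_inl_zero f u f, gamAt, ← Gam_update_smul]
    exact (B.gamAt_inl_zero f u _ 0 G).symm
  simp only [starN, graphSum, h, smul_sum, smul_comm c]

/-- If the function at the vertex `x` is holomorphic, then `x` has no outgoing edges. -/
theorem Gam_eq_zero_of_tail {Y E : Type*} [Fintype Y] [DecidableEq Y] [Fintype E] [DecidableEq E]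
    (φ : Y → R) (t h : E → Y) (x : Y) (hφ : ∀ q, B.d (Sum.inr q) (φ x) = 0) (e : E) (he : t e = x) :
    B.Gam φ t h = 0 := by
  refine sum_eq_zero fun k _ => ?_
  rw [vprod, prod_eq_zero (mem_univ x), zero_mul]
  rw [lab, ← add_sum_erase _ _ (mem_univ e), if_pos he, add_assoc, iter_add, iter_singleton,
    d_iter, hφ, map_zero]

theorem Gam_eq_zero_of_head {Y E : Type*} [Fintype Y] [DecidableEq Y] [Fintype E] [DecidableEq E]
    (φ : Y → R) (t h : E → Y) (x : Y) (hφ : ∀ p, B.d (Sum.inl p) (φ x) = 0) (e : E) (he : h e = x) :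
    B.Gam φ t h = 0 := by
  refine sum_eq_zero fun k _ => ?_
  rw [vprod, prod_eq_zero (mem_univ x), zero_mul]
  rw [lab, ← add_sum_erase _ _ (mem_univ e), if_pos he, add_right_comm, iter_add, iter_singleton,
    hφ, map_zero]

end Linear

/-- Identities for the formal product are checked modulo each power of `X` on truncations. -/
theorem star_congr_of_dvd {x y : A⟦X⟧} (h : ∀ k, ∃ x' y', PowerSeries.X ^ (k + 1) ∣ x - x' ∧
    PowerSeries.X ^ (k + 1) ∣ y - y' ∧ PowerSeries.X ^ (k + 1) ∣ x' - y') : x = y := by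
  refine eq_of_X_pow_dvd fun k => ?_
  obtain ⟨x', y', h1, h2, h3⟩ := h k
  have : x - y = (x - x') - (y - y') + (x' - y') := by ring
  rw [this]
  exact dvd_add (dvd_sub h1 h2) h3

theorem X_pow_dvd_smul_sub {x y : A⟦X⟧} {k : ℕ} (c : ℂ⟦X⟧) (h : PowerSeries.X ^ k ∣ x - y) :
    PowerSeries.X ^ k ∣ c • x - c • y := by
  rw [← smul_sub, Algebra.smul_def]
  exact Dvd.dvd.mul_left h _

theorem star_add_right (f u v : A⟦X⟧) : D.star Φ f (u + v) = D.star Φ f u + D.star Φ f v := by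
  ext k
  simp [star, starN_add_right]

theorem star_add_left (f g u : A⟦X⟧) : D.star Φ (f + g) u = D.star Φ f u + D.star Φ g u := by
  ext k
  simp [star, starN_add_left]

variable {Φ}

theorem star_smul_right (h0 : Φ 0 = D.lead) (c : ℂ⟦X⟧) (f u : A⟦X⟧) :
    D.star Φ f (c • u) = c • D.star Φ f u := by
  refine star_congr_of_dvd fun k => ⟨_, _, D.X_pow_dvd_star_sub Φ h0 _ _ le_rfl,
    X_pow_dvd_smul_sub c (D.X_pow_dvd_star_sub Φ h0 _ _ le_rfl), ?_⟩
  rw [starN_smul_right, sub_self]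
  exact dvd_zero _

theorem star_smul_left (h0 : Φ 0 = D.lead) (c : ℂ⟦X⟧) (f u : A⟦X⟧) :
    D.star Φ (c • f) u = c • D.star Φ f u := by
  refine star_congr_of_dvd fun k => ⟨_, _, D.X_pow_dvd_star_sub Φ h0 _ _ le_rfl,
    X_pow_dvd_smul_sub c (D.X_pow_dvd_star_sub Φ h0 _ _ le_rfl), ?_⟩
  rw [starN_smul_left, sub_self]
  exact dvd_zero _

/-- Right multiplication by `∂̄_l pot`. -/
def rightMul (Φ : ℕ → A) (l : ι) (u : A⟦X⟧) : A⟦X⟧ :=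
  seriesDerivation (D.d (Sum.inr l)) (PowerSeries.mk Φ) * u +
    PowerSeries.X * seriesDerivation (D.d (Sum.inr l)) u

theorem star_X_mul (h0 : Φ 0 = D.lead) (f u : A⟦X⟧) :
    D.star Φ f (PowerSeries.X * u) = PowerSeries.X * D.star Φ f u := by
  have : ∀ v : A⟦X⟧, PowerSeries.X * v = (PowerSeries.X : ℂ⟦X⟧) • v := fun v => by
    rw [Algebra.smul_def, ← hbar, hbar_series]
  rw [this, this, star_smul_right D h0]

/-- Left multiplications commute with the right multiplications by `∂̄_l pot`. -/
theorem star_rightMul (h0 : Φ 0 = D.lead) (l : ι) (f u : A⟦X⟧) :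
    D.star Φ f (D.rightMul Φ l u) = D.rightMul Φ l (D.star Φ f u) := by
  rw [rightMul, star_add_right, star_X_mul D h0, rightMul]
  refine star_congr_of_dvd fun k => ?_
  have h1 := D.X_pow_dvd_star_sub Φ h0 f (seriesDerivation (D.d (Sum.inr l)) (PowerSeries.mk Φ) * u)
    (le_refl (3 * k + 6))
  have h2 := D.X_pow_dvd_star_sub Φ h0 f (seriesDerivation (D.d (Sum.inr l)) u) (le_refl (3 * k + 6))
  have h3 := D.X_pow_dvd_star_sub Φ h0 f u (le_refl (3 * k + 6))
  have h4 := X_pow_dvd_seriesDerivation (D.d (Sum.inr l)) h3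
  -- The value `n = 3k + 5` makes `n + 1` the cut-off `3k + 6` used in the three approximations
  -- above.
  have h5 := (D.formal Φ).hbar_pow_dvd_starN_defect (D.X_dvd_formal Φ h0) l f u (n := 3 * k + 5)
    (k := k) (by omega)
  rw [hbar_series] at h5
  refine ⟨_, _, ?_, ?_, h5⟩
  · rw [add_sub_add_comm, ← mul_sub]
    exact dvd_add h1 (Dvd.dvd.mul_left h2 _)
  · rw [add_sub_add_comm]
    refine dvd_add ?_ ?_
    · have := Dvd.dvd.mul_left h3 (seriesDerivation (D.d (Sum.inr l)) (PowerSeries.mk Φ))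
      rwa [mul_sub] at this
    · rw [map_sub] at h4
      have := Dvd.dvd.mul_left h4 PowerSeries.X
      rwa [mul_sub] at this

/-! ### Separation of variables -/

/-- Take an edge whose tail has least rank: an internal tail would receive an edge from a vertex of
smaller rank, and the last external vertex has no outgoing edges. -/
theorem exists_tail_eq_first {V E : Type*} [Fintype V] [DecidableEq V] [Fintype E] {μ : V → ℕ}
    {G : EndPair V E} (hG : Admissible μ G) (e : E) : ∃ e, G.1 e = Sum.inl 0 := by
  obtain ⟨r, hr⟩ := hG.acyc
  obtain ⟨e₀, -, he₀⟩ := exists_min_image univ (fun e => r (G.1 e)) ⟨e, mem_univ e⟩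
  refine ⟨e₀, ?_⟩
  rcases hx : G.1 e₀ with i | v
  · fin_cases i
    · rfl
    · exact absurd hx (hG.snk e₀)
  · obtain ⟨e₁, he₁⟩ := one_le_deg.1 (hG.in_pos v)
    have h1 := he₀ e₁ (mem_univ _)
    have h2 := hr e₁
    rw [he₁, ← hx] at h2
    omega

theorem exists_head_eq_last {V E : Type*} [Fintype V] [DecidableEq V] [Fintype E]
    {G : EndPair V E} (hG : Admissible 0 G) (e : E) : ∃ e, G.2 e = Sum.inl 1 := by
  obtain ⟨r, hr⟩ := hG.acyc
  obtain ⟨e₀, -, he₀⟩ := exists_max_image univ (fun e => r (G.2 e)) ⟨e, mem_univ e⟩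
  refine ⟨e₀, ?_⟩
  rcases hx : G.2 e₀ with i | v
  · fin_cases i
    · exact absurd hx (hG.src e₀)
    · rfl
  · obtain ⟨e₁, he₁⟩ := one_le_deg.1 (hG.out_pos v)
    have h1 := he₀ e₁ (mem_univ _)
    have h2 := hr e₁
    rw [he₁, ← hx] at h2
    omega

theorem graphSum_zero_zero {𝕜 R : Type*} [CommRing 𝕜] [CommRing R] [Algebra 𝕜 R]
    (B : PotentialAlgebra 𝕜 R ι) (f u : R) : B.graphSum (Fin 0) (Fin 0) f u = f * u := by
  classical
  have hG : ∀ G : EndPair (Fin 0) (Fin 0), Admissible 0 G := fun G =>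
    ⟨⟨fun _ => 0, fun e => e.elim0⟩, fun e => e.elim0, fun e => e.elim0, fun v => v.elim0, fun v => v.elim0⟩
  let _ : Unique (EndPair (Fin 0) (Fin 0)) :=
    ⟨⟨(fun e => e.elim0, fun e => e.elim0)⟩, fun G => Prod.ext (Subsingleton.elim _ _) (Subsingleton.elim _ _)⟩
  rw [graphSum, filter_true_of_mem fun G _ => hG G, Fintype.sum_unique, Gam, Fintype.sum_unique, vprod,
    Fintype.prod_sum_type]
  simp [lab, vtx]

/-- Each graph with an edge differentiates `f` anti-holomorphically and `u` holomorphically at least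
once, so it contributes zero. Without edges there are no internal vertices, and the product `f * u`
remains. -/
theorem starN_eq_mul {R : Type*} [CommRing R] [Algebra ℂ⟦X⟧ R] (B : PotentialAlgebra ℂ⟦X⟧ R ι)
    {f u : R} (hfu : (∀ q, B.d (Sum.inr q) f = 0) ∨ ∀ p, B.d (Sum.inl p) u = 0) (N : ℕ) :
    B.starN (N + 1) f u = f * u := by
  classical
  have h : ∀ a b, b ≠ 0 → B.graphSum (Fin a) (Fin b) f u = 0 := by
    intro a b hb
    refine sum_eq_zero fun G hG => ?_
    have hG := (mem_filter.1 hG).2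
    have e₀ : Fin b := ⟨0, Nat.pos_of_ne_zero hb⟩
    rcases hfu with hf | hu
    · obtain ⟨e, he⟩ := exists_tail_eq_first hG e₀
      exact B.Gam_eq_zero_of_tail _ _ _ (Sum.inl 0) hf e he
    · obtain ⟨e, he⟩ := exists_head_eq_last hG e₀
      exact B.Gam_eq_zero_of_head _ _ _ (Sum.inl 1) hu e he
  rw [starN, sum_eq_single 0, sum_eq_single 0]
  · rw [graphSum_zero_zero]
    simp [coef]
  · intro b _ hb
    rw [h 0 b hb, smul_zero]
  · simp
  · intro a _ ha
    refine sum_eq_zero fun b _ => ?_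
    by_cases hb : b = 0
    · subst hb
      rw [B.graphSum_eq_zero f u (Nat.pos_of_ne_zero ha), smul_zero]
    · rw [h a b hb, smul_zero]
  · simp

theorem star_eq_mul {f u : A⟦X⟧} (hfu : (∀ q, seriesDerivation (D.d (Sum.inr q)) f = 0) ∨
    ∀ p, seriesDerivation (D.d (Sum.inl p)) u = 0) : D.star Φ f u = f * u := by
  ext k
  rw [star, PowerSeries.coeff_mk, starN_eq_mul _ hfu]

theorem seriesDerivation_one (d : Derivation ℂ A A) : seriesDerivation d 1 = 0 :=
  (seriesDerivation d).map_one_eq_zero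

theorem star_one (f : A⟦X⟧) : D.star Φ f 1 = f := by
  rw [star_eq_mul D (Or.inr fun p => seriesDerivation_one _), mul_one]

theorem one_star (f : A⟦X⟧) : D.star Φ 1 f = f := by
  rw [star_eq_mul D (Or.inl fun p => seriesDerivation_one _), one_mul]

/-! ### Associativity -/

section Local

variable (ev : A →ₐ[ℂ] ℂ)

theorem iter_mem_seriesJetIdeal (r s : ℕ) (m : Multiset ι) {u : A⟦X⟧}
    (hu : u ∈ seriesJetIdeal (fun p => D.d (Sum.inl p)) ev r (s + m.card)) :
    (D.formal Φ).iter (m.map Sum.inl) u ∈ seriesJetIdeal (fun p => D.d (Sum.inl p)) ev r s := by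
  induction m using Multiset.induction_on generalizing u with
  | empty => simpa using hu
  | cons p m ih =>
    rw [Multiset.map_cons, iter_cons, d_iter]
    refine ih fun i hi => ?_
    rw [formal_d, coeff_seriesDerivation]
    have := hu i hi
    rw [Multiset.card_cons, ← add_assoc] at this
    exact this.2 p

/-- A vertex without outgoing edges is differentiated only holomorphically, and at most `b` times;
each derivative lowers the order of vanishing by one. -/
theorem Gam_mem_seriesJetIdeal {Y : Type*} [Fintype Y] [DecidableEq Y] {b : ℕ} (φ : Y → A⟦X⟧)
    (t h : Fin b → Y) (x : Y) (ht : ∀ e, t e ≠ x) (r s : ℕ)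
    (hx : φ x ∈ seriesJetIdeal (fun p => D.d (Sum.inl p)) ev r (s + b)) :
    (D.formal Φ).Gam φ t h ∈ seriesJetIdeal (fun p => D.d (Sum.inl p)) ev r s := by
  refine sum_mem fun k _ => Ideal.mul_mem_right _ _ ?_
  rw [vprod, ← mul_prod_erase _ _ (mem_univ x)]
  refine Ideal.mul_mem_right _ _ ?_
  have h1 : lab t h k x = ((univ.filter fun e => h e = x).val.map fun e => (k e).2).map Sum.inl := by
    rw [lab, Multiset.map_map]
    have : ∀ s : Finset (Fin b), s.val.map (Sum.inl ∘ fun e => (k e).2) =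
        ∑ e ∈ s, {(Sum.inl (k e).2 : ι ⊕ ι)} := fun s => by
      rw [Finset.sum_eq_multiset_sum, ← Multiset.sum_map_singleton (s.val.map _), Multiset.map_map]
      rfl
    rw [this, sum_filter]
    refine sum_congr rfl fun e _ => ?_
    rw [if_neg (ht e), zero_add]
  rw [h1]
  refine D.iter_mem_seriesJetIdeal ev r s _ fun i hi => VanishesTo.mono ?_ (hx i hi)
  rw [Multiset.card_map, Finset.card_val]
  have := card_le_univ (univ.filter fun e => h e = x)
  simp at this
  omega

/-- Locality of left multiplication: coefficients up to `r` involve fewer than `3r + 6` edges, hence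
fewer than `3r + 6` derivatives of `u`. -/
theorem star_mem_seriesJetIdeal (h0 : Φ 0 = D.lead) (f : A⟦X⟧) (r s : ℕ) {u : A⟦X⟧}
    (hu : u ∈ seriesJetIdeal (fun p => D.d (Sum.inl p)) ev r (s + (3 * r + 6))) :
    D.star Φ f u ∈ seriesJetIdeal (fun p => D.d (Sum.inl p)) ev r s := by
  classical
  have h1 : (D.formal Φ).starN (3 * r + 6) f u ∈ seriesJetIdeal (fun p => D.d (Sum.inl p)) ev r s := by
    refine sum_mem fun a _ => sum_mem fun b hb => ?_
    rw [Algebra.smul_def]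
    refine Ideal.mul_mem_left _ _ (sum_mem fun G hG => ?_)
    refine D.Gam_mem_seriesJetIdeal ev _ _ _ (Sum.inl 1) (mem_filter.1 hG).2.snk r s
      fun i hi => VanishesTo.mono ?_ (hu i hi)
    have := mem_range.1 hb
    omega
  intro i hi
  have h2 := PowerSeries.X_pow_dvd_iff.1 (D.X_pow_dvd_star_sub Φ h0 f u (le_refl (3 * r + 6))) i
    (by omega)
  rw [map_sub, sub_eq_zero] at h2
  rw [h2]
  exact h1 i hi

end Local

/-- A local operator which commutes with the right multiplications by `∂̄_l pot` and annihilates `1` is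
zero. -/
theorem eq_zero_of_commute {T : Type*} (ev : T → A →ₐ[ℂ] ℂ) (hev : ∀ a : A, (∀ x, ev x a = 0) → a = 0)
    (h0 : Φ 0 = D.lead) (L : A⟦X⟧ →ₗ[ℂ⟦X⟧] A⟦X⟧) (hL1 : L 1 = 0)
    (hL : ∀ l u, L (D.rightMul Φ l u) = D.rightMul Φ l (L u))
    (hloc : ∀ x r, ∃ s, ∀ u ∈ seriesJetIdeal (fun p => D.d (Sum.inl p)) (ev x) r s,
      ev x (PowerSeries.coeff r (L u)) = 0) (u : A⟦X⟧) : L u = 0 := by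
  have hX : ∀ v : A⟦X⟧, L (PowerSeries.X * v) = PowerSeries.X * L v := fun v => by
    have : ∀ v : A⟦X⟧, PowerSeries.X * v = (PowerSeries.X : ℂ⟦X⟧) • v := fun v => by
      rw [Algebra.smul_def, ← hbar, hbar_series]
    rw [this, this, map_smul]
  have key : ∀ r, ∀ u, PowerSeries.X ^ r ∣ L u := by
    intro r
    induction r with
    | zero => intro u; simp
    | succ r ih =>
      set w : ι → A := fun l => D.d (Sum.inr l) D.lead with hw
      -- Right multiplication by `∂̄_l pot` is multiplication by `w l` modulo `X`. As `X ^ r`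
      -- divides all values of `L`, the terms containing `X` do not reach the coefficient `r`.
      have hmul : ∀ l v, PowerSeries.coeff r (L (PowerSeries.C (w l * v))) =
          w l * PowerSeries.coeff r (L (PowerSeries.C v)) := by
        intro l v
        obtain ⟨q, hq⟩ : PowerSeries.X ∣
            seriesDerivation (D.d (Sum.inr l)) (PowerSeries.mk Φ) - PowerSeries.C (w l) := by
          rw [PowerSeries.X_dvd_iff]
          rw [← PowerSeries.coeff_zero_eq_constantCoeff_apply, map_sub, coeff_seriesDerivation,
            PowerSeries.coeff_mk, PowerSeries.coeff_zero_C, h0, sub_self]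
        rw [sub_eq_iff_eq_add] at hq
        have h1 : PowerSeries.C (w l * v) = D.rightMul Φ l (PowerSeries.C v) -
            PowerSeries.X * (q * PowerSeries.C v + seriesDerivation (D.d (Sum.inr l)) (PowerSeries.C v)) := by
          rw [rightMul, hq, map_mul]
          ring
        obtain ⟨y, hy⟩ := ih (PowerSeries.C v)
        obtain ⟨y', hy'⟩ := X_pow_dvd_seriesDerivation (D.d (Sum.inr l)) (ih (PowerSeries.C v))
        obtain ⟨y'', hy''⟩ := ih
          (q * PowerSeries.C v + seriesDerivation (D.d (Sum.inr l)) (PowerSeries.C v))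
        rw [h1, map_sub, hX, hL, rightMul, hq, hy', hy'']
        have h2 : (PowerSeries.X * q + PowerSeries.C (w l)) * L (PowerSeries.C v) +
            PowerSeries.X * (PowerSeries.X ^ r * y') - PowerSeries.X * (PowerSeries.X ^ r * y'') =
            PowerSeries.C (w l) * L (PowerSeries.C v) +
              PowerSeries.X ^ (r + 1) * (q * y + y' - y'') := by
          conv_lhs => rw [add_mul]
          rw [show PowerSeries.X * q * L (PowerSeries.C v) =
            PowerSeries.X * q * (PowerSeries.X ^ r * y) by rw [hy]]
          ring
        rw [h2, map_add, PowerSeries.coeff_C_mul, PowerSeries.coeff_X_pow_mul', if_neg (by omega),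
          add_zero]
      have hzero : ∀ v, PowerSeries.coeff r (L (PowerSeries.C v)) = 0 := by
        intro v
        refine hev _ fun x => ?_
        obtain ⟨s, hs⟩ := hloc x r
        have hC : ∀ (c : ℂ) (v : A), PowerSeries.C (c • v) = (PowerSeries.C c : ℂ⟦X⟧) • PowerSeries.C v := by
          intro c v
          rw [Algebra.smul_def, Algebra.smul_def, map_mul, PowerSeries.algebraMap_apply'', PowerSeries.map_C]
        let Tx : A →ₗ[ℂ] ℂ :=
          { toFun := fun v => ev x (PowerSeries.coeff r (L (PowerSeries.C v)))
            map_add' := fun a b => by simp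
            map_smul' := fun c a => by
              have : PowerSeries.coeff r ((PowerSeries.C c : ℂ⟦X⟧) • L (PowerSeries.C a)) =
                  c • PowerSeries.coeff r (L (PowerSeries.C a)) := by
                rw [Algebra.smul_def, PowerSeries.algebraMap_apply'', PowerSeries.map_C,
                  PowerSeries.coeff_C_mul, Algebra.smul_def]
              rw [hC, map_smul, this, map_smul]
              rfl }
        have hTw : ∀ l v, Tx (w l * v) = ev x (w l) * Tx v := fun l v => by
          change ev x _ = _ * ev x _
          rw [hmul, map_mul]
        -- The functions `w l - w l (x)` vanish at `x`; combining them with the inverse Hessian at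
        -- `x` normalises their holomorphic derivatives there to the identity matrix. The rule `hTw`
        -- makes `Tx` vanish on their multiples.
        refine eq_zero_of_jet (d := fun p => D.d (Sum.inl p)) (ev := ev x)
          (w := fun p => ∑ l, ev x (D.g l p) • (w l - algebraMap ℂ A (ev x (w l))))
          (fun p q u => D.comm _ _ _) (fun p => ?_) (fun p q => ?_) Tx ?_ (fun p v => ?_) s
          (fun u hu => ?_) v
        · simp
        · have h1 := congrArg (ev x) (D.contract_g q p)
          simp only [map_sum, map_mul] at h1
          have h2 : ∀ l, ev x (D.d (Sum.inl q) (ev x (D.g l p) • (w l - algebraMap ℂ A (ev x (w l))))) =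
              ev x (D.d (Sum.inl q) (D.d (Sum.inr l) D.lead)) * ev x (D.g l p) := fun l => by
            rw [Derivation.map_smul, map_sub, Derivation.map_algebraMap, sub_zero, map_smul, smul_eq_mul,
              mul_comm]
          rw [map_sum, map_sum, sum_congr rfl fun l _ => h2 l, h1]
          simp only [eq_comm (a := p)]
          split_ifs <;> simp
        · change ev x (PowerSeries.coeff r (L (PowerSeries.C 1))) = 0
          rw [map_one, hL1]
          simp
        · rw [sum_mul, map_sum]
          refine sum_eq_zero fun l _ => ?_
          rw [smul_mul_assoc, map_smul, sub_mul, map_sub, hTw, ← Algebra.smul_def, map_smul, smul_eq_mul,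
            smul_eq_mul, sub_self, mul_zero]
        · refine hs _ fun i hi => ?_
          rw [PowerSeries.coeff_C]
          split_ifs
          · exact hu
          · exact zero_mem _
      intro u
      have h1 : u = PowerSeries.C (PowerSeries.constantCoeff u) + PowerSeries.X *
          (PowerSeries.mk fun p => PowerSeries.coeff (p + 1) u) := by
        rw [add_comm]
        exact PowerSeries.eq_X_mul_shift_add_const u
      rw [h1, map_add, hX]
      refine dvd_add ?_ ?_
      · rw [PowerSeries.X_pow_dvd_iff]
        intro m hm
        rcases Nat.lt_succ_iff_lt_or_eq.1 hm with hm | rfl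
        · exact PowerSeries.X_pow_dvd_iff.1 (ih _) m hm
        · exact hzero _
      · rw [pow_succ']
        exact mul_dvd_mul_left _ (ih _)
  refine eq_of_X_pow_dvd fun k => ?_
  rw [sub_zero]
  exact key _ u

/-- Left multiplication as a linear map. -/
def leftMul (h0 : Φ 0 = D.lead) (f : A⟦X⟧) : A⟦X⟧ →ₗ[ℂ⟦X⟧] A⟦X⟧ where
  toFun := D.star Φ f
  map_add' := D.star_add_right Φ f
  map_smul' c u := D.star_smul_right h0 c f u

/-- The associator, as an operator in `u`, satisfies the hypotheses of `eq_zero_of_commute`: it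
kills `1` by normalization and commutes with each `rightMul` because left multiplications do. -/
theorem star_assoc {T : Type*} (ev : T → A →ₐ[ℂ] ℂ) (hev : ∀ a : A, (∀ x, ev x a = 0) → a = 0)
    (h0 : Φ 0 = D.lead) (f g u : A⟦X⟧) :
    D.star Φ (D.star Φ f g) u = D.star Φ f (D.star Φ g u) := by
  rw [eq_comm, ← sub_eq_zero]
  refine D.eq_zero_of_commute ev hev h0
    (D.leftMul h0 f ∘ₗ D.leftMul h0 g - D.leftMul h0 (D.star Φ f g)) ?_ (fun l u => ?_) (fun x r => ?_) u
  · change D.star Φ f (D.star Φ g 1) - D.star Φ (D.star Φ f g) 1 = 0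
    rw [star_one, star_one, sub_self]
  · change D.star Φ f (D.star Φ g _) - D.star Φ (D.star Φ f g) _ =
      D.rightMul Φ l (D.star Φ f (D.star Φ g u) - D.star Φ (D.star Φ f g) u)
    rw [star_rightMul D h0, star_rightMul D h0, star_rightMul D h0, rightMul, rightMul, rightMul, map_sub]
    ring
  -- Two successive left multiplications each cost `3r + 6` orders, and order `1` must remain for
  -- the value at `x` to vanish.
  · refine ⟨1 + (3 * r + 6) + (3 * r + 6), fun u hu => ?_⟩
    change ev x (PowerSeries.coeff r (D.star Φ f (D.star Φ g u) - D.star Φ (D.star Φ f g) u)) = 0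
    have h1 := D.star_mem_seriesJetIdeal (ev x) h0 f r 1
      (D.star_mem_seriesJetIdeal (ev x) h0 g r (1 + (3 * r + 6)) hu) r le_rfl
    have h2 := D.star_mem_seriesJetIdeal (ev x) h0 (D.star Φ f g) r 1 (u := u)
      (fun i hi => VanishesTo.mono (by omega) (hu i hi)) r le_rfl
    rw [map_sub, map_sub, h1.1, h2.1, sub_zero]

end PotentialAlgebra
end KahlerStar
end

/-! ### Labelled graphs, isomorphism classes, and finiteness. -/

noncomputable section

set_option linter.unusedSectionVars false

namespace KahlerStar

open Finset

namespace WGraph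

variable {n : ℕ}

theorem Iso.ext_equiv {G H : WGraph n} {φ ψ : Iso G H} (h1 : ∀ v, φ.onInt v = ψ.onInt v)
    (h2 : ∀ e, φ.onEdge e = ψ.onEdge e) : φ = ψ := by
  obtain ⟨a, b, _, _, _⟩ := φ
  obtain ⟨a', b', _, _, _⟩ := ψ
  obtain rfl : a = a' := Equiv.ext h1
  obtain rfl : b = b' := Equiv.ext h2
  rfl

instance finite_iso (G H : WGraph n) : Finite (Iso G H) := by
  refine Finite.of_injective (fun φ : Iso G H => (φ.onInt, φ.onEdge)) fun φ ψ h => ?_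
  simp only [Prod.mk.injEq] at h
  exact Iso.ext_equiv (fun v => by rw [h.1]) fun e => by rw [h.2]

theorem autCard_ne_zero (G : WGraph n) : G.autCard ≠ 0 := by
  have : Nonempty (Iso G G) := ⟨Iso.refl G⟩
  exact Nat.card_pos.ne'

/-- Transport of a graph along permutations of the internal vertices and of the edges. -/
def transport (G : WGraph n) (σ : Equiv.Perm (Fin G.numInt)) (τ : Equiv.Perm (Fin G.numEdge)) :
    WGraph n where
  numInt := G.numInt
  numEdge := G.numEdge
  head e := Sum.map id σ (G.head (τ.symm e))
  tail e := Sum.map id σ (G.tail (τ.symm e))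
  weight v := G.weight (σ.symm v)
  neg_one_le_weight v := G.neg_one_le_weight _
  acyclic v hv := by
    refine G.acyclic (Sum.map id σ.symm v) (hv.lift (Sum.map id σ.symm) ?_)
    rintro a b ⟨e, rfl, rfl⟩
    exact ⟨τ.symm e, by simp [Sum.map_map], by simp [Sum.map_map]⟩
  exists_head_eq v := by
    obtain ⟨e, he⟩ := G.exists_head_eq (σ.symm v)
    exact ⟨τ e, by simp [he]⟩
  exists_tail_eq v := by
    obtain ⟨e, he⟩ := G.exists_tail_eq (σ.symm v)
    exact ⟨τ e, by simp [he]⟩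
  first_source i hi e h := by
    refine G.first_source i hi (τ.symm e) ?_
    rcases hx : G.head (τ.symm e) with j | v
    · rw [hx] at h; simpa using h
    · rw [hx] at h; simp at h
  last_sink i hi e h := by
    refine G.last_sink i hi (τ.symm e) ?_
    rcases hx : G.tail (τ.symm e) with j | v
    · rw [hx] at h; simpa using h
    · rw [hx] at h; simp at h
  three_le_degree v hv := by
    have h := G.three_le_degree _ hv
    have key : ∀ f : Fin G.numEdge → Fin n ⊕ Fin G.numInt,
        (univ.filter fun e => Sum.map id σ (f (τ.symm e)) = Sum.inr v).card =
        (univ.filter fun e => f e = Sum.inr (σ.symm v)).card := by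
      intro f
      refine card_equiv τ.symm fun e => ?_
      simp only [mem_filter, mem_univ, true_and]
      rcases f (τ.symm e) with j | w
      · simp
      · simp [Equiv.eq_symm_apply]
    rw [key, key]
    exact h

/-- The isomorphism onto the transported graph. -/
def transportIso (G : WGraph n) (σ : Equiv.Perm (Fin G.numInt)) (τ : Equiv.Perm (Fin G.numEdge)) :
    Iso G (G.transport σ τ) where
  onInt := σ
  onEdge := τ
  head_onEdge e := congrArg (fun e => Sum.map id σ (G.head e)) (τ.symm_apply_apply e)
  tail_onEdge e := congrArg (fun e => Sum.map id σ (G.tail e)) (τ.symm_apply_apply e)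
  weight_onInt v := congrArg G.weight (σ.symm_apply_apply v)

theorem transport_bijective (G : WGraph n) : Function.Bijective
    (fun p : Equiv.Perm (Fin G.numInt) × Equiv.Perm (Fin G.numEdge) =>
      (⟨G.transport p.1 p.2, G.transportIso p.1 p.2⟩ : Σ H, Iso G H)) := by
  constructor
  · rintro ⟨σ, τ⟩ ⟨σ', τ'⟩ h
    have h1 := congrArg (fun q : Σ H, Iso G H => fun v => (q.2.onInt v).val) h
    have h2 := congrArg (fun q : Σ H, Iso G H => fun v => (q.2.onEdge v).val) h
    ext v
    · exact congrFun h1 v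
    · exact congrFun h2 v
  · rintro ⟨H, φ⟩
    have ha : G.numInt = H.numInt := by simpa using Fintype.card_congr φ.onInt
    have hb : G.numEdge = H.numEdge := by simpa using Fintype.card_congr φ.onEdge
    obtain ⟨a, b, hd, tl, w, p1, p2, p3, p4, p5, p6, p7⟩ := H
    dsimp only at ha hb
    subst ha hb
    obtain ⟨σ, τ, h1, h2, h3⟩ := φ
    dsimp only at σ τ h1 h2 h3
    refine ⟨(σ, τ), ?_⟩
    obtain rfl : hd = fun e => Sum.map id σ (G.head (τ.symm e)) := by
      funext e
      simpa using h1 (τ.symm e)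
    obtain rfl : tl = fun e => Sum.map id σ (G.tail (τ.symm e)) := by
      funext e
      simpa using h2 (τ.symm e)
    obtain rfl : w = fun v => G.weight (σ.symm v) := by
      funext v
      simpa using h3 (σ.symm v)
    rfl

open Classical in
/-- Pairs of an isomorphic graph and an automorphism are the same as isomorphic images. -/
def isoEquiv (G : WGraph n) : {H : WGraph n // Nonempty (Iso G H)} × Iso G G ≃ Σ H, Iso G H where
  toFun p := ⟨p.1.1, p.2.trans p.1.2.some⟩
  invFun q := ⟨⟨q.1, ⟨q.2⟩⟩, q.2.trans (Nonempty.some (⟨q.2⟩ : Nonempty (Iso G q.1))).symm⟩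
  left_inv := by
    rintro ⟨⟨H, h⟩, φ⟩
    refine Prod.ext rfl (Iso.ext_equiv (fun v => ?_) fun e => ?_) <;>
    simp [Iso.trans, Iso.symm]
  right_inv := by
    rintro ⟨H, φ⟩
    refine Sigma.ext rfl (heq_of_eq (Iso.ext_equiv (fun v => ?_) fun e => ?_)) <;>
    simp [Iso.trans, Iso.symm]

/-- The orbit-stabilizer theorem for labelled graphs. -/
theorem card_mul_autCard (G : WGraph n) : Nat.card {H : WGraph n // Nonempty (Iso G H)} * G.autCard =
    G.numInt.factorial * G.numEdge.factorial := by
  -- Both sides count pairs of a graph `H` and an isomorphism from `G` to `H`: transport identifies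
  -- them with pairs of permutations, a chosen isomorphism for each `H` with automorphisms of `G`.
  rw [autCard, ← Nat.card_prod, Nat.card_congr G.isoEquiv,
    ← Nat.card_congr (Equiv.ofBijective _ G.transport_bijective), Nat.card_prod, Nat.card_perm,
    Nat.card_perm, Nat.card_fin, Nat.card_fin]

/-! ### The admissible pair of a graph with two external vertices -/

/-- The tails and heads of the edges. -/
def ends (G : WGraph 2) : EndPair (Fin G.numInt) (Fin G.numEdge) := (G.tail, G.head)

/-- A rank function from acyclicity. -/
theorem exists_rank {Y E : Type*} [Finite Y] (t h : E → Y)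
    (hac : ∀ v, ¬ Relation.TransGen (fun a b => ∃ e, t e = a ∧ h e = b) v v) :
    ∃ r : Y → ℕ, ∀ e, r (t e) < r (h e) := by
  classical
  have := Fintype.ofFinite Y
  -- The rank is the number of strict predecessors; along an edge the tail itself is a new one.
  refine ⟨fun x => (univ.filter fun y => Relation.TransGen (fun a b => ∃ e, t e = a ∧ h e = b) y x).card,
    fun e => card_lt_card ?_⟩
  rw [ssubset_iff_of_subset]
  · refine ⟨t e, ?_, ?_⟩
    · simpa using Relation.TransGen.single ⟨e, rfl, rfl⟩
    · simpa using hac (t e)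
  · intro y hy
    simp only [mem_filter, mem_univ, true_and] at hy ⊢
    exact hy.tail ⟨e, rfl, rfl⟩

theorem acyclic_of_rank {Y E : Type*} {t h : E → Y} {r : Y → ℕ} (hr : ∀ e, r (t e) < r (h e)) (v : Y) :
    ¬ Relation.TransGen (fun a b => ∃ e, t e = a ∧ h e = b) v v := by
  intro hv
  have key : ∀ {a b}, Relation.TransGen (fun a b => ∃ e, t e = a ∧ h e = b) a b → r a < r b := by
    intro a b hab
    induction hab with
    | single h1 => obtain ⟨e, rfl, rfl⟩ := h1; exact hr e
    | tail _ h1 ih => obtain ⟨e, rfl, rfl⟩ := h1; exact ih.trans (hr e)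
  exact lt_irrefl _ (key hv)

theorem ends_admissible (G : WGraph 2) : Admissible 0 G.ends where
  acyc := exists_rank _ _ G.acyclic
  src := G.first_source 0 rfl
  snk := G.last_sink 1 rfl
  in_pos v := one_le_deg.2 (G.exists_head_eq v)
  out_pos v := le_add_right (one_le_deg.2 (G.exists_tail_eq v))

theorem three_le_deg (G : WGraph 2) (v : Fin G.numInt) (hv : (G.weight v + 1).toNat = 0) :
    3 ≤ deg G.ends.2 (Sum.inr v) + deg G.ends.1 (Sum.inr v) := by
  have h1 := G.neg_one_le_weight v
  have h := G.three_le_degree v (by omega)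
  rw [deg_eq_card, deg_eq_card]
  exact h

theorem totalWeight_eq (G : WGraph 2) :
    G.totalWeight + G.numInt = G.numEdge + ((∑ v, (G.weight v + 1).toNat : ℕ) : ℤ) := by
  have h : ∀ v, (((G.weight v + 1).toNat : ℕ) : ℤ) = G.weight v + 1 := fun v =>
    Int.toNat_of_nonneg (by linarith [G.neg_one_le_weight v])
  push_cast
  simp only [h, sum_add_distrib, totalWeight]
  simp
  ring

theorem numInt_le (G : WGraph 2) : G.numInt ≤ G.numEdge := by
  simpa using G.ends_admissible.card_le

/-- A bivalent vertex has weight at least `0`, hence shifted weight at least `1`, so the half-edge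
count `card_bivalent` bounds the edges by the total weight. Nonnegativity and finiteness both
follow. -/
theorem numEdge_le (G : WGraph 2) : (G.numEdge : ℤ) ≤ 3 * G.totalWeight + 2 := by
  have h1 := G.ends_admissible.card_bivalent (Sum.inl 0) (by simp)
  have h2 : (bivalent 0 G.ends (Sum.inl 0)).card ≤ ∑ v, (G.weight v + 1).toNat := by
    rw [bivalent, card_filter]
    refine sum_le_sum fun v _ => ?_
    split_ifs with h
    · by_contra hc
      have := G.three_le_deg v (by omega)
      simp only [Pi.zero_apply, add_zero] at h
      omega
    · exact Nat.zero_le _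
  have h3 := G.totalWeight_eq
  have h4 := G.numInt_le
  simp only [Fintype.card_fin] at h1
  omega

theorem totalWeight_nonneg (G : WGraph 2) : 0 ≤ G.totalWeight := by
  have := G.numEdge_le
  omega

/-- The data of a graph: its numbers of internal vertices and edges, its tail and head functions, and its shifted
weights. -/
abbrev Data : Type := Σ p : ℕ × ℕ, EndPair (Fin p.1) (Fin p.2) × (Fin p.1 → ℕ)

def toData (G : WGraph 2) : Data :=
  ⟨(G.numInt, G.numEdge), G.ends, fun v => (G.weight v + 1).toNat⟩

theorem toData_injective : Function.Injective toData := by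
  rintro ⟨a, b, hd, tl, w, p1, p2, p3, p4, p5, p6, p7⟩ ⟨a', b', hd', tl', w', q1, q2, q3, q4, q5, q6, q7⟩ h
  simp only [toData, ends, Sigma.mk.injEq, Prod.mk.injEq] at h
  obtain ⟨⟨rfl, rfl⟩, h⟩ := h
  simp only [heq_eq_eq, Prod.mk.injEq] at h
  obtain ⟨⟨rfl, rfl⟩, h⟩ := h
  obtain rfl : w = w' := by
    funext v
    have := congrFun h v
    have h1 := p1 v
    have h2 := q1 v
    omega
  rfl

/-- The data of the graphs. -/
def IsGraphData (x : Data) : Prop :=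
  Admissible 0 x.2.1 ∧ ∀ v, x.2.2 v = 0 → 3 ≤ deg x.2.1.2 (Sum.inr v) + deg x.2.1.1 (Sum.inr v)

theorem exists_toData {x : Data} (hx : IsGraphData x) : ∃ G : WGraph 2, G.toData = x := by
  obtain ⟨⟨a, b⟩, ⟨t, h⟩, j⟩ := x
  obtain ⟨⟨⟨r, hr⟩, h1, h2, h3, h4⟩, h5⟩ := hx
  refine ⟨{ numInt := a, numEdge := b, head := h, tail := t, weight := fun v => (j v : ℤ) - 1,
            neg_one_le_weight := fun v => by omega
            acyclic := acyclic_of_rank hr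
            exists_head_eq := fun v => one_le_deg.1 (h3 v)
            exists_tail_eq := fun v => one_le_deg.1 (by simpa using h4 v)
            first_source := fun i hi e => ?_
            last_sink := fun i hi e => ?_
            three_le_degree := fun v hv => ?_ }, ?_⟩
  · obtain rfl : i = 0 := Fin.ext hi
    exact h1 e
  · obtain rfl : i = 1 := Fin.ext (by simpa using hi)
    exact h2 e
  · have := h5 v (by simpa using hv)
    simpa [deg_eq_card] using this
  · simp [toData, ends]

theorem toData_isGraphData (G : WGraph 2) : IsGraphData G.toData :=
  ⟨G.ends_admissible, G.three_le_deg⟩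

open Classical in
/-- The data of the graphs of total weight `k`. -/
def dataOfWeight (k : ℕ) : Finset Data :=
  -- The bounds exclude nothing, since `a ≤ b ≤ 3k + 2`; they agree with the cut-off in `star`. The
  -- remaining weight `k - (b - a)` is distributed over the internal vertices as shifted weights.
  (((range (3 * k + 6)) ×ˢ (range (3 * k + 6))).sigma fun p =>
    (univ : Finset (EndPair (Fin p.1) (Fin p.2))) ×ˢ
      (if p.2 - p.1 ≤ k then piAntidiag univ (k - (p.2 - p.1)) else ∅)).filter IsGraphData

theorem mem_dataOfWeight {k : ℕ} {x : Data} : x ∈ dataOfWeight k ↔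
    IsGraphData x ∧ x.1.1 < 3 * k + 6 ∧ x.1.2 < 3 * k + 6 ∧ x.1.2 + ∑ v, x.2.2 v = k + x.1.1 := by
  obtain ⟨⟨a, b⟩, G, j⟩ := x
  have hmem : ∀ n, j ∈ piAntidiag univ n ↔ ∑ v, j v = n := fun n => by simp
  have h : IsGraphData ⟨(a, b), G, j⟩ → a ≤ b := fun h => by simpa using h.1.card_le
  by_cases hab : b - a ≤ k
  · simp only [dataOfWeight, mem_filter, mem_sigma, mem_product, mem_range, mem_univ, true_and, if_pos hab,
      hmem]
    constructor
    · rintro ⟨⟨⟨h1, h2⟩, h3⟩, h4⟩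
      have := h h4
      exact ⟨h4, h1, h2, by omega⟩
    · rintro ⟨h4, h1, h2, h3⟩
      have := h h4
      exact ⟨⟨⟨h1, h2⟩, by omega⟩, h4⟩
  · simp only [dataOfWeight, mem_filter, mem_sigma, mem_product, mem_range, mem_univ, if_neg hab,
      notMem_empty, and_false, false_and, false_iff]
    rintro ⟨h4, h1, h2, h3⟩
    omega

theorem toData_mem_iff {k : ℕ} {G : WGraph 2} : G.toData ∈ dataOfWeight k ↔ G.totalWeight = k := by
  rw [mem_dataOfWeight]
  have h1 := G.totalWeight_eq
  have h2 := G.numEdge_le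
  have h3 := G.numInt_le
  change IsGraphData G.toData ∧ G.numInt < _ ∧ G.numEdge < _ ∧
    G.numEdge + ∑ v, (G.weight v + 1).toNat = k + G.numInt ↔ _
  constructor
  · rintro ⟨-, -, -, h⟩
    omega
  · intro h
    exact ⟨G.toData_isGraphData, by omega, by omega, by omega⟩

theorem finite_totalWeight (k : ℕ) : {G : WGraph 2 | G.totalWeight = k}.Finite := by
  refine Set.Finite.of_finite_image ((dataOfWeight k).finite_toSet.subset ?_) toData_injective.injOn
  rintro _ ⟨G, hG, rfl⟩
  exact toData_mem_iff.2 hG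

/-- Sums over the graphs of total weight `k` are sums over data. -/
theorem sum_dataOfWeight {R : Type*} [AddCommMonoid R] (k : ℕ) (F : Data → R) :
    ∑ G ∈ (finite_totalWeight k).toFinset, F G.toData = ∑ x ∈ dataOfWeight k, F x := by
  refine sum_bij (fun G _ => G.toData) (fun G hG => ?_) (fun G _ G' _ h => toData_injective h)
    (fun x hx => ?_) fun _ _ => rfl
  · exact toData_mem_iff.2 (by simpa using hG)
  · obtain ⟨G, rfl⟩ := exists_toData (mem_dataOfWeight.1 hx).1
    exact ⟨G, by simpa using toData_mem_iff.1 hx, rfl⟩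

end WGraph

theorem finite_graphClassOfWeight (k : ℕ) : Finite (GraphClassOfWeight 2 k) := by
  have := (WGraph.finite_totalWeight k).to_subtype
  refine Finite.of_surjective (fun G : {G : WGraph 2 | G.totalWeight = k} =>
    (⟨Quotient.mk _ G.1, G.2⟩ : GraphClassOfWeight 2 k)) ?_
  rintro ⟨c, hc⟩
  induction c using Quotient.inductionOn with
  | h G => exact ⟨⟨G, hc⟩, rfl⟩

theorem GraphClassOfWeight.mk_rep {n : ℕ} {k : ℤ} (c : GraphClassOfWeight n k) :
    Quotient.mk (WGraph.isoSetoid n) c.rep = c.1 := Quotient.out_eq _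

/-- The sum over isomorphism classes weighted by automorphisms is the sum over labelled graphs weighted
by the number of labellings. -/
theorem finsum_graphClass (k : ℕ) (F : WGraph 2 → ℂ)
    (hF : ∀ G H : WGraph 2, Nonempty (WGraph.Iso G H) → F G = F H) :
    ∑ᶠ c : GraphClassOfWeight 2 k, (1 / (c.rep.autCard : ℂ)) * F c.rep =
      ∑ G ∈ (WGraph.finite_totalWeight k).toFinset,
        ((G.numInt.factorial * G.numEdge.factorial : ℂ)⁻¹) * F G := by
  classical
  have := finite_graphClassOfWeight k
  have := Fintype.ofFinite (GraphClassOfWeight 2 k)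
  rw [finsum_eq_sum_of_fintype]
  have : Fintype {G : WGraph 2 // G.totalWeight = k} := (WGraph.finite_totalWeight k).fintype
  rw [sum_subtype (WGraph.finite_totalWeight k).toFinset (p := fun G => G.totalWeight = (k : ℤ))
    (by simp) (fun G => ((G.numInt.factorial * G.numEdge.factorial : ℂ)⁻¹) * F G)]
  let cls : {G : WGraph 2 // G.totalWeight = k} → GraphClassOfWeight 2 k := fun G =>
    ⟨Quotient.mk _ G.1, G.2⟩
  rw [← sum_fiberwise (s := univ) (g := cls)]
  refine sum_congr rfl fun c _ => ?_
  have hiso : ∀ G : {G : WGraph 2 // G.totalWeight = k}, cls G = c ↔ Nonempty (WGraph.Iso c.rep G.1) := by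
    intro G
    have h : cls G = c ↔ c.1 = (cls G).1 := eq_comm.trans Subtype.ext_iff
    rw [h, ← c.mk_rep]
    exact Quotient.eq (r := WGraph.isoSetoid 2)
  have hterm : ∀ G ∈ univ.filter (fun G => cls G = c),
      ((G.1.numInt.factorial * G.1.numEdge.factorial : ℂ)⁻¹) * F G.1 =
      ((c.rep.numInt.factorial * c.rep.numEdge.factorial : ℂ)⁻¹) * F c.rep := by
    intro G hG
    obtain ⟨φ⟩ := (hiso G).1 (mem_filter.1 hG).2
    have ha : c.rep.numInt = G.1.numInt := by simpa using Fintype.card_congr φ.onInt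
    have hb : c.rep.numEdge = G.1.numEdge := by simpa using Fintype.card_congr φ.onEdge
    rw [ha, hb, hF _ _ ⟨φ⟩]
  rw [sum_congr rfl hterm, sum_const, nsmul_eq_mul, ← mul_assoc]
  congr 1
  -- The fibre over a class consists of all labelled graphs isomorphic to its representative; by
  -- orbit-stabilizer there are `a! b! / |Aut|` of them.
  have hcard : (univ.filter (fun G => cls G = c)).card =
      Nat.card {H : WGraph 2 // Nonempty (WGraph.Iso c.rep H)} := by
    rw [← Fintype.card_subtype, ← Nat.card_eq_fintype_card]
    have hw : c.rep.totalWeight = k := by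
      have := c.2
      rw [← c.mk_rep] at this
      exact this
    refine Nat.card_congr ⟨fun G => ⟨G.1.1, (hiso G.1).1 G.2⟩, fun H => ⟨⟨H.1, ?_⟩, (hiso _).2 H.2⟩,
      fun _ => rfl, fun _ => rfl⟩
    obtain ⟨φ⟩ := H.2
    rw [← WGraph.totalWeight_congr φ, hw]
  have h1 := c.rep.card_mul_autCard
  rw [hcard]
  have h2 : (c.rep.autCard : ℂ) ≠ 0 := by exact_mod_cast c.rep.autCard_ne_zero
  have h3 : (c.rep.numInt.factorial : ℂ) ≠ 0 := by exact_mod_cast Nat.factorial_ne_zero _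
  have h4 : (c.rep.numEdge.factorial : ℂ) ≠ 0 := by exact_mod_cast Nat.factorial_ne_zero _
  rw [← Nat.cast_inj (R := ℂ)] at h1
  push_cast at h1
  field_simp
  rw [mul_comm] at h1
  exact h1.symm

end KahlerStar
end

/-! ### Low-order terms, and coefficients as sums over weighted graphs. -/

noncomputable section

set_option linter.unusedSectionVars false

namespace KahlerStar

open Finset

section Count

variable {V E : Type*} [Fintype V] [DecidableEq V] [Fintype E] [DecidableEq E]

theorem sum_deg_add_le (h : E → Fin 2 ⊕ V) (i : Fin 2) :
    ∑ v : V, deg h (Sum.inr v) + deg h (Sum.inl i) ≤ Fintype.card E := by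
  simp only [deg]
  rw [sum_comm, ← sum_add_distrib, Fintype.card_eq_sum_ones]
  refine sum_le_sum fun e _ => ?_
  rcases hx : h e with j | w
  · simp only [reduceCtorEq, if_false, sum_const_zero, zero_add]
    split_ifs <;> simp
  · simp

/-- Sharper than `card_bivalent`: some tail lies at the first and some head at the last external
vertex, so at most `2|E| - 2` half-edges are left for internal vertices. -/
theorem Admissible.card_bivalent_of_edge {G : EndPair V E} (hG : Admissible 0 G) (e : E) :
    3 * Fintype.card V + 2 ≤ 2 * Fintype.card E + (bivalent 0 G (Sum.inl 0)).card := by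
  have h1 : ∀ v, 3 ≤ (deg G.2 (Sum.inr v) + deg G.1 (Sum.inr v)) +
      (if (Sum.inr v : Fin 2 ⊕ V) ≠ Sum.inl 0 ∧
        deg G.2 (Sum.inr v) + deg G.1 (Sum.inr v) + (0 : V → ℕ) v < 3 then 1 else 0) := by
    intro v
    have ha := hG.in_pos v
    have hb := hG.out_pos v
    simp only [Pi.zero_apply, add_zero, ne_eq, reduceCtorEq, not_false_eq_true, true_and] at *
    split_ifs with h <;> omega
  have h2 := sum_le_sum fun v (_ : v ∈ univ) => h1 v
  simp only [sum_add_distrib, sum_const, card_univ, smul_eq_mul] at h2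
  rw [bivalent, card_filter]
  have h4 := sum_deg_add_le G.1 0
  have h5 := sum_deg_add_le G.2 1
  have h6 := one_le_deg.2 (PotentialAlgebra.exists_tail_eq_first hG e)
  have h7 := one_le_deg.2 (PotentialAlgebra.exists_head_eq_last hG e)
  omega

end Count

namespace PotentialAlgebra

section LowOrder

variable {R ι : Type*} [CommRing R] [Algebra ℂ⟦X⟧ R] [Fintype ι] [DecidableEq ι]
variable (B : PotentialAlgebra ℂ⟦X⟧ R ι)

/-- Below order two only the empty graph and the single edge contribute. -/
theorem hbar_sq_dvd_graphSum (hpot : hbar R ∣ B.pot - B.lead) (f u : R) {a b : ℕ}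
    (hab : 2 ≤ b ∨ 1 ≤ a) : hbar R ^ 2 ∣ coef a b • B.graphSum (Fin a) (Fin b) f u := by
  classical
  rw [graphSum, smul_sum]
  refine dvd_sum fun G hG => ?_
  have hG := (mem_filter.1 hG).2
  have h3 : a ≤ b := by simpa using hG.card_le
  have h2 := hG.card_bivalent_of_edge (⟨0, by omega⟩ : Fin b)
  have h1 : hbar R ^ ((bivalent 0 G (Sum.inl 0)).map ⟨Sum.inr, Sum.inr_injective⟩ :
      Finset (Fin 2 ⊕ Fin a)).card ∣ B.Gam (B.vtx f u 0 G) G.1 G.2 := by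
    refine B.hbar_pow_dvd_Gam _ _ _ _ fun x hx => ?_
    obtain ⟨v, hv, rfl⟩ := mem_map.1 hx
    simp only [bivalent, mem_filter, mem_univ, true_and] at hv
    simp only [vtx, Function.Embedding.coeFn_mk, Sum.elim_inr, potOfDeg, if_neg (not_le.2 hv.2)]
    rwa [dvd_neg]
  rw [card_map] at h1
  rw [coef, mul_smul, Algebra.smul_def, Algebra.smul_def, map_pow]
  refine Dvd.dvd.mul_left ?_ _
  refine (pow_dvd_pow _ ?_).trans (pow_add (hbar R) _ _ ▸ mul_dvd_mul_left _ h1)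
  simp only [Fintype.card_fin] at h2
  omega

theorem hbar_sq_dvd_starN_sub (hpot : hbar R ∣ B.pot - B.lead) (f u : R) (n : ℕ) :
    hbar R ^ 2 ∣ B.starN (n + 2) f u - (f * u + coef 0 1 • B.graphSum (Fin 0) (Fin 1) f u) := by
  have h : B.starN (n + 2) f u = (f * u + coef 0 1 • B.graphSum (Fin 0) (Fin 1) f u) +
      (∑ b ∈ range n, coef 0 (b + 2) • B.graphSum (Fin 0) (Fin (b + 2)) f u +
      ∑ a ∈ range (n + 1), ∑ b ∈ range (n + 2), coef (a + 1) b •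
        B.graphSum (Fin (a + 1)) (Fin b) f u) := by
    have hb : ∑ b ∈ range (n + 2), coef 0 b • B.graphSum (Fin 0) (Fin b) f u =
        ∑ b ∈ range n, coef 0 (b + 2) • B.graphSum (Fin 0) (Fin (b + 2)) f u +
          coef 0 1 • B.graphSum (Fin 0) (Fin 1) f u + f * u := by
      have h1 : coef 0 0 = 1 := by simp [coef]
      rw [sum_range_succ', sum_range_succ', graphSum_zero_zero, h1, one_smul]
    rw [starN, sum_range_succ', hb]
    abel
  rw [h, add_sub_cancel_left]
  exact dvd_add (dvd_sum fun b _ => B.hbar_sq_dvd_graphSum hpot f u (Or.inl (by omega)))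
    (dvd_sum fun a _ => dvd_sum fun b _ => B.hbar_sq_dvd_graphSum hpot f u (Or.inr (by omega)))

theorem graphSum_zero_one (f u : R) : B.graphSum (Fin 0) (Fin 1) f u =
    ∑ q, ∑ p, B.g q p * (B.d (Sum.inr q) f * B.d (Sum.inl p) u) := by
  classical
  have hG : (univ.filter fun G : EndPair (Fin 0) (Fin 1) => Admissible 0 G) =
      {(fun _ => Sum.inl 0, fun _ => Sum.inl 1)} := by
    ext G
    simp only [mem_filter, mem_univ, true_and, mem_singleton]
    constructor
    · intro h
      obtain ⟨e, he⟩ := exists_tail_eq_first h 0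
      obtain ⟨e', he'⟩ := exists_head_eq_last h 0
      refine Prod.ext (funext fun i => ?_) (funext fun i => ?_)
      · rw [Subsingleton.elim i e, he]
      · rw [Subsingleton.elim i e', he']
    · rintro rfl
      refine ⟨⟨Sum.elim (fun i => i.val) fun _ => 0, fun e => ?_⟩, fun e => ?_, fun e => ?_,
        fun v => v.elim0, fun v => v.elim0⟩ <;> simp
  rw [graphSum, hG, sum_singleton, Gam, ← Fintype.sum_prod_type']
  refine Fintype.sum_equiv (Equiv.funUnique (Fin 1) (ι × ι)) _ _ fun k => ?_
  rw [vprod, Fintype.prod_sum_type]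
  simp [lab, vtx]
  ring

end LowOrder

variable {A ι : Type*} [CommRing A] [Algebra ℂ A] [Fintype ι] [DecidableEq ι]
variable (D : PotentialAlgebra ℂ A ι) (Φ : ℕ → A)

theorem coeff_iter (s : Multiset (ι ⊕ ι)) (F : A⟦X⟧) (n : ℕ) :
    PowerSeries.coeff n ((D.formal Φ).iter s F) = D.iter s (PowerSeries.coeff n F) := by
  induction s using Multiset.induction_on with
  | empty => rfl
  | cons i s ih => rw [iter_cons, iter_cons, formal_d, coeff_seriesDerivation, ih]

theorem iter_C (s : Multiset (ι ⊕ ι)) (f : A) :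
    (D.formal Φ).iter s (PowerSeries.C f) = PowerSeries.C (D.iter s f) := by
  ext n
  rw [coeff_iter, PowerSeries.coeff_C, PowerSeries.coeff_C]
  split_ifs <;> simp

theorem coeff_smul_coef (a b k : ℕ) (F : A⟦X⟧) : PowerSeries.coeff k (coef a b • F) =
    ((a.factorial * b.factorial : ℂ)⁻¹) •
      (if b - a ≤ k then PowerSeries.coeff (k - (b - a)) F else 0) := by
  have h : algebraMap ℂ⟦X⟧ A⟦X⟧ (coef a b) =
      PowerSeries.C (algebraMap ℂ A (a.factorial * b.factorial : ℂ)⁻¹) * PowerSeries.X ^ (b - a) := by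
    rw [coef, PowerSeries.algebraMap_apply'', map_mul, PowerSeries.map_C, map_pow, PowerSeries.map_X]
  rw [Algebra.smul_def, h, mul_assoc, PowerSeries.coeff_C_mul, PowerSeries.coeff_X_pow_mul',
    ← Algebra.smul_def]

variable {Φ}

theorem coeff_zero_star (h0 : Φ 0 = D.lead) (f u : A) :
    PowerSeries.coeff 0 (D.star Φ (PowerSeries.C f) (PowerSeries.C u)) = f * u := by
  have h := (D.formal Φ).hbar_sq_dvd_starN_sub (D.X_dvd_formal Φ h0) (PowerSeries.C f)
    (PowerSeries.C u) 4
  rw [hbar_series, PowerSeries.X_pow_dvd_iff] at h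
  have h1 := h 0 (by omega)
  rw [map_sub, sub_eq_zero] at h1
  rw [star, PowerSeries.coeff_mk, h1, map_add, coeff_smul_coef]
  simp [← map_mul]

theorem coeff_one_star (h0 : Φ 0 = D.lead) (f u : A) :
    PowerSeries.coeff 1 (D.star Φ (PowerSeries.C f) (PowerSeries.C u)) =
      ∑ q, ∑ p, D.g q p * (D.d (Sum.inr q) f * D.d (Sum.inl p) u) := by
  have h := (D.formal Φ).hbar_sq_dvd_starN_sub (D.X_dvd_formal Φ h0) (PowerSeries.C f)
    (PowerSeries.C u) 7
  rw [hbar_series, PowerSeries.X_pow_dvd_iff] at h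
  have h1 := h 1 (by omega)
  rw [map_sub, sub_eq_zero] at h1
  rw [star, PowerSeries.coeff_mk, h1, map_add, coeff_smul_coef, graphSum_zero_one, ← map_mul,
    PowerSeries.coeff_C, if_neg one_ne_zero, zero_add]
  have hg : ∀ q p, (D.formal Φ).g q p = PowerSeries.C (D.g q p) := fun _ _ => rfl
  simp only [formal_d, seriesDerivation_C, hg, ← map_mul, ← map_sum]
  simp

variable (Φ)

/-- The metric and the external functions are constant series, so the order `n` is distributed over
the internal vertices; `j v` is the shifted weight of `v`. -/
theorem coeff_Gam {V E : Type*} [Fintype V] [DecidableEq V] [Fintype E] [DecidableEq E] (f u : A)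
    (ψ : V → A⟦X⟧) (t h : E → Fin 2 ⊕ V) (n : ℕ) :
    PowerSeries.coeff n ((D.formal Φ).Gam (Sum.elim ![PowerSeries.C f, PowerSeries.C u] ψ) t h) =
      ∑ j ∈ piAntidiag univ n, D.Gam (Sum.elim ![f, u] fun v => PowerSeries.coeff (j v) (ψ v)) t h := by
  simp only [Gam, map_sum]
  rw [sum_comm]
  refine sum_congr rfl fun k _ => ?_
  have hg : ∏ e, (D.formal Φ).g (k e).1 (k e).2 = PowerSeries.C (∏ e, D.g (k e).1 (k e).2) := by
    rw [map_prod]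
    rfl
  have hsum : ∀ F : (V → ℕ) → A,
      ∑ l ∈ finsuppAntidiag univ n, F l = ∑ j ∈ piAntidiag univ n, F j := fun F =>
    sum_bij' (fun l _ => l) (fun j _ => Finsupp.equivFunOnFinite.symm j) (fun l hl => by simpa using hl)
      (fun j hj => by simpa using hj) (fun l _ => by simp) (fun j _ => by simp) fun l _ => rfl
  rw [hg, PowerSeries.coeff_mul_C, ← sum_mul]
  congr 1
  simp only [vprod, Fintype.prod_sum_type, Sum.elim_inl, Sum.elim_inr, Fin.prod_univ_two,
    Matrix.cons_val_zero, Matrix.cons_val_one, iter_C, ← map_mul]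
  rw [PowerSeries.coeff_C_mul, PowerSeries.coeff_prod, ← mul_sum]
  congr 1
  simp only [coeff_iter]
  exact hsum fun j => ∏ v, D.iter (lab t h k (Sum.inr v)) (PowerSeries.coeff (j v) (ψ v))

theorem Gam_eq_zero {Y E : Type*} [Fintype Y] [DecidableEq Y] [Fintype E] [DecidableEq E] (φ : Y → A)
    (t h : E → Y) (x : Y) (hx : φ x = 0) : D.Gam φ t h = 0 :=
  sum_eq_zero fun k _ => by
    rw [vprod, prod_eq_zero (mem_univ x) (by rw [hx, map_zero]), zero_mul]

variable {Φ}

/-- The coefficients of the formal product as sums over the data of labelled graphs. -/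
theorem coeff_star (h0 : Φ 0 = D.lead) (f u : A) (k : ℕ) :
    PowerSeries.coeff k (D.star Φ (PowerSeries.C f) (PowerSeries.C u)) =
      ∑ x ∈ WGraph.dataOfWeight k, ((x.1.1.factorial * x.1.2.factorial : ℂ)⁻¹) •
        D.Gam (Sum.elim ![f, u] fun v => -Φ (x.2.2 v)) x.2.1.1 x.2.1.2 := by
  classical
  rw [star, PowerSeries.coeff_mk, starN, WGraph.dataOfWeight, sum_filter, sum_sigma, sum_product]
  simp only [map_sum, coeff_smul_coef]
  refine sum_congr rfl fun a _ => sum_congr rfl fun b _ => ?_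
  rw [sum_product]
  split_ifs with hab
  · rw [graphSum, map_sum, smul_sum, sum_filter]
    refine sum_congr rfl fun G _ => ?_
    by_cases hG : Admissible 0 G
    · rw [if_pos hG, vtx, coeff_Gam, smul_sum]
      refine sum_congr rfl fun j _ => ?_
      by_cases hj : ∀ v, j v = 0 → 3 ≤ deg G.2 (Sum.inr v) + deg G.1 (Sum.inr v)
      · rw [if_pos ⟨hG, hj⟩]
        congr 2
        funext x
        rcases x with i | v
        · rfl
        · simp only [Sum.elim_inr, Pi.zero_apply, add_zero, map_neg, potOfDeg]
          congr 1
          split_ifs with h3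
          · exact PowerSeries.coeff_mk _ _
          · have : j v ≠ 0 := fun h => h3 (hj v h)
            simp [formal, PowerSeries.coeff_C, this]
      -- Here a vertex of degree below three has shifted weight zero. Its function is the constant
      -- coefficient of `pot - lead` up to sign, which is zero, so the contraction vanishes.
      · rw [if_neg fun h => hj h.2]
        push Not at hj
        obtain ⟨v, hv, hd⟩ := hj
        rw [D.Gam_eq_zero _ _ _ (Sum.inr v), smul_zero]
        simp only [Sum.elim_inr, Pi.zero_apply, add_zero, map_neg, potOfDeg, if_neg (not_le.2 hd), hv]
        simp [formal, h0]
    · rw [if_neg hG]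
      exact (sum_eq_zero fun j _ => if_neg fun h => hG h.1).symm
  · simp

theorem coeff_star_eq_sum_graphs (h0 : Φ 0 = D.lead) (f u : A) (k : ℕ) :
    PowerSeries.coeff k (D.star Φ (PowerSeries.C f) (PowerSeries.C u)) =
      ∑ G ∈ (WGraph.finite_totalWeight k).toFinset,
        ((G.numInt.factorial * G.numEdge.factorial : ℂ)⁻¹) •
          D.Gam (Sum.elim ![f, u] fun v => -Φ (G.weight v + 1).toNat) G.tail G.head := by
  rw [coeff_star D h0, ← WGraph.sum_dataOfWeight]
  rfl

end PotentialAlgebra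
end KahlerStar
end

/-! ### Bilinear extension, and calculus on smooth functions. -/

noncomputable section

set_option linter.unusedSectionVars false

namespace KahlerStar

open Finset

section Series

variable {A : Type*} [CommRing A] [Algebra ℂ A]

theorem coeff_succ_X_smul (F : A⟦X⟧) (n : ℕ) :
    PowerSeries.coeff (n + 1) ((PowerSeries.X : ℂ⟦X⟧) • F) = PowerSeries.coeff n F := by
  rw [Algebra.smul_def, PowerSeries.algebraMap_apply'', PowerSeries.map_X,
    PowerSeries.coeff_succ_X_mul]

theorem coeff_zero_X_smul (F : A⟦X⟧) :
    PowerSeries.coeff 0 ((PowerSeries.X : ℂ⟦X⟧) • F) = 0 := by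
  rw [Algebra.smul_def, PowerSeries.algebraMap_apply'', PowerSeries.map_X,
    PowerSeries.coeff_zero_X_mul]

/-- A `ℂ⟦X⟧`-linear map is determined by its values on constant series. -/
theorem coeff_map_eq_sum (T : A⟦X⟧ →ₗ[ℂ⟦X⟧] A⟦X⟧) (N : ℕ) (F : A⟦X⟧) :
    PowerSeries.coeff N (T F) = ∑ p ∈ antidiagonal N,
      PowerSeries.coeff p.2 (T (PowerSeries.C (PowerSeries.coeff p.1 F))) := by
  have h : ∀ F : A⟦X⟧, F = (PowerSeries.X : ℂ⟦X⟧) •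
      (PowerSeries.mk fun p => PowerSeries.coeff (p + 1) F) +
        PowerSeries.C (PowerSeries.coeff 0 F) := fun F => by
    rw [Algebra.smul_def, PowerSeries.algebraMap_apply'', PowerSeries.map_X]
    rw [PowerSeries.coeff_zero_eq_constantCoeff_apply]
    exact PowerSeries.eq_X_mul_shift_add_const F
  induction N generalizing F with
  | zero =>
    conv_lhs => rw [h F, map_add, map_smul, map_add, coeff_zero_X_smul, zero_add]
    simp
  | succ N ih =>
    conv_lhs => rw [h F, map_add, map_smul, map_add, coeff_succ_X_smul, ih]
    rw [Finset.Nat.sum_antidiagonal_succ, add_comm]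
    simp

end Series

namespace PotentialAlgebra

variable {A ι : Type*} [CommRing A] [Algebra ℂ A] [Fintype ι] [DecidableEq ι]
variable (D : PotentialAlgebra ℂ A ι) {Φ : ℕ → A}

/-- Right multiplication as a linear map. -/
def starRight (h0 : Φ 0 = D.lead) (u : A⟦X⟧) : A⟦X⟧ →ₗ[ℂ⟦X⟧] A⟦X⟧ where
  toFun f := D.star Φ f u
  map_add' f g := D.star_add_left Φ f g u
  map_smul' c f := D.star_smul_left h0 c f u

/-- By `ℂ⟦X⟧`-linearity in each argument the product is determined on constants; the rest reorders a
triple sum. -/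
theorem coeff_star_eq_sum (h0 : Φ 0 = D.lead) (F G : A⟦X⟧) (N : ℕ) :
    PowerSeries.coeff N (D.star Φ F G) =
      ∑ a ∈ antidiagonal N, ∑ b ∈ antidiagonal a.2, PowerSeries.coeff a.1
        (D.star Φ (PowerSeries.C (PowerSeries.coeff b.1 F))
          (PowerSeries.C (PowerSeries.coeff b.2 G))) := by
  have h1 := coeff_map_eq_sum (D.starRight h0 G) N F
  have h2 := fun f n => coeff_map_eq_sum (D.leftMul h0 f) n G
  change PowerSeries.coeff N (D.star Φ F G) = ∑ p ∈ antidiagonal N, PowerSeries.coeff p.2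
    (D.leftMul h0 (PowerSeries.C (PowerSeries.coeff p.1 F)) G) at h1
  rw [h1, sum_congr rfl fun p _ => h2 _ _, sum_sigma', sum_sigma']
  refine sum_nbij' (fun x => ⟨(x.2.2, x.1.1 + x.2.1), (x.1.1, x.2.1)⟩)
    (fun x => ⟨(x.2.1, x.2.2 + x.1.1), (x.2.2, x.1.1)⟩) ?_ ?_ ?_ ?_ ?_
  · rintro ⟨⟨a, b⟩, ⟨c, d⟩⟩ h
    simp only [mem_sigma, HasAntidiagonal.mem_antidiagonal] at h ⊢
    obtain ⟨h1, h2⟩ := h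
    exact ⟨by rw [← h1, ← h2]; ring, trivial⟩
  · rintro ⟨⟨a, b⟩, ⟨c, d⟩⟩ h
    simp only [mem_sigma, HasAntidiagonal.mem_antidiagonal] at h ⊢
    obtain ⟨h1, h2⟩ := h
    exact ⟨by rw [← h1, ← h2]; ring, trivial⟩
  · rintro ⟨⟨a, b⟩, ⟨c, d⟩⟩ h
    simp only [mem_sigma, HasAntidiagonal.mem_antidiagonal] at h
    obtain ⟨h1, h2⟩ := h
    subst h2
    rfl
  · rintro ⟨⟨a, b⟩, ⟨c, d⟩⟩ h
    simp only [mem_sigma, HasAntidiagonal.mem_antidiagonal] at h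
    obtain ⟨h1, h2⟩ := h
    subst h2
    rfl
  · rintro ⟨⟨a, b⟩, ⟨c, d⟩⟩ _
    rfl

end PotentialAlgebra

/-! ### Derivations of the algebra of smooth functions -/

variable {m : ℕ} {M : Type*} [TopologicalSpace M] [ChartedSpace (Coord m) M]
variable {z : OpenPartialHomeomorph M (Coord m)}

/-- The evaluation of real linear forms on a complexified tangent vector. -/
def extendOneL (X : CTangent m) : (Coord m →L[ℝ] ℂ) →L[ℝ] ℂ :=
  ContinuousLinearMap.apply ℝ ℂ X.1 + Complex.I • ContinuousLinearMap.apply ℝ ℂ X.2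

theorem extendOneL_apply (X : CTangent m) (L : Coord m →L[ℝ] ℂ) : extendOneL X L = extendOne L X := by
  simp [extendOneL, extendOne]

theorem extendOne_smul (c : ℂ) (L : Coord m →L[ℝ] ℂ) (X : CTangent m) :
    extendOne (c • L) X = c * extendOne L X := by
  simp only [extendOne, smul_apply, smul_eq_mul]
  ring

theorem extendOne_add (L L' : Coord m →L[ℝ] ℂ) (X : CTangent m) :
    extendOne (L + L') X = extendOne L X + extendOne L' X := by
  simp only [extendOne, add_apply]
  ring

theorem contDiffAt_coordRep (f : SmoothFn z) {y : Coord m} (hy : y ∈ z.target) :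
    ContDiffAt ℝ ∞ (coordRep z f) y :=
  ContDiffOn.contDiffAt (s := z.target) f.2 (z.open_target.mem_nhds hy)

theorem differentiableAt_coordRep (f : SmoothFn z) {y : Coord m} (hy : y ∈ z.target) :
    DifferentiableAt ℝ (coordRep z f) y :=
  (contDiffAt_coordRep f hy).differentiableAt (by simp)

theorem coordRep_apply (f : z.source → ℂ) (x : z.source) : coordRep z f (z x) = f x := by
  rw [coordRep_of_mem f (z.map_source x.2)]
  congr 1
  exact Subtype.ext (z.left_inv x.2)

theorem SmoothFn.ext_target {f g : SmoothFn z}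
    (h : ∀ y ∈ z.target, coordRep z f y = coordRep z g y) : f = g := by
  refine Subtype.ext (funext fun x => ?_)
  have := h _ (z.map_source x.2)
  rwa [coordRep_apply, coordRep_apply] at this

/-- The smooth function on `U` with a given coordinate expression. -/
def ofCoord (F : Coord m → ℂ) (hF : ContDiffOn ℝ ∞ F z.target) : SmoothFn z :=
  ⟨fun x => F (z x), hF.congr fun y hy => by rw [coordRep_of_mem _ hy, z.right_inv hy]⟩

theorem coordRep_ofCoord {F : Coord m → ℂ} (hF : ContDiffOn ℝ ∞ F z.target) {y : Coord m}
    (hy : y ∈ z.target) : coordRep z (ofCoord F hF) y = F y := by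
  rw [coordRep_of_mem _ hy]
  exact congrArg F (z.right_inv hy)

theorem contDiffOn_extendOne_fderiv (X : CTangent m) (f : SmoothFn z) :
    ContDiffOn ℝ ∞ (fun y => extendOne (fderiv ℝ (coordRep z f) y) X) z.target := by
  simp only [← extendOneL_apply]
  exact (extendOneL X).contDiff.comp_contDiffOn (f.2.fderiv_of_isOpen z.open_target (by simp))

/-- The derivative along a complexified constant vector field. -/
def dirDeriv (X : CTangent m) : Derivation ℂ (SmoothFn z) (SmoothFn z) :=
  Derivation.mk'
    { toFun := fun f => ofCoord _ (contDiffOn_extendOne_fderiv X f)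
      map_add' := fun f g => SmoothFn.ext_target fun y hy => by
        have h : coordRep z (f + g : SmoothFn z) =ᶠ[nhds y] coordRep z f + coordRep z g :=
          Filter.eventually_of_mem (z.open_target.mem_nhds hy) fun x hx => by
            simp [coordRep_of_mem _ hx]
        have h2 : coordRep z (ofCoord _ (contDiffOn_extendOne_fderiv X f) +
            ofCoord _ (contDiffOn_extendOne_fderiv X g) : SmoothFn z) y =
            coordRep z (ofCoord _ (contDiffOn_extendOne_fderiv X f)) y +
            coordRep z (ofCoord _ (contDiffOn_extendOne_fderiv X g)) y := by
          simp [coordRep_of_mem _ hy]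
        rw [h2]
        simp only [coordRep_ofCoord _ hy]
        rw [h.fderiv_eq, fderiv_add (differentiableAt_coordRep f hy) (differentiableAt_coordRep g hy), extendOne_add]
      map_smul' := fun c f => SmoothFn.ext_target fun y hy => by
        have h : coordRep z (c • f : SmoothFn z) =ᶠ[nhds y] c • coordRep z f :=
          Filter.eventually_of_mem (z.open_target.mem_nhds hy) fun x hx => by
            simp [coordRep_of_mem _ hx]
        have h2 : coordRep z (c • ofCoord _ (contDiffOn_extendOne_fderiv X f) : SmoothFn z) y =
            c * coordRep z (ofCoord _ (contDiffOn_extendOne_fderiv X f)) y := by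
          simp [coordRep_of_mem _ hy]
        rw [RingHom.id_apply, h2]
        simp only [coordRep_ofCoord _ hy]
        rw [h.fderiv_eq, fderiv_const_smul (differentiableAt_coordRep f hy), extendOne_smul] }
    fun f g => SmoothFn.ext_target fun y hy => by
      have h : coordRep z (f * g : SmoothFn z) =ᶠ[nhds y] coordRep z f * coordRep z g :=
        Filter.eventually_of_mem (z.open_target.mem_nhds hy) fun x hx => by
          simp [coordRep_of_mem _ hx]
      have h2 : coordRep z (f • ofCoord _ (contDiffOn_extendOne_fderiv X g) +
          g • ofCoord _ (contDiffOn_extendOne_fderiv X f) : SmoothFn z) y =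
          coordRep z f y * coordRep z (ofCoord _ (contDiffOn_extendOne_fderiv X g)) y +
          coordRep z g y * coordRep z (ofCoord _ (contDiffOn_extendOne_fderiv X f)) y := by
        simp [coordRep_of_mem _ hy]
      change coordRep z (ofCoord _ (contDiffOn_extendOne_fderiv X (f * g))) y = coordRep z
        (f • ofCoord _ (contDiffOn_extendOne_fderiv X g) +
          g • ofCoord _ (contDiffOn_extendOne_fderiv X f) : SmoothFn z) y
      rw [h2]
      simp only [coordRep_ofCoord _ hy]
      rw [h.fderiv_eq, fderiv_mul (differentiableAt_coordRep f hy) (differentiableAt_coordRep g hy), extendOne_add,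
        extendOne_smul, extendOne_smul]

theorem coordRep_dirDeriv (X : CTangent m) (f : SmoothFn z) {y : Coord m} (hy : y ∈ z.target) :
    coordRep z (dirDeriv X f) y = extendOne (fderiv ℝ (coordRep z f) y) X :=
  coordRep_ofCoord (contDiffOn_extendOne_fderiv X f) hy

theorem coordRep_dirDeriv_eventuallyEq (X : CTangent m) (f : SmoothFn z) {y : Coord m}
    (hy : y ∈ z.target) : coordRep z (dirDeriv X f) =ᶠ[nhds y]
      fun y => extendOne (fderiv ℝ (coordRep z f) y) X :=
  Filter.eventually_of_mem (z.open_target.mem_nhds hy) fun _ hx => coordRep_dirDeriv X f hx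

theorem dirDeriv_comm (X Y : CTangent m) (f : SmoothFn z) :
    dirDeriv X (dirDeriv Y f) = dirDeriv Y (dirDeriv X f) := by
  refine SmoothFn.ext_target fun y hy => ?_
  have hs : IsSymmSndFDerivAt ℝ (coordRep z f) y :=
    (contDiffAt_coordRep f hy).isSymmSndFDerivAt (by rw [minSmoothness_of_isRCLikeNormedField]; exact ENat.LEInfty.out)
  have hd : DifferentiableAt ℝ (fderiv ℝ (coordRep z f)) y :=
    ((contDiffAt_coordRep f hy).fderiv_right (m := 1)
      (by rw [one_add_one_eq_two]; exact ENat.LEInfty.out)).differentiableAt (by simp)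
  have h : ∀ Z : CTangent m, fderiv ℝ (coordRep z (dirDeriv Z f)) y =
      (extendOneL Z).comp (fderiv ℝ (fderiv ℝ (coordRep z f)) y) := fun Z => by
    rw [(coordRep_dirDeriv_eventuallyEq Z f hy).fderiv_eq]
    simp only [← extendOneL_apply]
    exact ((extendOneL Z).hasFDerivAt.comp y hd.hasFDerivAt).fderiv
  rw [coordRep_dirDeriv _ _ hy, coordRep_dirDeriv _ _ hy, h, h]
  simp only [extendOne, ContinuousLinearMap.comp_apply, extendOneL_apply]
  rw [hs X.1 Y.1, hs X.1 Y.2, hs X.2 Y.1, hs X.2 Y.2]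
  ring

/-- The derivations `∂/∂zᵖ` and `∂/∂z̄ᵖ`. -/
def del : Fin m ⊕ Fin m → Derivation ℂ (SmoothFn z) (SmoothFn z) :=
  Sum.elim (fun p => dirDeriv (delZ p)) fun q => dirDeriv (delZbar q)

theorem del_comm (i j : Fin m ⊕ Fin m) (f : SmoothFn z) : del i (del j f) = del j (del i f) := by
  rcases i with i | i <;> rcases j with j | j <;> exact dirDeriv_comm _ _ _

/-- Equality on the open target suffices for derivatives, so the extension by zero in `coordRep` has
no effect. -/
theorem dz_eq {F : Coord m → ℂ} {f : SmoothFn z} (h : Set.EqOn F (coordRep z f) z.target) (p : Fin m) :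
    Set.EqOn (dz p F) (coordRep z (del (Sum.inl p) f)) z.target := fun y hy => by
  rw [dz, Filter.EventuallyEq.fderiv_eq (Filter.eventually_of_mem (z.open_target.mem_nhds hy) h)]
  exact (coordRep_dirDeriv _ _ hy).symm

theorem dzbar_eq {F : Coord m → ℂ} {f : SmoothFn z} (h : Set.EqOn F (coordRep z f) z.target)
    (p : Fin m) : Set.EqOn (dzbar p F) (coordRep z (del (Sum.inr p) f)) z.target := fun y hy => by
  rw [dzbar, Filter.EventuallyEq.fderiv_eq (Filter.eventually_of_mem (z.open_target.mem_nhds hy) h)]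
  exact (coordRep_dirDeriv _ _ hy).symm

/-- Evaluation at a point. -/
def evalAt (x : z.source) : SmoothFn z →ₐ[ℂ] ℂ :=
  (Pi.evalAlgHom ℂ (fun _ : z.source => ℂ) x).comp (SmoothFn z).val

theorem evalAt_apply (x : z.source) (f : SmoothFn z) : evalAt x f = f.1 x := rfl

theorem eq_zero_of_evalAt (f : SmoothFn z) (h : ∀ x, evalAt x f = 0) : f = 0 :=
  Subtype.ext (funext h)

end KahlerStar
end

/-! ### The Hessian of the potential, the metric, and partition functions. -/

noncomputable section

set_option linter.unusedSectionVars false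

namespace KahlerStar

open Finset

section Inverse

/-- Differentiate `H⁻¹ * H = 1` and multiply by `H⁻¹` on the right. -/
theorem derivation_inv_matrix {𝕜 R n : Type*} [CommRing 𝕜] [CommRing R] [Algebra 𝕜 R] [Fintype n]
    [DecidableEq n] (δ : Derivation 𝕜 R R) (H : Matrix n n R) (hH : IsUnit H.det) (q p : n) :
    δ (H⁻¹ q p) = -∑ r, ∑ s, H⁻¹ q r * δ (H r s) * H⁻¹ s p := by
  have h1 : H⁻¹.map δ * H = -(H⁻¹ * H.map δ) := by
    ext i j
    have h := congrArg (fun A : Matrix n n R => δ (A i j)) (H.nonsing_inv_mul hH)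
    simp only [Matrix.mul_apply, map_sum, Derivation.leibniz, smul_eq_mul, sum_add_distrib,
      Matrix.one_apply] at h
    rw [apply_ite δ, δ.map_one_eq_zero, map_zero, ite_self] at h
    simp only [Matrix.mul_apply, Matrix.map_apply, Matrix.neg_apply]
    rw [eq_neg_iff_add_eq_zero, ← h, add_comm]
    simp only [mul_comm]
  have h2 : H⁻¹.map δ = -(H⁻¹ * H.map δ * H⁻¹) := by
    rw [← Matrix.neg_mul, ← h1, Matrix.mul_assoc, H.mul_nonsing_inv hH, Matrix.mul_one]
  have h3 := congrFun (congrFun h2 q) p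
  simp only [Matrix.map_apply, Matrix.neg_apply, Matrix.mul_apply, sum_mul] at h3
  rw [h3, sum_comm]

end Inverse

section Form

variable {m : ℕ}

/-- The value of `dzᵖ`. -/
def holPart (X : CTangent m) (p : Fin m) : ℂ := X.1 p + Complex.I * X.2 p

/-- The value of `dz̄ᵖ`. -/
def antiPart (X : CTangent m) (p : Fin m) : ℂ := star (X.1 p) + Complex.I * star (X.2 p)

theorem holPart_delZ (p r : Fin m) : holPart (delZ p) r = if r = p then 1 else 0 := by
  simp only [holPart, delZ, Pi.neg_apply, Pi.single_apply]
  split_ifs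
  · linear_combination (-1 / 2 : ℂ) * Complex.I_mul_I
  · simp

theorem antiPart_delZ (p r : Fin m) : antiPart (delZ p) r = 0 := by
  simp only [antiPart, delZ, Pi.neg_apply, Pi.single_apply]
  split_ifs
  · simp
    linear_combination (1 / 2 : ℂ) * Complex.I_mul_I
  · simp

theorem holPart_delZbar (p r : Fin m) : holPart (delZbar p) r = 0 := by
  simp only [holPart, delZbar, Pi.single_apply]
  split_ifs
  · linear_combination (1 / 2 : ℂ) * Complex.I_mul_I
  · simp

theorem antiPart_delZbar (p r : Fin m) : antiPart (delZbar p) r = if r = p then 1 else 0 := by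
  simp only [antiPart, delZbar, Pi.single_apply]
  split_ifs
  · simp
    linear_combination (-1 / 2 : ℂ) * Complex.I_mul_I
  · simp

theorem holPart_complexStructure (X : CTangent m) (r : Fin m) :
    holPart (complexStructure X) r = Complex.I * holPart X r := by
  simp only [holPart, complexStructure, Pi.smul_apply, smul_eq_mul]
  ring

theorem antiPart_complexStructure (X : CTangent m) (r : Fin m) :
    antiPart (complexStructure X) r = -Complex.I * antiPart X r := by
  simp only [antiPart, complexStructure, Pi.smul_apply, smul_eq_mul, star_mul']
  simp
  ring

variable {η : Coord m [⋀^Fin 2]→L[ℝ] ℂ} {H : Matrix (Fin m) (Fin m) ℂ}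

theorem extendTwo_eq (hη : ∀ u v : Coord m, η ![u, v] =
      Complex.I * ∑ p, ∑ q, H p q * (u p * star (v q) - v p * star (u q))) (X Y : CTangent m) :
    extendTwo η X Y = Complex.I * ∑ p, ∑ q, H p q *
      (holPart X p * antiPart Y q - holPart Y p * antiPart X q) := by
  simp only [extendTwo, hη]
  rw [← mul_sub, ← mul_add]
  congr 1
  simp only [← sum_sub_distrib, ← sum_add_distrib, mul_sum]
  refine sum_congr rfl fun p _ => sum_congr rfl fun q _ => ?_
  simp only [holPart, antiPart]
  linear_combination (-H p q * (X.2 p * star (Y.2 q) - Y.2 p * star (X.2 q))) * Complex.I_mul_I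

/-- `J` acts on `∂/∂z̄^q` by `-√-1`, which cancels the factor `√-1` in the form: the metric is the
Hessian of the leading potential. -/
theorem metricMatrix_eq (hη : ∀ u v : Coord m, η ![u, v] =
      Complex.I * ∑ p, ∑ q, H p q * (u p * star (v q) - v p * star (u q))) : metricMatrix η = H := by
  ext p q
  rw [metricMatrix, Matrix.of_apply, extendTwo_eq hη]
  simp only [holPart_delZ, antiPart_delZ, holPart_complexStructure, holPart_delZbar,
    antiPart_complexStructure, antiPart_delZbar, mul_zero, sub_zero, mul_ite, ite_mul, mul_one, zero_mul,
    one_mul, sum_ite_eq', mem_univ, if_true]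
  linear_combination (-H p q) * Complex.I_mul_I

/-- A vector `v` with `vH = 0` would give `η(v, Jv) = 2 ∑ v̄_q (vH)_q = 0`. -/
theorem det_ne_zero_of_positive (hη : ∀ u v : Coord m, η ![u, v] =
      Complex.I * ∑ p, ∑ q, H p q * (u p * star (v q) - v p * star (u q)))
    (hpos : ∀ u : Coord m, u ≠ 0 → 0 < (η ![u, Complex.I • u]).re) : H.det ≠ 0 := by
  intro hdet
  obtain ⟨v, hv, hvH⟩ := Matrix.exists_vecMul_eq_zero_iff.2 hdet
  have h1 := hpos v hv
  have h2 : η ![v, Complex.I • v] = 2 * ∑ q, star (v q) * (Matrix.vecMul v H) q := by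
    rw [hη, mul_sum, mul_sum]
    simp only [Matrix.vecMul, dotProduct, mul_sum]
    rw [sum_comm]
    refine sum_congr rfl fun q _ => sum_congr rfl fun p _ => ?_
    simp only [Pi.smul_apply, smul_eq_mul, star_mul', Complex.star_def, Complex.conj_I]
    linear_combination (-2 * H p q * v p * (starRingEnd ℂ) (v q)) * Complex.I_mul_I
  rw [h2, hvH] at h1
  simp at h1

end Form

variable {m : ℕ} {M : Type*} [TopologicalSpace M] [ChartedSpace (Coord m) M]
variable {z : OpenPartialHomeomorph M (Coord m)}

theorem isUnit_of_evalAt_ne_zero (f : SmoothFn z) (hf : ∀ x, evalAt x f ≠ 0) : IsUnit f := by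
  have h : ∀ y ∈ z.target, coordRep z f y ≠ 0 := fun y hy => by
    rw [coordRep_of_mem _ hy]
    exact hf _
  refine IsUnit.of_mul_eq_one (ofCoord _ (ContDiffOn.inv f.2 h)) (SmoothFn.ext_target fun y hy => ?_)
  have h1 : coordRep z (f * ofCoord _ (ContDiffOn.inv f.2 h) : SmoothFn z) y =
      coordRep z f y * coordRep z (ofCoord _ (ContDiffOn.inv f.2 h)) y := by
    simp [coordRep_of_mem _ hy]
  have h2 : coordRep z (1 : SmoothFn z) y = 1 := by simp [coordRep_of_mem _ hy]
  rw [h1, h2, coordRep_ofCoord _ hy]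
  exact mul_inv_cancel₀ (h y hy)

/-- The matrix `∂²P/∂zᵖ∂z̄^q`. -/
def hessian (P : SmoothFn z) : Matrix (Fin m) (Fin m) (SmoothFn z) :=
  Matrix.of fun p q => del (Sum.inl p) (del (Sum.inr q) P)

/-- The algebra of smooth functions with a non-degenerate potential. -/
def smoothAlgebra (P : SmoothFn z) (hP : IsUnit (hessian P).det) :
    PotentialAlgebra ℂ (SmoothFn z) (Fin m) where
  d := del
  comm := del_comm
  pot := P
  lead := P
  g q p := (hessian P)⁻¹ q p
  g_contract q l := by
    have h := congrFun (congrFun ((hessian P).nonsing_inv_mul hP) q) l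
    rwa [Matrix.mul_apply, Matrix.one_apply] at h
  d_g l q p := by
    rw [derivation_inv_matrix _ _ hP]
    congr 1
    refine sum_congr rfl fun r _ => sum_congr rfl fun s _ => ?_
    rw [hessian, Matrix.of_apply, del_comm (Sum.inr l), del_comm (Sum.inr l)]

variable {Ω : ℕ → TwoForm m M} {Φ : ℕ → SmoothFn z}

/-- The Hessian at a point. -/
def hessianAt (P : SmoothFn z) (x : z.source) : Matrix (Fin m) (Fin m) ℂ :=
  (evalAt x).toRingHom.mapMatrix (hessian P)

theorem IsFormalPotential.inChart_apply (hΦ : IsFormalPotential Ω Φ) (x : z.source) (u v : Coord m) :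
    inChart z (Ω 0) (z x) ![u, v] = Complex.I * ∑ p, ∑ q, hessianAt (Φ 0) x p q *
      (u p * star (v q) - v p * star (u q)) := by
  rw [hΦ 0 _ (z.map_source x.2)]
  congr 1
  refine sum_congr rfl fun p _ => sum_congr rfl fun q _ => ?_
  congr 1
  rw [dz_eq (dzbar_eq (f := Φ 0) (fun _ _ => rfl) q) p (z.map_source x.2), coordRep_apply]
  rfl

theorem isUnit_det_hessian (hΩ : IsKahlerForm (Ω 0)) (hz : IsHolomorphicChart z)
    (hΦ : IsFormalPotential Ω Φ) : IsUnit (hessian (Φ 0)).det := by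
  refine isUnit_of_evalAt_ne_zero _ fun x => ?_
  have h := det_ne_zero_of_positive (hΦ.inChart_apply x) (hΩ.positive z hz _ (z.map_source x.2))
  rw [hessianAt, ← RingHom.map_det] at h
  exact h

theorem metricMatrix_inv_apply (hΦ : IsFormalPotential Ω Φ) (hP : IsUnit (hessian (Φ 0)).det)
    (x : z.source) (q p : Fin m) : (metricMatrix (inChart z (Ω 0) (z x)))⁻¹ q p =
      evalAt x ((smoothAlgebra (Φ 0) hP).g q p) := by
  rw [metricMatrix_eq (hΦ.inChart_apply x)]
  have h : (evalAt x).toRingHom.mapMatrix (hessian (Φ 0))⁻¹ * hessianAt (Φ 0) x = 1 := by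
    rw [hessianAt, ← map_mul, (hessian (Φ 0)).nonsing_inv_mul hP, map_one]
  rw [Matrix.inv_eq_left_inv h]
  rfl

/-! ### Partition functions -/

theorem sum_ite_singleton {α : Type*} {n : ℕ} (P : Fin n → Prop) [DecidablePred P] (c : Fin n → α) :
    ∑ e, (if P e then ({c e} : Multiset α) else 0) = (((List.finRange n).filter P).map c : List α) := by
  rw [Fin.sum_univ_def]
  induction List.finRange n with
  | nil => rfl
  | cons e l ih =>
    rw [List.map_cons, List.sum_cons, ih]
    by_cases h : P e <;> simp [h]

theorem iterDeriv_eq (D : PotentialAlgebra ℂ (SmoothFn z) (Fin m)) (hD : D.d = del) (a b : List (Fin m))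
    {F : Coord m → ℂ} {f : SmoothFn z} (h : Set.EqOn F (coordRep z f) z.target) :
    Set.EqOn (iterDeriv a b F) (coordRep z (D.iter ((b.map Sum.inr : List (Fin m ⊕ Fin m)) +
      (a.map Sum.inl : List (Fin m ⊕ Fin m)) : Multiset (Fin m ⊕ Fin m)) f)) z.target := by
  rw [add_comm, D.iter_add]
  have h1 : Set.EqOn (b.foldr dzbar F)
      (coordRep z (D.iter (b.map Sum.inr : List (Fin m ⊕ Fin m)) f)) z.target := by
    induction b with
    | nil => exact h
    | cons q b ih =>
      rw [List.foldr_cons, List.map_cons, ← Multiset.cons_coe, D.iter_cons, hD]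
      exact dzbar_eq ih q
  rw [iterDeriv]
  induction a with
  | nil => exact h1
  | cons p a ih =>
    rw [List.foldr_cons, List.map_cons, ← Multiset.cons_coe, D.iter_cons, hD]
    exact dz_eq ih p

/-- Identifies the coordinate contraction with `Gam`. The lists of derivatives become multisets
because the derivations commute on `C^∞(U)`. -/
theorem partitionFunction_eq (hΦ : IsFormalPotential Ω Φ) (hP : IsUnit (hessian (Φ 0)).det) {n : ℕ}
    (G : WGraph n) (f : Fin n → SmoothFn z) (x : z.source) :
    G.partitionFunction (fun y => metricMatrix (inChart z (Ω 0) y)) (fun j => coordRep z (Φ j))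
      (fun i => coordRep z (f i)) (z x) =
    evalAt x ((smoothAlgebra (Φ 0) hP).Gam
      (Sum.elim f fun v => -Φ (G.weight v + 1).toNat) G.tail G.head) := by
  have hy := z.map_source x.2
  rw [WGraph.partitionFunction, PotentialAlgebra.Gam, map_sum, sum_comm, ← Fintype.sum_prod_type']
  refine Fintype.sum_equiv (Equiv.arrowProdEquivProdArrow _ _ _).symm _ _ fun k => ?_
  rw [map_mul, PotentialAlgebra.vprod, map_prod, map_prod]
  congr 1
  · refine prod_congr rfl fun v _ => ?_
    have hF : Set.EqOn (G.vertexFun (fun j => coordRep z (Φ j)) (fun i => coordRep z (f i)) v)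
        (coordRep z ((Sum.elim f fun v => -Φ (G.weight v + 1).toNat) v)) z.target := by
      rcases v with i | v
      · exact fun _ _ => rfl
      · intro y hy
        simp [WGraph.vertexFun, coordRep_of_mem _ hy]
    rw [WGraph.vertexFactor, iterDeriv_eq (smoothAlgebra (Φ 0) hP) rfl _ _ hF hy, coordRep_apply,
      evalAt_apply, PotentialAlgebra.lab, sum_add_distrib, sum_ite_singleton, sum_ite_singleton,
      List.map_map, List.map_map]
    rfl
  · exact prod_congr rfl fun e _ => metricMatrix_inv_apply hΦ hP x _ _

theorem graphOperator_eq (hΦ : IsFormalPotential Ω Φ) (hP : IsUnit (hessian (Φ 0)).det) (k : ℕ)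
    (f u : SmoothFn z) (x : z.source) : graphOperator Ω Φ k ![f, u] x =
      (PowerSeries.coeff k ((smoothAlgebra (Φ 0) hP).star Φ (PowerSeries.C f) (PowerSeries.C u))).1 x := by
  rw [graphOperator, finsum_graphClass k (fun G => G.partitionFunction
    (fun y => metricMatrix (inChart z (Ω 0) y)) (fun j => coordRep z (Φ j))
      (fun i => coordRep z (![f, u] i)) (z x)),
    PotentialAlgebra.coeff_star_eq_sum_graphs (smoothAlgebra (Φ 0) hP) rfl, ← evalAt_apply, map_sum]
  · refine sum_congr rfl fun G _ => ?_
    rw [partitionFunction_eq hΦ hP, map_smul, smul_eq_mul]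
  · rintro G G' ⟨φ⟩
    rw [partitionFunction_eq hΦ hP, partitionFunction_eq hΦ hP]
    congr 1
    refine PotentialAlgebra.Gam_reindex _ (Equiv.sumCongr (Equiv.refl _) φ.onInt) φ.onEdge _ _ _ _ _ _
      (fun v => ?_) (fun e => φ.tail_onEdge e) fun e => φ.head_onEdge e
    rcases v with i | v
    · rfl
    · simp [φ.weight_onInt]

end KahlerStar
end

/-! ### The Poisson bracket, separation of variables, and the conclusion. -/

noncomputable section

set_option linter.unusedSectionVars false

namespace KahlerStar

open Finset

section Form

variable {m : ℕ}

theorem apply_single (L : Coord m →L[ℝ] ℂ) (p : Fin m) (c : ℂ) : L (Pi.single p c) =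
    extendOne L (delZ p) * c + extendOne L (delZbar p) * star c := by
  have h : (Pi.single p c : Coord m) = (2 * c.re) • (Pi.single p (1 / 2 : ℂ) : Coord m) +
      (2 * c.im) • (Pi.single p (Complex.I / 2) : Coord m) := by
    rw [← Pi.single_smul, ← Pi.single_smul, ← Pi.single_add]
    congr 1
    conv_lhs => rw [← Complex.re_add_im c]
    simp only [Complex.real_smul, Complex.ofReal_mul, Complex.ofReal_ofNat]
    ring
  have h1 : star c = c.re - c.im * Complex.I := by
    apply Complex.ext <;> simp
  rw [h1, h, map_add, map_smul, map_smul]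
  simp only [extendOne, delZ, delZbar, map_neg, Complex.real_smul, Complex.ofReal_mul,
    Complex.ofReal_ofNat]
  have h2 : c = c.re + c.im * Complex.I := (Complex.re_add_im c).symm
  generalize L (Pi.single p (1 / 2 : ℂ)) = a
  generalize L (Pi.single p (Complex.I / 2)) = b
  generalize c.re = r at *
  generalize c.im = s at *
  rw [h2]
  linear_combination (-2 * b * s * (-1 : ℂ)) * Complex.I_mul_I

theorem extendOne_eq (L : Coord m →L[ℝ] ℂ) (X : CTangent m) : extendOne L X =
    ∑ p, extendOne L (delZ p) * holPart X p + ∑ p, extendOne L (delZbar p) * antiPart X p := by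
  have h : ∀ u : Coord m, L u =
      ∑ p, (extendOne L (delZ p) * u p + extendOne L (delZbar p) * star (u p)) := fun u => by
    conv_lhs => rw [← Finset.univ_sum_single u, map_sum]
    exact sum_congr rfl fun p _ => apply_single L p (u p)
  rw [← sum_add_distrib]
  conv_lhs => rw [extendOne, h, h, mul_sum, ← sum_add_distrib]
  refine sum_congr rfl fun p _ => ?_
  rw [holPart, antiPart]
  ring

/-- The complexified tangent space is the sum of its `(1,0)` and `(0,1)` parts, so the values of
`dz` and `dz̄` can be prescribed independently. -/
theorem exists_holPart_antiPart (a b : Fin m → ℂ) :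
    ∃ X : CTangent m, holPart X = a ∧ antiPart X = b := by
  refine ⟨(fun p => (a p + star (b p)) / 2, fun p => (a p - star (b p)) / 2 * -Complex.I), ?_, ?_⟩
  · funext p
    simp only [holPart]
    linear_combination (-(a p - star (b p)) / 2) * Complex.I_mul_I
  · funext p
    simp only [antiPart, Complex.star_def, map_mul, map_div₀, map_add, map_sub, map_neg,
      Complex.conj_I, Complex.conj_conj, map_ofNat]
    linear_combination (((starRingEnd ℂ) (a p) - b p) / 2) * Complex.I_mul_I

variable {η : Coord m [⋀^Fin 2]→L[ℝ] ℂ} {H : Matrix (Fin m) (Fin m) ℂ}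

theorem extendTwo_swap (hη : ∀ u v : Coord m, η ![u, v] =
      Complex.I * ∑ p, ∑ q, H p q * (u p * star (v q) - v p * star (u q))) (X Y : CTangent m) :
    extendTwo η X Y = -extendTwo η Y X := by
  rw [extendTwo_eq hη, extendTwo_eq hη, ← mul_neg, ← sum_neg_distrib]
  congr 1
  refine sum_congr rfl fun p _ => ?_
  rw [← sum_neg_distrib]
  exact sum_congr rfl fun q _ => by ring

/-- The Hamiltonian vector in terms of the inverse matrix. -/
theorem exists_hamiltonian (hη : ∀ u v : Coord m, η ![u, v] =
      Complex.I * ∑ p, ∑ q, H p q * (u p * star (v q) - v p * star (u q))) (hH : IsUnit H.det)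
    (L : Coord m →L[ℝ] ℂ) : ∃ X : CTangent m,
      (∀ p, holPart X p = -Complex.I * ∑ q, H⁻¹ q p * extendOne L (delZbar q)) ∧
      (∀ q, antiPart X q = Complex.I * ∑ p, H⁻¹ q p * extendOne L (delZ p)) ∧
      ∀ Y, extendTwo η X Y = extendOne L Y := by
  obtain ⟨X, ha, hb⟩ := exists_holPart_antiPart
    (fun p => -Complex.I * ∑ q, H⁻¹ q p * extendOne L (delZbar q))
    (fun q => Complex.I * ∑ p, H⁻¹ q p * extendOne L (delZ p))
  refine ⟨X, fun p => congrFun ha p, fun q => congrFun hb q, fun Y => ?_⟩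
  have h1 : ∀ q, ∑ p, H p q * ∑ r, H⁻¹ r p * extendOne L (delZbar r) = extendOne L (delZbar q) := by
    intro q
    have h : Matrix.vecMul (Matrix.vecMul (fun r => extendOne L (delZbar r)) H⁻¹) H q =
        extendOne L (delZbar q) := by
      rw [Matrix.vecMul_vecMul, H.nonsing_inv_mul hH, Matrix.vecMul_one]
    rw [← h]
    simp only [Matrix.vecMul, dotProduct]
    refine sum_congr rfl fun p _ => ?_
    rw [mul_comm]
    congr 1
    exact sum_congr rfl fun r _ => mul_comm _ _
  have h2 : ∀ p, ∑ q, H p q * ∑ r, H⁻¹ q r * extendOne L (delZ r) = extendOne L (delZ p) := by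
    intro p
    have h : Matrix.mulVec H (Matrix.mulVec H⁻¹ fun r => extendOne L (delZ r)) p =
        extendOne L (delZ p) := by
      rw [Matrix.mulVec_mulVec, H.mul_nonsing_inv hH, Matrix.one_mulVec]
    exact h
  have h3 : ∑ p, extendOne L (delZ p) * holPart Y p =
      ∑ p, (∑ q, H p q * ∑ r, H⁻¹ q r * extendOne L (delZ r)) * holPart Y p :=
    sum_congr rfl fun p _ => by rw [h2]
  have h4 : ∑ q, extendOne L (delZbar q) * antiPart Y q =
      ∑ q, (∑ p, H p q * ∑ r, H⁻¹ r p * extendOne L (delZbar r)) * antiPart Y q :=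
    sum_congr rfl fun q _ => by rw [h1]
  rw [extendTwo_eq hη, extendOne_eq, ha, hb, h3, h4]
  simp only [mul_sub, sum_sub_distrib]
  rw [sub_eq_add_neg, add_comm]
  congr 1
  · rw [mul_sum, ← sum_neg_distrib]
    refine sum_congr rfl fun p _ => ?_
    rw [mul_sum, sum_mul, ← sum_neg_distrib]
    refine sum_congr rfl fun q _ => ?_
    linear_combination (-H p q * holPart Y p * ∑ r, H⁻¹ q r * extendOne L (delZ r)) * Complex.I_mul_I
  · rw [sum_comm, mul_sum]
    refine sum_congr rfl fun q _ => ?_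
    rw [mul_sum, sum_mul]
    refine sum_congr rfl fun p _ => ?_
    linear_combination (-H p q * antiPart Y q * ∑ r, H⁻¹ r p * extendOne L (delZbar r)) *
      Complex.I_mul_I

/-- The chosen Hamiltonian vectors enter only through their defining equation: exchanging arguments
twice replaces the second one by the explicit solution of `exists_hamiltonian`, so uniqueness is not
needed. -/
theorem extendTwo_hamiltonianVector (hη : ∀ u v : Coord m, η ![u, v] =
      Complex.I * ∑ p, ∑ q, H p q * (u p * star (v q) - v p * star (u q))) (hH : IsUnit H.det)
    (L₁ L₂ : Coord m →L[ℝ] ℂ) :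
    extendTwo η (hamiltonianVector η L₁) (hamiltonianVector η L₂) = Complex.I *
      (∑ q, ∑ p, H⁻¹ q p * (extendOne L₁ (delZbar q) * extendOne L₂ (delZ p)) -
        ∑ q, ∑ p, H⁻¹ q p * (extendOne L₂ (delZbar q) * extendOne L₁ (delZ p))) := by
  have hspec : ∀ L Y, extendTwo η (hamiltonianVector η L) Y = extendOne L Y := fun L => by
    obtain ⟨X, -, -, hX⟩ := exists_hamiltonian hη hH L
    exact Classical.epsilon_spec (p := fun X => ∀ Y, extendTwo η X Y = extendOne L Y) ⟨X, hX⟩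
  obtain ⟨X, ha, hb, hX⟩ := exists_hamiltonian hη hH L₂
  rw [extendTwo_swap hη, hspec, ← hX, ← extendTwo_swap hη, hspec, extendOne_eq]
  simp only [ha, hb]
  rw [mul_sub, sub_eq_add_neg, add_comm]
  congr 1
  · rw [mul_sum]
    refine sum_congr rfl fun q _ => ?_
    rw [mul_left_comm, mul_sum]
    congr 1
    exact sum_congr rfl fun p _ => by ring
  · rw [← mul_neg, sum_comm, ← sum_neg_distrib, mul_sum]
    refine sum_congr rfl fun p _ => ?_
    rw [mul_left_comm, neg_mul, ← mul_neg, mul_sum]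
    congr 2
    exact sum_congr rfl fun q _ => by ring

end Form

variable {m : ℕ} {M : Type*} [TopologicalSpace M] [ChartedSpace (Coord m) M]
variable {z : OpenPartialHomeomorph M (Coord m)}

theorem single_I_div_two (p : Fin m) :
    (Pi.single p (Complex.I / 2) : Coord m) = Complex.I • Pi.single p (1 / 2 : ℂ) := by
  rw [← Pi.single_smul, smul_eq_mul, mul_one_div]

/-- The Cauchy–Riemann equations: for a complex linear differential the two halves of `∂/∂z̄^q`
cancel. -/
theorem IsHolomorphicFn.del_eq_zero {f : SmoothFn z} (hf : IsHolomorphicFn f) (q : Fin m) :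
    del (Sum.inr q) f = 0 := by
  refine SmoothFn.ext_target fun y hy => ?_
  have h := (hf.differentiableAt (z.open_target.mem_nhds hy)).fderiv_restrictScalars ℝ
  have h0 : coordRep z (0 : SmoothFn z) y = 0 := by simp [coordRep_of_mem _ hy]
  rw [h0]
  change coordRep z (dirDeriv (delZbar q) f) y = 0
  rw [coordRep_dirDeriv _ _ hy, h, extendOne]
  simp only [delZbar, single_I_div_two, ContinuousLinearMap.coe_restrictScalars', map_smul, smul_eq_mul]
  linear_combination (fderiv ℂ (coordRep z f) y (Pi.single q (1 / 2 : ℂ))) * Complex.I_mul_I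

theorem IsAntiholomorphicFn.del_eq_zero {f : SmoothFn z} (hf : IsAntiholomorphicFn f) (p : Fin m) :
    del (Sum.inl p) f = 0 := by
  refine SmoothFn.ext_target fun y hy => ?_
  have h1 := hf.differentiableAt (z.open_target.mem_nhds hy)
  have h : fderiv ℝ (coordRep z f) y = (Complex.conjCLE : ℂ →L[ℝ] ℂ).comp
      ((fderiv ℂ (fun y => star (coordRep z f y)) y).restrictScalars ℝ) := by
    have h2 := (Complex.conjCLE : ℂ →L[ℝ] ℂ).hasFDerivAt.comp y
      (h1.hasFDerivAt.restrictScalars ℝ)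
    rw [← h2.fderiv]
    congr 1
    funext x
    simp
  have h0 : coordRep z (0 : SmoothFn z) y = 0 := by simp [coordRep_of_mem _ hy]
  rw [h0]
  change coordRep z (dirDeriv (delZ p) f) y = 0
  rw [coordRep_dirDeriv _ _ hy, h, extendOne]
  simp only [delZ, single_I_div_two, ContinuousLinearMap.comp_apply,
    ContinuousLinearMap.coe_restrictScalars', map_neg, map_smul, smul_eq_mul]
  generalize fderiv ℂ (fun y => star (coordRep z f y)) y (Pi.single p (1 / 2 : ℂ)) = c
  simp only [ContinuousLinearEquiv.coe_coe, Complex.conjCLE_apply, map_mul, Complex.conj_I]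
  linear_combination ((starRingEnd ℂ) c) * Complex.I_mul_I

variable {Ω : ℕ → TwoForm m M} {Φ : ℕ → SmoothFn z}

theorem coeff_one_star_sub (hΦ : IsFormalPotential Ω Φ) (hP : IsUnit (hessian (Φ 0)).det)
    (f₁ f₂ : SmoothFn z) (x : z.source) :
    (PowerSeries.coeff 1 ((smoothAlgebra (Φ 0) hP).star Φ (PowerSeries.C f₁) (PowerSeries.C f₂))).1 x -
      (PowerSeries.coeff 1
        ((smoothAlgebra (Φ 0) hP).star Φ (PowerSeries.C f₂) (PowerSeries.C f₁))).1 x =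
      -Complex.I * poissonBracket (Ω 0) f₁ f₂ x := by
  have hH : IsUnit (hessianAt (Φ 0) x).det := by
    rw [hessianAt, ← RingHom.map_det]
    exact hP.map _
  have hd : ∀ (X : CTangent m) (f : SmoothFn z),
      evalAt x (dirDeriv X f) = extendOne (fderiv ℝ (coordRep z f) (z x)) X := fun X f => by
    rw [← coordRep_dirDeriv _ _ (z.map_source x.2), coordRep_apply]
    rfl
  have hg : ∀ q p, evalAt x ((smoothAlgebra (Φ 0) hP).g q p) = (hessianAt (Φ 0) x)⁻¹ q p :=
    fun q p => by rw [← metricMatrix_inv_apply hΦ hP, metricMatrix_eq (hΦ.inChart_apply x)]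
  have h : ∀ f u : SmoothFn z, (PowerSeries.coeff 1
      ((smoothAlgebra (Φ 0) hP).star Φ (PowerSeries.C f) (PowerSeries.C u))).1 x =
      ∑ q, ∑ p, (hessianAt (Φ 0) x)⁻¹ q p * (extendOne (fderiv ℝ (coordRep z f) (z x)) (delZbar q) *
        extendOne (fderiv ℝ (coordRep z u) (z x)) (delZ p)) := fun f u => by
    rw [PotentialAlgebra.coeff_one_star (smoothAlgebra (Φ 0) hP) rfl, ← evalAt_apply]
    simp only [map_sum, map_mul, hg]
    simp only [← hd]
    rfl
  rw [h, h, poissonBracket, extendTwo_hamiltonianVector (hΦ.inChart_apply x) hH, ← mul_assoc,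
    neg_mul, Complex.I_mul_I, neg_neg, one_mul]

theorem isGraphProduct_star (hΦ : IsFormalPotential Ω Φ) (hP : IsUnit (hessian (Φ 0)).det) :
    IsGraphProduct Ω Φ ((smoothAlgebra (Φ 0) hP).star Φ) := fun F G N x => by
  rw [PotentialAlgebra.coeff_star_eq_sum _ rfl, ← evalAt_apply, map_sum]
  refine sum_congr rfl fun a _ => ?_
  rw [map_sum]
  exact sum_congr rfl fun b _ => (graphOperator_eq hΦ hP _ _ _ x).symm

theorem isDeformationQuantization_star (hΦ : IsFormalPotential Ω Φ)
    (hP : IsUnit (hessian (Φ 0)).det) :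
    IsDeformationQuantization (poissonBracket (Ω 0)) ((smoothAlgebra (Φ 0) hP).star Φ) where
  assoc := PotentialAlgebra.star_assoc _ evalAt eq_zero_of_evalAt rfl
  add_left := PotentialAlgebra.star_add_left _ _
  add_right := PotentialAlgebra.star_add_right _ _
  smul_left := PotentialAlgebra.star_smul_left _ rfl
  smul_right c F G := PotentialAlgebra.star_smul_right _ rfl c F G
  zeroth := PotentialAlgebra.coeff_zero_star _ rfl
  first := coeff_one_star_sub hΦ hP

theorem isNormalized_star (hP : IsUnit (hessian (Φ 0)).det) :
    IsNormalized ((smoothAlgebra (Φ 0) hP).star Φ) := fun _ =>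
  ⟨PotentialAlgebra.one_star _ _, PotentialAlgebra.star_one _ _⟩

theorem hasSeparationOfVariables_star (hP : IsUnit (hessian (Φ 0)).det) :
    HasSeparationOfVariables ((smoothAlgebra (Φ 0) hP).star Φ) := fun f₁ f₂ h => by
  rw [PotentialAlgebra.star_eq_mul, map_mul]
  refine h.imp (fun h q => ?_) fun h p => ?_
  · rw [seriesDerivation_C]
    exact (congrArg PowerSeries.C (h.del_eq_zero q)).trans (map_zero _)
  · rw [seriesDerivation_C]
    exact (congrArg PowerSeries.C (h.del_eq_zero p)).trans (map_zero _)

end KahlerStar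
end

theorem theorem4p1 {m : ℕ} {M : Type*} [TopologicalSpace M]
    [ChartedSpace (KahlerStar.Coord m) M] [IsManifold 𝓘(ℂ, KahlerStar.Coord m) ω M]
    (Ω : ℕ → KahlerStar.TwoForm m M) (hΩ : KahlerStar.IsFormalDeformation Ω)
    (z : OpenPartialHomeomorph M (KahlerStar.Coord m)) (hz : KahlerStar.IsHolomorphicChart z)
    (Φ : ℕ → KahlerStar.SmoothFn z) (hΦ : KahlerStar.IsFormalPotential Ω Φ) :
    (∀ G : KahlerStar.WGraph 2, Finite (KahlerStar.WGraph.Iso G G) ∧ 0 ≤ G.totalWeight) ∧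
    (∀ k : ℕ, Finite (KahlerStar.GraphClassOfWeight 2 k)) ∧
    ∃ mul : (KahlerStar.SmoothFn z)⟦X⟧ → (KahlerStar.SmoothFn z)⟦X⟧ →
        (KahlerStar.SmoothFn z)⟦X⟧,
      KahlerStar.IsGraphProduct Ω Φ mul ∧
      KahlerStar.IsDeformationQuantization (KahlerStar.poissonBracket (Ω 0)) mul ∧
      KahlerStar.IsNormalized mul ∧
      KahlerStar.HasSeparationOfVariables mul := by
  have hP := KahlerStar.isUnit_det_hessian hΩ.kahler hz hΦ
  exact ⟨fun G => ⟨inferInstance, G.totalWeight_nonneg⟩, KahlerStar.finite_graphClassOfWeight,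
    (KahlerStar.smoothAlgebra (Φ 0) hP).star Φ, KahlerStar.isGraphProduct_star hΦ hP,
    KahlerStar.isDeformationQuantization_star hΦ hP, KahlerStar.isNormalized_star hP,
    KahlerStar.hasSeparationOfVariables_star hP⟩
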